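/- Let $n\ge 3$, let $K$ be a field and let $k$ be a PID. **Quivers and functors.** For $m\ge 3$ let $D_m^*$ be the quiver $1\to 2\to\cdots\to m-2$ with two further arrows $m-2\to m-1$ and $m-2\to m$, with dimension vector $\delta=(1,2,\dots,2,1,1)$. For $m\ge 2$ let $A_m^1$ be the quiver $1\to\cdots\to m-2\to m\leftarrow m-1$, so $A_2^1=A_2$ and $A^1_3$ is $1\to 3\leftarrow 2$. Let $A_m$ be the linear quiver $1\to\cdots\to m$. The quivers $A_m^1$ and $A_m$ carry the dimension vector $(1,\dots,1)$. Let $\operatorname{Mod}(Q)$ be the category of finite-dimensional representations of $Q$ over $K$. For an exceptional representation $E$ of $Q$ let $E^\perp=\{N\mid\operatorname{Hom}_Q(E,N)=\operatorname{Ext}_Q(E,N)=0\}$. Let $\pi_E$ be the left adjoint of the full embedding $\iota_E$ of $\operatorname{Mod}(Q_E)$, with $E^\perp\cong\operatorname{Mod}(Q_E)$. It is called the orthogonal projection through $E$, and $\iota_E$ is its section. $S_i$ and $I_i$ are the simple and the injective representation at the vertex $i$. **The configuration $\mathbf D_n^2$.** The vertices are $\operatorname{Mod}$ of $D_m^*$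 ($3\le m\le n+1$), of $A_m^1$ ($3\le m\le n$) and of $A_m$ ($1\le m\le n-1$), where $A_2$ also plays the role of $A_2^1$. The root is $(D_{n+1}^*,\delta)$. The arrows are: * the projections through $S_2,\dots,S_{m-1}$ from $D_{m+1}^*$ to $D_m^*$ (contraction at the vertex), with sections for $S_2,\dots,S_{m-2}$ ($3\le m\le n$); * the projections through $I_m$ and $I_{m+1}$ from $D_{m+1}^*$ to $A_m^1$ ($2\le m\le n$). Here $\pi_{I_j}(M)$ is $M_2/M_1\to\cdots\to M_{m-1}/M_1\to(M_m\oplus M_{m+1})/M_1\leftarrow M_{j'}$, where $\{j,j'\}=\{m,m+1\}$ and $/M_1$ means modulo the image of $M_1$; * the projections through $S_1,\dots,S_{m-1}$ from $A_{m+1}^1$ to $A_m^1$, with sections for $S_1,\dots,S_{m-2}$ ($2\le m\le n-1$); * the projections through $S_m$ from $A_{m+1}^1$ to $A_m$, which forget the vertex $m$ ($2\le m\le n-1$); * the projections through $S_1,\dots,S_m$ from $A_{m+1}$ to $A_m$, with sections for $S_1,\dots,S_{m-1}$ ($1\le m\le n-2$); * loops $t$ on each $D_m^*$ (exchange of the two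 sinks) and on $A_3^1$ (exchange of the two sources). All projections respect the dimension vectors in the sense that their sections take representations of the dimension vector of the target to representations of the dimension vector of the source, and all loops are automorphisms that preserve dimension vectors. The $k$-algebra $k\mathbf D_n^2$ is the path algebra over $k$ of the quiver with these vertices and arrows, modulo $p-q$ for all pairs of parallel paths $p,q$ that evaluate to isomorphic functors. **Proposition.** These functors are orthogonal projections, sections and automorphisms as described, and the algebra $k\mathbf D_n^2$ is Morita equivalent over $k$ to the following path algebra with relations. The vertices are those of $\mathbf D_n^2$. The arrows are $d:D_{m+1}^*\to D_m^*$ $(3\le m\le n)$, loops $t$ on $D_m^*$ $(3\le m\le n+1)$, $c:D_{m+1}^*\to A_m^1$ $(2\le m\le n)$, $a':A_{m+1}^1\to A_m^1$ $(2\le m\le n-1)$, a loop $t$ on $A_3^1$, $b:A_{m+1}^1\to A_m$ $(3\le m\le n-1)$ and $a:A_{m+1}\to A_m$ $(1\le m\le n-2)$. The arrow $a':A_3^1\to A_2^1=A_2$ is denoted by $a'/b$, and the last arrow $a:A_2\to A_1$ by $a/b$. With products written in the order of composition, the relations, imposed wherever the arrows are composable, are $$t^2=e,\quad tdt=d,\quad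 cd=a'c,\quad ctd=a'ct,\quad ab=ba',\quad b(c-ct)=0,\quad dd=0,\quad a'a'=0,\quad aa=0.$$ In them $a'/b$ satisfies all relations of $a'$ and $(a'/b)\,t$ satisfies all relations of $b$; the arrow $a/b$ satisfies all relations of $a$ and all relations of $b$. So, on the last vertices, $(a'/b)a'=0$, $cd=(a'/b)c$ and $ctd=(a'/b)ct$ on $D_4^*$, $ab=(a'/b)\,t\,a'$ on $A_4^1$, $(a'/b)\,t\,(c-ct)=0$ on $D_4^*$, $(a/b)(a'/b)t=(a/b)(a'/b)$ on $A_3^1$, $(a/b)(c-ct)=0$ on $D_3^*$, and $(a/b)a=0$ on $A_3$. -/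

import Mathlib

open CategoryTheory

universe u w

noncomputable section

/-! ### Representations of quivers over a field -/

/-- A finite dimensional representation over `K` of a quiver `V`. -/
structure QRep (K : Type w) [Field K] (V : Type) [Quiver.{0} V] where
  X : V → Type w
  [addCommGroup : ∀ v, AddCommGroup (X v)]
  [module : ∀ v, Module K (X v)]
  [finite : ∀ v, Module.Finite K (X v)]
  map : ∀ {a b : V}, (a ⟶ b) → (X a →ₗ[K] X b)

namespace QRep

attribute [instance] QRep.addCommGroup QRep.module QRep.finite

section

variable {K : Type w} [Field K] {V W : Type} [Quiver.{0} V] [Quiver.{0} W]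

/-- Morphisms of representations. -/
@[ext]
structure Hom (M N : QRep K V) where
  app : ∀ v, M.X v →ₗ[K] N.X v
  comm : ∀ {a b : V} (e : a ⟶ b), app b ∘ₗ M.map e = N.map e ∘ₗ app a

instance : Category (QRep K V) where
  Hom M N := Hom M N
  id M := ⟨fun _ => LinearMap.id, fun _ => rfl⟩
  comp f g := ⟨fun v => g.app v ∘ₗ f.app v, fun e => by
    rw [LinearMap.comp_assoc, f.comm, ← LinearMap.comp_assoc, g.comm, LinearMap.comp_assoc]⟩

/-- The linear map attached to a path. -/
def pathMap (M : QRep K V) {a : V} : ∀ {b : V}, Quiver.Path a b → (M.X a →ₗ[K] M.X b)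
  | _, .nil => LinearMap.id
  | _, .cons p e => M.map e ∘ₗ M.pathMap p

theorem Hom.comm_path {M N : QRep K V} (f : Hom M N) {a b : V} (p : Quiver.Path a b) :
    f.app b ∘ₗ M.pathMap p = N.pathMap p ∘ₗ f.app a := by
  induction p with
  | nil => rfl
  | cons p e ih =>
    simp only [pathMap]
    rw [← LinearMap.comp_assoc, f.comm, LinearMap.comp_assoc, ih, LinearMap.comp_assoc]

/-- The dimension vector. -/
def dimVec (M : QRep K V) : V → ℕ := fun v => Module.finrank K (M.X v)

/-- Pull-back of representations along a map of vertices which sends arrows to paths. It is only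
used for trees, where there is at most one path between two vertices, so that the choice of the
paths is no choice at all. -/
def restrict (φ : W → V) (h : ∀ a b : W, (a ⟶ b) → Nonempty (Quiver.Path (φ a) (φ b))) :
    QRep K V ⥤ QRep K W where
  obj M :=
    { X := fun a => M.X (φ a)
      map := fun {a b} e => M.pathMap (h a b e).some }
  map f := ⟨fun a => f.app (φ a), fun _ => f.comm_path _⟩
  map_id _ := rfl
  map_comp _ _ := rfl

/-- The simple representation `S_v` at a vertex `v`. -/
def simple (K : Type w) [Field K] {V : Type} [Quiver.{0} V] (v : V) : QRep K V where
  X a := PLift (a = v) → K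
  map _ := 0

/-- The injective representation `I_v`: its space at `a` is dual to the space with basis the paths
from `a` to `v`. -/
def injective (K : Type w) [Field K] {V : Type} [Quiver.{0} V] (v : V)
    [∀ a : V, Finite (Quiver.Path a v)] : QRep K V where
  X a := Quiver.Path a v → K
  map e := LinearMap.funLeft K K (fun p => e.toPath.comp p)

/-- `Hom(E, N) = 0`. -/
def HomVanish (E N : QRep K V) : Prop := ∀ (f : E ⟶ N) (v : V), f.app v = 0

/-- `Ext(E, N) = 0`: every extension of `E` by `N` splits. -/
def ExtVanish (E N : QRep K V) : Prop :=
  ∀ (M : QRep K V) (i : N ⟶ M) (p : M ⟶ E),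
    (∀ v, Function.Injective (i.app v)) → (∀ v, Function.Surjective (p.app v)) →
    (∀ v, LinearMap.range (i.app v) = LinearMap.ker (p.app v)) →
    ∃ s : E ⟶ M, s ≫ p = 𝟙 E

/-- `E ⊥ N`. -/
def Perp (E N : QRep K V) : Prop := HomVanish E N ∧ ExtVanish E N

/-- `E` is exceptional: its endomorphisms are the scalars, it is not zero, and it has no
self-extensions. -/
structure IsExceptional (E : QRep K V) : Prop where
  ne_zero : ∃ v, Nontrivial (E.X v)
  scalar : ∀ f : E ⟶ E, ∃ c : K, ∀ (v : V) (x : E.X v), f.app v x = c • x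
  ext : ExtVanish E E

/-- `π` is the orthogonal projection `π_E` to the quiver `W`, and it respects the dimension
vectors `α` and `β`: `E` is exceptional, `π` is left adjoint to a full embedding `ι` whose
essential image is the right orthogonal category of `E`, and `ι` takes representations of
dimension `β` to representations of dimension `α`. -/
def IsOrthogonalProjection (E : QRep K V) (α : V → ℕ) (β : W → ℕ) (π : QRep K V ⥤ QRep K W) :
    Prop :=
  IsExceptional E ∧ ∃ ι : QRep K W ⥤ QRep K V,
    Nonempty (π ⊣ ι) ∧ ι.Full ∧ ι.Faithful ∧ (∀ N, ι.essImage N ↔ Perp E N) ∧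
    ∀ N, dimVec N = β → dimVec (ι.obj N) = α

end

end QRep

/-! ### The quivers -/

/-- Vertices of the quiver `D*_{p+3}`: `src` is `1`, `mid 0, …, mid (p-1)` are `2, …, p+1`, and
`snk false`, `snk true` are the two sinks `p+2`, `p+3`. -/
inductive DVert (p : ℕ) : Type
  | src : DVert p
  | mid (i : Fin p) : DVert p
  | snk (b : Bool) : DVert p

/-- Arrows `1 → 2 → ⋯ → p+1` and `p+1 → p+2`, `p+1 → p+3`. -/
def DVert.Adj {p : ℕ} : DVert p → DVert p → Prop
  | .src, .mid i => i.val = 0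
  | .src, .snk _ => p = 0
  | .mid i, .mid j => j.val = i.val + 1
  | .mid i, .snk _ => i.val + 1 = p
  | _, _ => False

instance (p : ℕ) : Quiver.{0} (DVert p) := ⟨fun a b => PLift (a.Adj b)⟩

/-- Vertices of the quiver `A¹_{q+2}`: a linear quiver `chain 0 → ⋯ → chain (q-1) → sink` with one
more arrow `extra → sink`. In the numbering `1, …, q+2` the vertex `extra` is `q+1` and `sink` is
`q+2`. -/
inductive TVert (q : ℕ) : Type
  | chain (i : Fin q) : TVert q
  | extra : TVert q
  | sink : TVert q

/-- Arrows of `A¹_{q+2}`. -/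
def TVert.Adj {q : ℕ} : TVert q → TVert q → Prop
  | .chain i, .chain j => j.val = i.val + 1
  | .chain i, .sink => i.val + 1 = q
  | .extra, .sink => True
  | _, _ => False

instance (q : ℕ) : Quiver.{0} (TVert q) := ⟨fun a b => PLift (a.Adj b)⟩

/-- Vertices of the linear quiver `A_{r+1}`: `chain 0 → ⋯ → chain (r-1) → sink`. -/
inductive AVert (r : ℕ) : Type
  | chain (i : Fin r) : AVert r
  | sink : AVert r

/-- Arrows of `A_{r+1}`. -/
def AVert.Adj {r : ℕ} : AVert r → AVert r → Prop
  | .chain i, .chain j => j.val = i.val + 1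
  | .chain i, .sink => i.val + 1 = r
  | _, _ => False

instance (r : ℕ) : Quiver.{0} (AVert r) := ⟨fun a b => PLift (a.Adj b)⟩

/-! ### Paths in these quivers -/

theorem DVert.reach_mid_mid {p : ℕ} (i : Fin p) : ∀ (d : ℕ) (j : Fin p), j.val = i.val + d →
    Nonempty (Quiver.Path (DVert.mid i) (DVert.mid j))
  | 0, j, h => by
    obtain rfl : j = i := Fin.ext h
    exact ⟨.nil⟩
  | d + 1, j, h => by
    obtain ⟨x⟩ := DVert.reach_mid_mid i d ⟨i.val + d, by omega⟩ rfl
    exact ⟨x.cons ⟨h⟩⟩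

theorem DVert.reach_mid_snk {p : ℕ} (i : Fin p) (b : Bool) :
    Nonempty (Quiver.Path (DVert.mid i) (DVert.snk b)) := by
  obtain ⟨x⟩ := DVert.reach_mid_mid i (p - 1 - i.val) ⟨p - 1, by have := i.isLt; omega⟩
    (by have := i.isLt; change p - 1 = i.val + (p - 1 - i.val); omega)
  exact ⟨x.cons ⟨by have := i.isLt; change p - 1 + 1 = p; omega⟩⟩

theorem DVert.reach_src_mid {p : ℕ} (j : Fin p) :
    Nonempty (Quiver.Path (DVert.src) (DVert.mid j)) := by
  have hp : 0 < p := lt_of_le_of_lt (Nat.zero_le _) j.isLt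
  obtain ⟨x⟩ := DVert.reach_mid_mid ⟨0, hp⟩ j.val j (by simp)
  have e : (DVert.src : DVert p) ⟶ DVert.mid ⟨0, hp⟩ := ⟨rfl⟩
  exact ⟨e.toPath.comp x⟩

theorem DVert.reach_src_snk {p : ℕ} (b : Bool) :
    Nonempty (Quiver.Path (DVert.src : DVert p) (DVert.snk b)) := by
  rcases Nat.eq_zero_or_pos p with h | h
  · exact ⟨Quiver.Path.nil.cons ⟨h⟩⟩
  · obtain ⟨x⟩ := DVert.reach_src_mid (⟨0, h⟩ : Fin p)
    obtain ⟨y⟩ := DVert.reach_mid_snk (⟨0, h⟩ : Fin p) b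
    exact ⟨x.comp y⟩

theorem TVert.reach_chain_chain {q : ℕ} (i : Fin q) : ∀ (d : ℕ) (j : Fin q), j.val = i.val + d →
    Nonempty (Quiver.Path (TVert.chain i) (TVert.chain j))
  | 0, j, h => by
    obtain rfl : j = i := Fin.ext h
    exact ⟨.nil⟩
  | d + 1, j, h => by
    obtain ⟨x⟩ := TVert.reach_chain_chain i d ⟨i.val + d, by omega⟩ rfl
    exact ⟨x.cons ⟨h⟩⟩

theorem TVert.reach_chain_sink {q : ℕ} (i : Fin q) :
    Nonempty (Quiver.Path (TVert.chain i) TVert.sink) := by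
  obtain ⟨x⟩ := TVert.reach_chain_chain i (q - 1 - i.val) ⟨q - 1, by have := i.isLt; omega⟩
    (by have := i.isLt; change q - 1 = i.val + (q - 1 - i.val); omega)
  exact ⟨x.cons ⟨by have := i.isLt; change q - 1 + 1 = q; omega⟩⟩

theorem TVert.reach_extra_sink {q : ℕ} :
    Nonempty (Quiver.Path (TVert.extra : TVert q) TVert.sink) :=
  ⟨Quiver.Path.nil.cons ⟨trivial⟩⟩

theorem AVert.reach_chain_chain {r : ℕ} (i : Fin r) : ∀ (d : ℕ) (j : Fin r), j.val = i.val + d →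
    Nonempty (Quiver.Path (AVert.chain i) (AVert.chain j))
  | 0, j, h => by
    obtain rfl : j = i := Fin.ext h
    exact ⟨.nil⟩
  | d + 1, j, h => by
    obtain ⟨x⟩ := AVert.reach_chain_chain i d ⟨i.val + d, by omega⟩ rfl
    exact ⟨x.cons ⟨h⟩⟩

theorem AVert.reach_chain_sink {r : ℕ} (i : Fin r) :
    Nonempty (Quiver.Path (AVert.chain i) AVert.sink) := by
  obtain ⟨x⟩ := AVert.reach_chain_chain i (r - 1 - i.val) ⟨r - 1, by have := i.isLt; omega⟩
    (by have := i.isLt; change r - 1 = i.val + (r - 1 - i.val); omega)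
  exact ⟨x.cons ⟨by have := i.isLt; change r - 1 + 1 = r; omega⟩⟩

/-- The distance from the source. -/
def DVert.pos {p : ℕ} : DVert p → ℕ
  | .src => 0
  | .mid i => i.val + 1
  | .snk _ => p + 1

theorem DVert.pos_arrow {p : ℕ} : ∀ {a b : DVert p}, (a ⟶ b) → b.pos = a.pos + 1
  | .src, .mid _, ⟨h⟩ => congrArg (· + 1) h
  | .src, .snk _, ⟨h⟩ => congrArg (· + 1) h
  | .mid _, .mid _, ⟨h⟩ => congrArg (· + 1) h
  | .mid _, .snk _, ⟨h⟩ => congrArg (· + 1) (Eq.symm h)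

theorem DVert.pos_path {p : ℕ} {a b : DVert p} (x : Quiver.Path a b) :
    b.pos = a.pos + x.length := by
  induction x with
  | nil => rfl
  | cons x e ih => rw [DVert.pos_arrow e, ih, Quiver.Path.length_cons, Nat.add_assoc]

/-- Every vertex of `D*_{p+3}` is the head of at most one arrow. -/
theorem DVert.tail_unique {p : ℕ} {a b c : DVert p} (e : a ⟶ c) (f : b ⟶ c) : a = b := by
  have h := (DVert.pos_arrow e).symm.trans (DVert.pos_arrow f)
  cases a <;> cases b <;> cases c <;> simp only [DVert.pos, DVert.mid.injEq] at * <;>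
    first
    | exact e.down.elim
    | exact f.down.elim
    | exact Fin.ext (by omega)
    | omega

instance DVert.subsingletonArrow {p : ℕ} (a b : DVert p) : Subsingleton (a ⟶ b) :=
  inferInstanceAs (Subsingleton (PLift (a.Adj b)))

instance DVert.subsingletonPath {p : ℕ} (a b : DVert p) : Subsingleton (Quiver.Path a b) := by
  refine ⟨fun x => ?_⟩
  induction x with
  | nil =>
    intro y
    have hy := DVert.pos_path y
    cases y with
    | nil => rfl
    | cons y e => rw [Quiver.Path.length_cons] at hy; omega
  | cons x e ih =>
    intro y
    have hx := DVert.pos_path (x.cons e)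
    cases y with
    | nil => rw [Quiver.Path.length_cons] at hx; omega
    | cons y f =>
      obtain rfl := DVert.tail_unique e f
      rw [ih y, Subsingleton.elim e f]

/-! ### The functors -/

section Functors

variable (K : Type w) [Field K]

/-- The map of vertices given by a monotone map of the middle vertices and a map of the sinks. -/
def DVert.mapV {p q : ℕ} (f : Fin q →o Fin p) (g : Bool → Bool) : DVert q → DVert p
  | .src => .src
  | .mid i => .mid (f i)
  | .snk b => .snk (g b)

theorem DVert.mapV_arrow {p q : ℕ} (f : Fin q →o Fin p) (g : Bool → Bool) :
    ∀ a b : DVert q, (a ⟶ b) → Nonempty (Quiver.Path (mapV f g a) (mapV f g b))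
  | .src, .mid j, _ => DVert.reach_src_mid (f j)
  | .src, .snk b, _ => DVert.reach_src_snk (g b)
  | .mid i, .mid j, ⟨h⟩ => DVert.reach_mid_mid (f i) ((f j).val - (f i).val) (f j) (by
      have h0 : j.val = i.val + 1 := h
      have h1 : i ≤ j := by rw [Fin.le_def]; omega
      have h2 : (f i).val ≤ (f j).val := f.monotone h1
      omega)
  | .mid i, .snk b, _ => DVert.reach_mid_snk (f i) (g b)

/-- The map of vertices given by a monotone map of the chains. -/
def TVert.mapV {p q : ℕ} (f : Fin q →o Fin p) : TVert q → TVert p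
  | .chain i => .chain (f i)
  | .extra => .extra
  | .sink => .sink

theorem TVert.mapV_arrow {p q : ℕ} (f : Fin q →o Fin p) :
    ∀ a b : TVert q, (a ⟶ b) → Nonempty (Quiver.Path (mapV f a) (mapV f b))
  | .chain i, .chain j, ⟨h⟩ => TVert.reach_chain_chain (f i) ((f j).val - (f i).val) (f j) (by
      have h0 : j.val = i.val + 1 := h
      have h1 : i ≤ j := by rw [Fin.le_def]; omega
      have h2 : (f i).val ≤ (f j).val := f.monotone h1
      omega)
  | .chain i, .sink, _ => TVert.reach_chain_sink (f i)
  | .extra, .sink, _ => TVert.reach_extra_sink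

/-- The map of vertices given by a monotone map of the chains. -/
def AVert.mapV {p q : ℕ} (f : Fin q →o Fin p) : AVert q → AVert p
  | .chain i => .chain (f i)
  | .sink => .sink

theorem AVert.mapV_arrow {p q : ℕ} (f : Fin q →o Fin p) :
    ∀ a b : AVert q, (a ⟶ b) → Nonempty (Quiver.Path (mapV f a) (mapV f b))
  | .chain i, .chain j, ⟨h⟩ => AVert.reach_chain_chain (f i) ((f j).val - (f i).val) (f j) (by
      have h0 : j.val = i.val + 1 := h
      have h1 : i ≤ j := by rw [Fin.le_def]; omega
      have h2 : (f i).val ≤ (f j).val := f.monotone h1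
      omega)
  | .chain i, .sink, _ => AVert.reach_chain_sink (f i)

/-- The inclusion of `A_{q+1}` in `A¹_{q+2}` that misses `extra`. -/
def AVert.toTVert {q : ℕ} : AVert q → TVert q
  | .chain i => .chain i
  | .sink => .sink

theorem AVert.toTVert_arrow {q : ℕ} :
    ∀ a b : AVert q, (a ⟶ b) → Nonempty (Quiver.Path (toTVert a) (toTVert b))
  | .chain _, .chain _, ⟨h⟩ => ⟨Quiver.Path.nil.cons ⟨h⟩⟩
  | .chain i, .sink, _ => TVert.reach_chain_sink i

/-- The exchange of the two sources of `A¹_3`. -/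
def TVert.swapV : TVert 1 → TVert 1
  | .chain _ => .extra
  | .extra => .chain 0
  | .sink => .sink

theorem TVert.swapV_arrow :
    ∀ a b : TVert 1, (a ⟶ b) → Nonempty (Quiver.Path (swapV a) (swapV b))
  | .chain i, .chain j, ⟨h⟩ => absurd h (by
      have := i.isLt
      have := j.isLt
      change ¬ (j.val = i.val + 1)
      omega)
  | .chain _, .sink, _ => TVert.reach_extra_sink
  | .extra, .sink, _ => TVert.reach_chain_sink 0

/-- The isomorphism of `A_2` with `A¹_2`. -/
def AVert.foldV : AVert 1 → TVert 0
  | .chain _ => .extra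
  | .sink => .sink

theorem AVert.foldV_arrow :
    ∀ a b : AVert 1, (a ⟶ b) → Nonempty (Quiver.Path (foldV a) (foldV b))
  | .chain i, .chain j, ⟨h⟩ => absurd h (by
      have := i.isLt
      have := j.isLt
      change ¬ (j.val = i.val + 1)
      omega)
  | .chain _, .sink, _ => TVert.reach_extra_sink

/-- The contraction at the vertex `mid i`. -/
def dProj {p : ℕ} (i : Fin (p + 1)) : QRep K (DVert (p + 1)) ⥤ QRep K (DVert p) :=
  QRep.restrict (DVert.mapV (Fin.succAboveOrderEmb i).toOrderHom id) (DVert.mapV_arrow _ _)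

/-- The functor which repeats the space at `mid i`, with the identity between the two copies. It
is right adjoint to the contraction at the first of the two copies. -/
def dSect {p : ℕ} (i : Fin p) : QRep K (DVert p) ⥤ QRep K (DVert (p + 1)) :=
  QRep.restrict (DVert.mapV (Fin.predAboveOrderHom i) id) (DVert.mapV_arrow _ _)

/-- The exchange of the two sinks. -/
def dSwap {p : ℕ} : QRep K (DVert p) ⥤ QRep K (DVert p) :=
  QRep.restrict (DVert.mapV OrderHom.id not) (DVert.mapV_arrow _ _)

/-- The contraction at the vertex `chain i`. -/
def tProj {q : ℕ} (i : Fin (q + 1)) : QRep K (TVert (q + 1)) ⥤ QRep K (TVert q) :=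
  QRep.restrict (TVert.mapV (Fin.succAboveOrderEmb i).toOrderHom) (TVert.mapV_arrow _)

/-- The functor which repeats the space at `chain i`. -/
def tSect {q : ℕ} (i : Fin q) : QRep K (TVert q) ⥤ QRep K (TVert (q + 1)) :=
  QRep.restrict (TVert.mapV (Fin.predAboveOrderHom i)) (TVert.mapV_arrow _)

/-- The exchange of the two sources of `A¹_3`. -/
def tSwap : QRep K (TVert 1) ⥤ QRep K (TVert 1) :=
  QRep.restrict TVert.swapV TVert.swapV_arrow

/-- The functor which forgets the vertex `extra`. -/
def tForget {q : ℕ} : QRep K (TVert q) ⥤ QRep K (AVert q) :=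
  QRep.restrict AVert.toTVert AVert.toTVert_arrow

/-- The identification of the representations of `A¹_2` with those of `A_2`. -/
def tFold : QRep K (TVert 0) ⥤ QRep K (AVert 1) :=
  QRep.restrict AVert.foldV AVert.foldV_arrow

/-- The contraction at the vertex `chain i`. -/
def aProj {r : ℕ} (i : Fin (r + 1)) : QRep K (AVert (r + 1)) ⥤ QRep K (AVert r) :=
  QRep.restrict (AVert.mapV (Fin.succAboveOrderEmb i).toOrderHom) (AVert.mapV_arrow _)

/-- The functor which repeats the space at `chain i`. -/
def aSect {r : ℕ} (i : Fin r) : QRep K (AVert r) ⥤ QRep K (AVert (r + 1)) :=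
  QRep.restrict (AVert.mapV (Fin.predAboveOrderHom i)) (AVert.mapV_arrow _)

variable {K}

/-- The image of `M(src)` in `M(mid i)`; there is exactly one path from `src` to `mid i`. -/
def midImage {p : ℕ} (M : QRep K (DVert p)) (i : Fin p) : Submodule K (M.X (.mid i)) :=
  ⨆ x : Quiver.Path DVert.src (DVert.mid i), LinearMap.range (M.pathMap x)

/-- The image of `M(src)` in the sum of the spaces at the two sinks. -/
def snkImage {p : ℕ} (M : QRep K (DVert p)) :
    Submodule K (M.X (.snk false) × M.X (.snk true)) :=
  ⨆ x : Quiver.Path DVert.src (DVert.snk false) × Quiver.Path DVert.src (DVert.snk true),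
    LinearMap.range ((M.pathMap x.1).prod (M.pathMap x.2))

theorem midImage_le_mid {p : ℕ} (M : QRep K (DVert p)) {i j : Fin p}
    (e : DVert.mid i ⟶ DVert.mid j) :
    midImage M i ≤ (midImage M j).comap (M.map e) := by
  refine iSup_le fun x => ?_
  rintro _ ⟨y, rfl⟩
  exact Submodule.mem_iSup_of_mem (x.cons e) ⟨y, rfl⟩

theorem midImage_le_snk {p : ℕ} (M : QRep K (DVert p)) {i : Fin p}
    (e : ∀ b, DVert.mid i ⟶ DVert.snk b) :
    midImage M i ≤ (snkImage M).comap ((M.map (e false)).prod (M.map (e true))) := by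
  refine iSup_le fun x => ?_
  rintro _ ⟨y, rfl⟩
  exact Submodule.mem_iSup_of_mem (x.cons (e false), x.cons (e true)) ⟨y, rfl⟩

theorem midImage_le_map {p : ℕ} {M N : QRep K (DVert p)} (f : M ⟶ N) (i : Fin p) :
    midImage M i ≤ (midImage N i).comap (f.app (.mid i)) := by
  refine iSup_le fun x => ?_
  rintro _ ⟨y, rfl⟩
  exact Submodule.mem_iSup_of_mem x ⟨f.app _ y, (LinearMap.congr_fun (f.comm_path x) y).symm⟩

theorem snkImage_le_map {p : ℕ} {M N : QRep K (DVert p)} (f : M ⟶ N) :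
    snkImage M ≤
      (snkImage N).comap ((f.app (.snk false)).prodMap (f.app (.snk true))) := by
  refine iSup_le fun x => ?_
  rintro _ ⟨y, rfl⟩
  exact Submodule.mem_iSup_of_mem x ⟨f.app _ y, Prod.ext
    (LinearMap.congr_fun (f.comm_path x.1) y).symm
    (LinearMap.congr_fun (f.comm_path x.2) y).symm⟩

/-- The spaces of the projection of `M` through `I_{snk b}`. -/
def iProjX {p : ℕ} (b : Bool) (M : QRep K (DVert p)) : TVert p → Type w
  | .chain i => M.X (.mid i) ⧸ midImage M i
  | .extra => M.X (.snk (!b))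
  | .sink => (M.X (.snk false) × M.X (.snk true)) ⧸ snkImage M

instance {p : ℕ} (b : Bool) (M : QRep K (DVert p)) : ∀ v, AddCommGroup (iProjX b M v)
  | .chain i => inferInstanceAs (AddCommGroup (M.X (.mid i) ⧸ midImage M i))
  | .extra => inferInstanceAs (AddCommGroup (M.X (.snk (!b))))
  | .sink => inferInstanceAs
      (AddCommGroup ((M.X (.snk false) × M.X (.snk true)) ⧸ snkImage M))

instance {p : ℕ} (b : Bool) (M : QRep K (DVert p)) : ∀ v, Module K (iProjX b M v)
  | .chain i => inferInstanceAs (Module K (M.X (.mid i) ⧸ midImage M i))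
  | .extra => inferInstanceAs (Module K (M.X (.snk (!b))))
  | .sink => inferInstanceAs
      (Module K ((M.X (.snk false) × M.X (.snk true)) ⧸ snkImage M))

instance {p : ℕ} (b : Bool) (M : QRep K (DVert p)) : ∀ v, Module.Finite K (iProjX b M v)
  | .chain i => inferInstanceAs (Module.Finite K (M.X (.mid i) ⧸ midImage M i))
  | .extra => inferInstanceAs (Module.Finite K (M.X (.snk (!b))))
  | .sink => inferInstanceAs
      (Module.Finite K ((M.X (.snk false) × M.X (.snk true)) ⧸ snkImage M))

/-- The inclusion of the space at the sink `snk c` in the sum over both sinks. -/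
def snkIncl {p : ℕ} (M : QRep K (DVert p)) :
    ∀ c : Bool, M.X (.snk c) →ₗ[K] M.X (.snk false) × M.X (.snk true)
  | false => LinearMap.inl K _ _
  | true => LinearMap.inr K _ _

/-- The maps of the projection of `M` through `I_{snk b}`. -/
def iProjMap {p : ℕ} (b : Bool) (M : QRep K (DVert p)) :
    ∀ {a c : TVert p}, (a ⟶ c) → (iProjX b M a →ₗ[K] iProjX b M c)
  | .chain i, .chain j, ⟨h⟩ =>
      Submodule.mapQ (midImage M i) (midImage M j)
        (M.map (show DVert.mid i ⟶ DVert.mid j from ⟨h⟩)) (midImage_le_mid M _)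
  | .chain i, .sink, ⟨h⟩ =>
      Submodule.mapQ (midImage M i) (snkImage M)
        ((M.map (show DVert.mid i ⟶ DVert.snk false from ⟨h⟩)).prod
          (M.map (show DVert.mid i ⟶ DVert.snk true from ⟨h⟩)))
        (midImage_le_snk M fun _ => ⟨h⟩)
  | .extra, .sink, _ => (snkImage M).mkQ ∘ₗ snkIncl M (!b)

/-- The components of the projection through `I_{snk b}` on morphisms. -/
def iProjApp {p : ℕ} (b : Bool) {M N : QRep K (DVert p)} (f : M ⟶ N) :
    ∀ v, iProjX b M v →ₗ[K] iProjX b N v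
  | .chain i => Submodule.mapQ (midImage M i) (midImage N i) (f.app (.mid i))
      (midImage_le_map f i)
  | .extra => f.app (.snk (!b))
  | .sink => Submodule.mapQ (snkImage M) (snkImage N)
      ((f.app (.snk false)).prodMap (f.app (.snk true))) (snkImage_le_map f)

theorem iProjApp_comm {p : ℕ} (b : Bool) {M N : QRep K (DVert p)} (f : M ⟶ N) :
    ∀ {a c : TVert p} (e : a ⟶ c),
      iProjApp b f c ∘ₗ iProjMap b M e = iProjMap b N e ∘ₗ iProjApp b f a
  | .chain i, .chain j, ⟨h⟩ => by
    refine Submodule.linearMap_qext _ (LinearMap.ext fun x => ?_)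
    exact congrArg (midImage N j).mkQ
      (LinearMap.congr_fun (f.comm (show DVert.mid i ⟶ DVert.mid j from ⟨h⟩)) x)
  | .chain i, .sink, ⟨h⟩ => by
    refine Submodule.linearMap_qext _ (LinearMap.ext fun x => ?_)
    exact congrArg (snkImage N).mkQ (Prod.ext
      (LinearMap.congr_fun (f.comm (show DVert.mid i ⟶ DVert.snk false from ⟨h⟩)) x)
      (LinearMap.congr_fun (f.comm (show DVert.mid i ⟶ DVert.snk true from ⟨h⟩)) x))
  | .extra, .sink, _ => by
    refine LinearMap.ext fun x => ?_
    cases b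
    · exact congrArg (snkImage N).mkQ (Prod.ext (map_zero (f.app (.snk false))) rfl)
    · exact congrArg (snkImage N).mkQ (Prod.ext rfl (map_zero (f.app (.snk true))))

variable (K)

/-- The projection through `I_{snk b}`, from `D*_{p+3}` to `A¹_{p+2}`. It takes `M` to
`M(mid 0)/M(src) → ⋯ → M(mid (p-1))/M(src) → (M(snk false) ⊕ M(snk true))/M(src) ← M(snk (!b))`. -/
def iProj {p : ℕ} (b : Bool) : QRep K (DVert p) ⥤ QRep K (TVert p) where
  obj M := { X := iProjX b M, map := fun e => iProjMap b M e }
  map f := ⟨iProjApp b f, fun e => iProjApp_comm b f e⟩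
  map_id M := by
    refine QRep.Hom.ext (funext fun v => ?_)
    cases v with
    | chain i => exact Submodule.linearMap_qext _ rfl
    | extra => rfl
    | sink => exact Submodule.linearMap_qext _ rfl
  map_comp f g := by
    refine QRep.Hom.ext (funext fun v => ?_)
    cases v with
    | chain i => exact Submodule.linearMap_qext _ rfl
    | extra => rfl
    | sink => exact Submodule.linearMap_qext _ rfl

end Functors

/-! ### The configuration rooted at `D*_{N+3}` -/

/-- Vertices of the configuration: `D p` is `D*_{p+3}` for `0 ≤ p ≤ N`, `T q` is `A¹_{q+3}` for
`0 ≤ q < N`, and `A r` is `A_{r+1}` for `0 ≤ r ≤ N`. There is no separate vertex for `A¹_2`, since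
it is `A_2`. -/
inductive CVert (N : ℕ) : Type
  | D (p : ℕ) (h : p ≤ N) : CVert N
  | T (q : ℕ) (h : q < N) : CVert N
  | A (r : ℕ) (h : r ≤ N) : CVert N

instance (N : ℕ) : Fintype (CVert N) :=
  haveI := Classical.decEq (CVert N)
  Fintype.ofSurjective
    (fun x : Fin (N + 1) ⊕ Fin N ⊕ Fin (N + 1) => match x with
      | .inl p => CVert.D p.val (Nat.le_of_lt_succ p.isLt)
      | .inr (.inl q) => CVert.T q.val q.isLt
      | .inr (.inr r) => CVert.A r.val (Nat.le_of_lt_succ r.isLt))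
    (fun v => match v with
      | .D p h => ⟨.inl ⟨p, Nat.lt_succ_of_le h⟩, rfl⟩
      | .T q h => ⟨.inr (.inl ⟨q, h⟩), rfl⟩
      | .A r h => ⟨.inr (.inr ⟨r, Nat.lt_succ_of_le h⟩), rfl⟩)

/-- The vertices of the quiver placed at a vertex of the configuration. -/
def CVert.Verts {N : ℕ} : CVert N → Type
  | .D p _ => DVert p
  | .T q _ => TVert (q + 1)
  | .A r _ => AVert r

instance {N : ℕ} : ∀ v : CVert N, Quiver.{0} v.Verts
  | .D p _ => inferInstanceAs (Quiver (DVert p))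
  | .T q _ => inferInstanceAs (Quiver (TVert (q + 1)))
  | .A r _ => inferInstanceAs (Quiver (AVert r))

/-- The dimension vectors: `(1, 2, …, 2, 1, 1)` on `D*_{p+3}`, and `(1, …, 1)` on the others. -/
def CVert.dim {N : ℕ} : ∀ v : CVert N, v.Verts → ℕ
  | .D _ _ => fun x => match x with
    | .src => 1
    | .mid _ => 2
    | .snk _ => 1
  | .T _ _ => fun _ => 1
  | .A _ _ => fun _ => 1

/-- Arrows of the configuration: projections, sections and loops. -/
inductive CArrow (N : ℕ) : CVert N → CVert N → Type
  | dS (p : ℕ) (h : p + 1 ≤ N) (i : Fin (p + 1)) :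
      CArrow N (.D (p + 1) h) (.D p (Nat.le_of_succ_le h))
  | dR (p : ℕ) (h : p + 1 ≤ N) (i : Fin p) :
      CArrow N (.D p (Nat.le_of_succ_le h)) (.D (p + 1) h)
  | dT (p : ℕ) (h : p ≤ N) : CArrow N (.D p h) (.D p h)
  | dI (q : ℕ) (h : q + 1 ≤ N) (b : Bool) : CArrow N (.D (q + 1) h) (.T q h)
  | dIZero (h : 1 ≤ N) (b : Bool) : CArrow N (.D 0 (Nat.zero_le N)) (.A 1 h)
  | tS (q : ℕ) (h : q + 1 < N) (i : Fin (q + 2)) :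
      CArrow N (.T (q + 1) h) (.T q (Nat.lt_of_succ_lt h))
  | tSZero (h : 0 < N) : CArrow N (.T 0 h) (.A 1 h)
  | tR (q : ℕ) (h : q + 1 < N) (i : Fin (q + 1)) :
      CArrow N (.T q (Nat.lt_of_succ_lt h)) (.T (q + 1) h)
  | tT (h : 0 < N) : CArrow N (.T 0 h) (.T 0 h)
  | tE (q : ℕ) (h : q < N) : CArrow N (.T q h) (.A (q + 1) h)
  | aS (r : ℕ) (h : r + 1 ≤ N) (i : Fin (r + 1)) :
      CArrow N (.A (r + 1) h) (.A r (Nat.le_of_succ_le h))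
  | aR (r : ℕ) (h : r + 1 ≤ N) (i : Fin r) :
      CArrow N (.A r (Nat.le_of_succ_le h)) (.A (r + 1) h)

instance (N : ℕ) : Quiver.{0} (CVert N) := ⟨CArrow N⟩

section Configuration

variable (K : Type w) [Field K]

/-- The functor assigned to an arrow. -/
def CArrow.functor {N : ℕ} : ∀ {u v : CVert N}, CArrow N u v → (QRep K u.Verts ⥤ QRep K v.Verts)
  | _, _, .dS _ _ i => dProj K i
  | _, _, .dR _ _ i => dSect K i
  | _, _, .dT _ _ => dSwap K
  | _, _, .dI _ _ b => iProj K b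
  | _, _, .dIZero _ b => iProj K b ⋙ tFold K
  | _, _, .tS _ _ i => tProj K i
  | _, _, .tSZero _ => tProj K 0 ⋙ tFold K
  | _, _, .tR _ _ i => tSect K i
  | _, _, .tT _ => tSwap K
  | _, _, .tE _ _ => tForget K
  | _, _, .aS _ _ i => aProj K i
  | _, _, .aR _ _ i => aSect K i

/-- `CExceptional K e E`: the arrow `e` stands for the projection through `E`. -/
inductive CExceptional {N : ℕ} : ∀ {u v : CVert N}, CArrow N u v → QRep K u.Verts → Prop
  | dS (p : ℕ) (h : p + 1 ≤ N) (i : Fin (p + 1)) :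
      CExceptional (.dS p h i) (QRep.simple K (DVert.mid i))
  | dI (q : ℕ) (h : q + 1 ≤ N) (b : Bool) :
      CExceptional (.dI q h b) (QRep.injective K (V := DVert (q + 1)) (.snk b))
  | dIZero (h : 1 ≤ N) (b : Bool) :
      CExceptional (.dIZero h b) (QRep.injective K (V := DVert 0) (.snk b))
  | tS (q : ℕ) (h : q + 1 < N) (i : Fin (q + 2)) :
      CExceptional (.tS q h i) (QRep.simple K (TVert.chain i))
  | tSZero (h : 0 < N) :
      CExceptional (.tSZero h) (QRep.simple K (TVert.chain (q := 1) 0))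
  | tE (q : ℕ) (h : q < N) :
      CExceptional (.tE q h) (QRep.simple K (TVert.extra (q := q + 1)))
  | aS (r : ℕ) (h : r + 1 ≤ N) (i : Fin (r + 1)) :
      CExceptional (.aS r h i) (QRep.simple K (AVert.chain i))

/-- `CSection e s`: the arrow `s` stands for the section of the projection `e`. -/
inductive CSection {N : ℕ} : ∀ {u v : CVert N}, CArrow N u v → CArrow N v u → Prop
  | d (p : ℕ) (h : p + 1 ≤ N) (i : Fin p) : CSection (.dS p h i.castSucc) (.dR p h i)
  | t (q : ℕ) (h : q + 1 < N) (i : Fin (q + 1)) : CSection (.tS q h i.castSucc) (.tR q h i)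
  | a (r : ℕ) (h : r + 1 ≤ N) (i : Fin r) : CSection (.aS r h i.castSucc) (.aR r h i)

/-- The functors do form a quiver exceptional configuration with dimension vectors: the
projections are the orthogonal projections through the given exceptional representations, the
sections are right adjoint to the projections, and the loops are automorphisms. -/
structure IsQECwd (N : ℕ) : Prop where
  projection : ∀ {u v : CVert N} (e : CArrow N u v) (E : QRep K u.Verts), CExceptional K e E →
    QRep.IsOrthogonalProjection E u.dim v.dim (e.functor K)
  section_adj : ∀ {u v : CVert N} (e : CArrow N u v) (s : CArrow N v u), CSection e s →
    Nonempty (e.functor K ⊣ s.functor K)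
  loop : ∀ {u : CVert N} (e : CArrow N u u), (e.functor K).IsEquivalence ∧
    ∀ M : QRep K u.Verts, M.dimVec = u.dim → ((e.functor K).obj M).dimVec = u.dim

/-- The evaluation of a path of the configuration. -/
def evalPath {N : ℕ} {u : CVert N} :
    ∀ {v : CVert N}, Quiver.Path u v → (QRep K u.Verts ⥤ QRep K v.Verts)
  | _, .nil => 𝟭 _
  | _, .cons x e => evalPath x ⋙ CArrow.functor K e

end Configuration

/-! ### Path algebras -/

section PathAlgebra

variable (k : Type u) [CommRing k] (V : Type) [Fintype V] [Quiver.{0} V]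

/-- Generators of the path algebra: vertices and arrows. -/
abbrev PathGen : Type := V ⊕ (Σ a b : V, (a ⟶ b))

/-- Relations of the path algebra. Products are written in the order of composition, so that
`e_{ha} a = a = a e_{ta}`. -/
inductive PathRel : FreeAlgebra k (PathGen V) → FreeAlgebra k (PathGen V) → Prop
  | idem (v : V) : PathRel (FreeAlgebra.ι k (.inl v) * FreeAlgebra.ι k (.inl v))
      (FreeAlgebra.ι k (.inl v))
  | orth (v v' : V) (h : v ≠ v') :
      PathRel (FreeAlgebra.ι k (.inl v) * FreeAlgebra.ι k (.inl v')) 0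
  | one : PathRel (∑ v : V, FreeAlgebra.ι k (.inl v)) 1
  | head (a b : V) (e : a ⟶ b) :
      PathRel (FreeAlgebra.ι k (.inl b) * FreeAlgebra.ι k (.inr ⟨a, b, e⟩))
        (FreeAlgebra.ι k (.inr ⟨a, b, e⟩))
  | tail (a b : V) (e : a ⟶ b) :
      PathRel (FreeAlgebra.ι k (.inr ⟨a, b, e⟩) * FreeAlgebra.ι k (.inl a))
        (FreeAlgebra.ι k (.inr ⟨a, b, e⟩))

/-- The path algebra over `k` of a quiver with finitely many vertices. -/
abbrev PathAlg : Type u := RingQuot (PathRel k V)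

variable {V}

/-- The trivial path at a vertex. -/
def vertexElt (v : V) : PathAlg k V :=
  RingQuot.mkAlgHom k (PathRel k V) (FreeAlgebra.ι k (.inl v))

/-- An arrow as an element of the path algebra. -/
def arrowElt {a b : V} (e : a ⟶ b) : PathAlg k V :=
  RingQuot.mkAlgHom k (PathRel k V) (FreeAlgebra.ι k (.inr ⟨a, b, e⟩))

/-- A path as an element of the path algebra. -/
def pathElt {a : V} : ∀ {b : V}, Quiver.Path a b → PathAlg k V
  | _, .nil => vertexElt k a
  | _, .cons x e => arrowElt k e * pathElt x

end PathAlgebra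

/-- The relations of the configuration: two paths are identified when their evaluations are
isomorphic functors. -/
inductive ConfigRel (K : Type w) [Field K] (k : Type u) [CommRing k] (N : ℕ) :
    PathAlg k (CVert N) → PathAlg k (CVert N) → Prop
  | mk {u v : CVert N} (x y : Quiver.Path u v) (h : Nonempty (evalPath K x ≅ evalPath K y)) :
      ConfigRel K k N (pathElt k x) (pathElt k y)

/-- The algebra of the configuration. -/
abbrev ConfigAlg (K : Type w) [Field K] (k : Type u) [CommRing k] (N : ℕ) : Type u :=
  RingQuot (ConfigRel K k N)

/-! ### The quiver with relations of complexes -/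

/-- The vertices of the second quiver; they are named after those of the configuration. -/
def BVert (N : ℕ) : Type := CVert N

instance (N : ℕ) : Fintype (BVert N) := inferInstanceAs (Fintype (CVert N))

/-- The arrows of the second quiver. -/
inductive BArrow (N : ℕ) : CVert N → CVert N → Type
  | d (p : ℕ) (h : p + 1 ≤ N) : BArrow N (.D (p + 1) h) (.D p (Nat.le_of_succ_le h))
  | t (p : ℕ) (h : p ≤ N) : BArrow N (.D p h) (.D p h)
  | c (q : ℕ) (h : q + 1 ≤ N) : BArrow N (.D (q + 1) h) (.T q h)
  | cZero (h : 1 ≤ N) : BArrow N (.D 0 (Nat.zero_le N)) (.A 1 h)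
  | a' (q : ℕ) (h : q + 1 < N) : BArrow N (.T (q + 1) h) (.T q (Nat.lt_of_succ_lt h))
  | f (h : 0 < N) : BArrow N (.T 0 h) (.A 1 h)
  | s (h : 0 < N) : BArrow N (.T 0 h) (.T 0 h)
  | b (q : ℕ) (h : q + 1 < N) : BArrow N (.T (q + 1) h) (.A (q + 2) h)
  | a (r : ℕ) (h : r + 1 ≤ N) : BArrow N (.A (r + 1) h) (.A r (Nat.le_of_succ_le h))

instance (N : ℕ) : Quiver.{0} (BVert N) := ⟨BArrow N⟩

section Complexes

variable (k : Type u) [CommRing k] {N : ℕ}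

/-- An arrow of the second quiver as an element of its path algebra. -/
def bElt {u v : CVert N} (e : BArrow N u v) : PathAlg k (BVert N) :=
  arrowElt k (V := BVert N) (a := u) (b := v) e

/-- The trivial path at a vertex of the second quiver. -/
def bOne (v : CVert N) : PathAlg k (BVert N) := vertexElt k (V := BVert N) v

/-- The relations. Here `f` is the arrow `a'/b` from `A¹_3` to `A_2`, `s` is the loop at `A¹_3`,
and `a 0` is the last arrow, from `A_2` to `A_1`. The relations with `f` are those of the arrows
`a'` with `f` in the role of `a'`, and those of the arrows `b` with `f s` in the role of `b`; the
relations with `a 0` are those of the arrows `a` and `b` with `a 0` in the role of both. -/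
inductive BRel : PathAlg k (BVert N) → PathAlg k (BVert N) → Prop
  | t_t (p : ℕ) (h : p ≤ N) :
      BRel (bElt k (.t p h) * bElt k (.t p h)) (bOne k (.D p h))
  | s_s (h : 0 < N) : BRel (bElt k (.s h) * bElt k (.s h)) (bOne k (.T 0 h))
  | t_d_t (p : ℕ) (h : p + 1 ≤ N) :
      BRel (bElt k (.t p (Nat.le_of_succ_le h)) * bElt k (.d p h) * bElt k (.t (p + 1) h))
        (bElt k (.d p h))
  | c_d (q : ℕ) (h : q + 2 ≤ N) :
      BRel (bElt k (.c q (Nat.le_of_succ_le h)) * bElt k (.d (q + 1) h))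
        (bElt k (.a' q h) * bElt k (.c (q + 1) h))
  | c_d_zero (h : 1 ≤ N) :
      BRel (bElt k (.cZero h) * bElt k (.d 0 h)) (bElt k (.f h) * bElt k (.c 0 h))
  | c_t_d (q : ℕ) (h : q + 2 ≤ N) :
      BRel (bElt k (.c q (Nat.le_of_succ_le h)) * bElt k (.t (q + 1) (Nat.le_of_succ_le h)) *
          bElt k (.d (q + 1) h))
        (bElt k (.a' q h) * bElt k (.c (q + 1) h) * bElt k (.t (q + 2) h))
  | c_t_d_zero (h : 1 ≤ N) :
      BRel (bElt k (.cZero h) * bElt k (.t 0 (Nat.zero_le N)) * bElt k (.d 0 h))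
        (bElt k (.f h) * bElt k (.c 0 h) * bElt k (.t 1 h))
  | a_b (q : ℕ) (h : q + 2 < N) :
      BRel (bElt k (.a (q + 2) h) * bElt k (.b (q + 1) h))
        (bElt k (.b q (Nat.lt_of_succ_lt h)) * bElt k (.a' (q + 1) h))
  | a_b_one (h : 1 < N) :
      BRel (bElt k (.a 1 h) * bElt k (.b 0 h))
        (bElt k (.f (Nat.lt_of_succ_lt h)) * bElt k (.s (Nat.lt_of_succ_lt h)) *
          bElt k (.a' 0 h))
  | a_b_zero (h : 0 < N) :
      BRel (bElt k (.a 0 h) * (bElt k (.f h) * bElt k (.s h))) (bElt k (.a 0 h) * bElt k (.f h))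
  | b_c (q : ℕ) (h : q + 1 < N) :
      BRel (bElt k (.b q h) * (bElt k (.c (q + 1) h) -
        bElt k (.c (q + 1) h) * bElt k (.t (q + 2) h))) 0
  | b_c_one (h : 0 < N) :
      BRel (bElt k (.f h) * bElt k (.s h) *
        (bElt k (.c 0 h) - bElt k (.c 0 h) * bElt k (.t 1 h))) 0
  | b_c_zero (h : 1 ≤ N) :
      BRel (bElt k (.a 0 h) *
        (bElt k (.cZero h) - bElt k (.cZero h) * bElt k (.t 0 (Nat.zero_le N)))) 0
  | d_d (p : ℕ) (h : p + 2 ≤ N) :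
      BRel (bElt k (.d p (Nat.le_of_succ_le h)) * bElt k (.d (p + 1) h)) 0
  | a'_a' (q : ℕ) (h : q + 2 < N) :
      BRel (bElt k (.a' q (Nat.lt_of_succ_lt h)) * bElt k (.a' (q + 1) h)) 0
  | f_a' (h : 1 < N) : BRel (bElt k (.f (Nat.lt_of_succ_lt h)) * bElt k (.a' 0 h)) 0
  | a_a (r : ℕ) (h : r + 2 ≤ N) :
      BRel (bElt k (.a r (Nat.le_of_succ_le h)) * bElt k (.a (r + 1) h)) 0

end Complexes

/-- The path algebra of the second quiver modulo the relations. -/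
abbrev ComplexAlg (k : Type u) [CommRing k] (N : ℕ) : Type u :=
  RingQuot (BRel k (N := N))

end

noncomputable section

section

/-! ### Representations of thin quivers -/

namespace QRep

variable {K : Type w} [Field K] {V W U : Type} [Quiver.{0} V] [Quiver.{0} W] [Quiver.{0} U]

/-! The contractions and sections between quivers of one type behave like the faces and degeneracies
of an augmented simplicial object. The Morita equivalence is therefore a form of the Dold–Kan
correspondence: on normalized parts only the last face survives, and the composite of two last faces
is zero. The remaining functors are compatible with this structure.

Orthogonality. Each exceptional representation `E` that occurs has one generator at a vertex `g` and
relations at some other vertices. Hom and Ext from `E` to `N` are then the kernel and the cokernel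
of the map from the space of `N` at `g` to the product of its spaces at the relations, and `N` is
orthogonal to `E` exactly if this map is bijective (`Presentation.perp_iff`). Every projection has
an explicit right adjoint with invertible counit: a pull-back if a single arrow leaves the deleted
vertex (`isOrthogonalProjection_restrict`), a right Kan extension at the branching vertex
(`dProj_last_isOrthogonalProjection`), and `iSect` for the injective representations. Its essential
image consists of the objects with invertible unit, and invertibility of the unit is the same
bijectivity.

Normalization. In a ring with a `SimplicialSystem` the product of the factors `1 - s_j d_j` is an
idempotent. Faces other than the last vanish when multiplied by it on the right, degeneracies when
multiplied by it on the left. The sum `totalNrm` of these idempotents over all vertices is full,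
since `s_j d_j` factors through lower degree (`one_mem_span_totalNrm`). Hence the algebra of the
configuration is Morita equivalent to a corner, and it remains to identify the corner with the
algebra of complexes. The homomorphism `nrmHom` sends each arrow of the second quiver to a functor
of the configuration, restricted to normalized parts; the relations are checked in `nrmPathHom_rel`.

Surjectivity. A product of arrows applied to a normalized element can be rewritten with all sections
on the left (`cfgA_mul_mem_degSpan`), and the idempotent kills sections on its right.

Injectivity. The configuration algebra identifies paths with isomorphic evaluations, and these
isomorphisms are not classified. An invariant replaces the classification: isomorphic functors have
the same effect on dimension vectors. For vectors that vanish at the source, this effect depends on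
dimensions only, which gives an action on a free module (`dimHom`). The relations of the second
quiver reduce every path to zero or to one of the normal forms `Word` (`wordSum_surjective`).
Different normal forms move a generic dimension vector to different places
(`Word.dim_generic_injective`). The correction terms of the normalizing idempotents begin with a
contraction other than the last and lose an entry that all normal forms keep. So the coefficient of
each normal form can be read off (`wordCoeff_elt`). -/

@[simp] theorem id_app (M : QRep K V) (v : V) : Hom.app (𝟙 M) v = LinearMap.id := rfl

@[simp] theorem comp_app {L M N : QRep K V} (f : L ⟶ M) (g : M ⟶ N) (v : V) :
    Hom.app (f ≫ g) v = g.app v ∘ₗ f.app v := rfl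

theorem hom_ext {M N : QRep K V} {f g : M ⟶ N} (h : ∀ v x, f.app v x = g.app v x) : f = g :=
  Hom.ext (funext fun v => LinearMap.ext (h v))

theorem comm_apply {M N : QRep K V} (f : M ⟶ N) {a b : V} (e : a ⟶ b) (x : M.X a) :
    f.app b (M.map e x) = N.map e (f.app a x) := LinearMap.congr_fun (f.comm e) x

theorem comm_path_apply {M N : QRep K V} (f : M ⟶ N) {a b : V} (p : Quiver.Path a b)
    (x : M.X a) : f.app b (M.pathMap p x) = N.pathMap p (f.app a x) :=
  LinearMap.congr_fun (f.comm_path p) x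

/-- An isomorphism of representations from isomorphisms of the spaces. -/
def isoMk {M N : QRep K V} (e : ∀ v, M.X v ≃ₗ[K] N.X v)
    (h : ∀ {a b : V} (f : a ⟶ b) (x : M.X a), e b (M.map f x) = N.map f (e a x)) : M ≅ N where
  hom := ⟨fun v => (e v).toLinearMap, fun f => LinearMap.ext (h f)⟩
  inv := ⟨fun v => (e v).symm.toLinearMap, fun f => LinearMap.ext fun x => by
    apply (e _).injective
    simp [h f]⟩
  hom_inv_id := hom_ext fun v x => (e v).symm_apply_apply x
  inv_hom_id := hom_ext fun v x => (e v).apply_symm_apply x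

theorem isIso_iff {M N : QRep K V} (f : M ⟶ N) :
    IsIso f ↔ ∀ v, Function.Bijective (f.app v) := by
  constructor
  · intro hf v
    refine Function.bijective_iff_has_inverse.2 ⟨(inv f).app v, fun x => ?_, fun x => ?_⟩
    · exact congrArg (fun g : M ⟶ M => g.app v x) (IsIso.hom_inv_id f)
    · exact congrArg (fun g : N ⟶ N => g.app v x) (IsIso.inv_hom_id f)
  · intro h
    let i : M ≅ N := isoMk (fun v => LinearEquiv.ofBijective (f.app v) (h v))
      (fun e x => comm_apply f e x)
    exact (inferInstance : IsIso i.hom)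

theorem dimVec_eq_of_iso {M N : QRep K V} (i : M ≅ N) : dimVec M = dimVec N := by
  funext v
  exact (LinearEquiv.ofBijective (i.hom.app v)
    ((isIso_iff i.hom).1 inferInstance v)).finrank_eq

theorem pathMap_comp (M : QRep K V) {a b c : V} (x : Quiver.Path a b) (y : Quiver.Path b c) :
    M.pathMap (x.comp y) = M.pathMap y ∘ₗ M.pathMap x := by
  induction y with
  | nil => rfl
  | cons y e ih => simp only [Quiver.Path.comp_cons, pathMap, ih, LinearMap.comp_assoc]

theorem pathMap_toPath (M : QRep K V) {a b : V} (e : a ⟶ b) : M.pathMap e.toPath = M.map e := rfl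

theorem pathMap_comp_apply (M : QRep K V) {a b c : V} (x : Quiver.Path a b)
    (y : Quiver.Path b c) (m : M.X a) : M.pathMap (x.comp y) m = M.pathMap y (M.pathMap x m) :=
  LinearMap.congr_fun (M.pathMap_comp x y) m

/-- Between thin quivers only reachability matters, so a map of vertices that sends arrows to
reachable pairs is as good as a functor between the path categories. -/
theorem nonempty_path_of_arrows {φ : W → V}
    (h : ∀ a b : W, (a ⟶ b) → Nonempty (Quiver.Path (φ a) (φ b))) {a b : W}
    (x : Quiver.Path a b) : Nonempty (Quiver.Path (φ a) (φ b)) := by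
  induction x with
  | nil => exact ⟨.nil⟩
  | cons x e ih => exact ih.map fun z => z.comp (h _ _ e).some

section Thin

variable [∀ a b : V, Subsingleton (Quiver.Path a b)]

theorem pathMap_congr (M : QRep K V) {a b : V} (x y : Quiver.Path a b) (m : M.X a) :
    M.pathMap x m = M.pathMap y m := by rw [Subsingleton.elim x y]

theorem pathMap_loop (M : QRep K V) {a : V} (x : Quiver.Path a a) (m : M.X a) :
    M.pathMap x m = m := M.pathMap_congr x .nil m

theorem pathMap_pathMap (M : QRep K V) {a b c : V} (x : Quiver.Path a b)
    (y : Quiver.Path b c) (z : Quiver.Path a c) (m : M.X a) :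
    M.pathMap y (M.pathMap x m) = M.pathMap z m :=
  (M.pathMap_comp_apply x y m).symm.trans (M.pathMap_congr _ _ m)

/-- Thinness removes the choice of paths made by `restrict`: both sides are structure maps of `M`
between the same two vertices. All comparisons of composite pull-backs rest on this. -/
theorem pathMap_restrict (φ : W → V) (h : ∀ a b : W, (a ⟶ b) → Nonempty (Quiver.Path (φ a) (φ b)))
    (M : QRep K V) {a b : W} (x : Quiver.Path a b) (y : Quiver.Path (φ a) (φ b))
    (m : M.X (φ a)) : ((restrict φ h).obj M).pathMap x m = M.pathMap y m := by
  induction x with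
  | nil => exact (M.pathMap_loop y m).symm
  | @cons b c x e ih =>
    obtain ⟨z⟩ := nonempty_path_of_arrows h x
    exact (congrArg (M.pathMap (h _ _ e).some) (ih z)).trans (M.pathMap_pathMap _ _ _ _)

/-- The composition of two pull-backs. -/
def restrictComp (φ : W → V) (h : ∀ a b : W, (a ⟶ b) → Nonempty (Quiver.Path (φ a) (φ b)))
    (ψ : U → W) (h' : ∀ a b : U, (a ⟶ b) → Nonempty (Quiver.Path (ψ a) (ψ b)))
    (χ : U → V) (h'' : ∀ a b : U, (a ⟶ b) → Nonempty (Quiver.Path (χ a) (χ b)))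
    (hχ : ∀ a, φ (ψ a) = χ a) :
    restrict (K := K) φ h ⋙ restrict ψ h' ≅ restrict χ h'' := by
  -- Once the maps of vertices coincide, both sides have the same spaces and the isomorphism is the
  -- identity on each of them.
  obtain rfl : (fun a => φ (ψ a)) = χ := funext hχ
  exact NatIso.ofComponents (fun M => isoMk (fun a => LinearEquiv.refl K (M.X (φ (ψ a))))
    fun {a b} e x => pathMap_restrict φ h M (h' a b e).some (h'' a b e).some x) fun f => rfl

/-- The pull-back along the identity. -/
def restrictId (φ : V → V) (h : ∀ a b : V, (a ⟶ b) → Nonempty (Quiver.Path (φ a) (φ b)))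
    (hφ : ∀ a, φ a = a) : restrict (K := K) φ h ≅ 𝟭 (QRep K V) := by
  obtain rfl : φ = id := funext hφ
  exact NatIso.ofComponents (fun M => isoMk (fun a => LinearEquiv.refl K (M.X a))
    fun {a b} e x => M.pathMap_congr (h a b e).some e.toPath x) fun f => rfl

variable [∀ a b : W, Subsingleton (Quiver.Path a b)]

/-- A Galois connection between two thin quivers induces an adjunction. -/
def restrictAdj (φ : W → V) (h : ∀ a b : W, (a ⟶ b) → Nonempty (Quiver.Path (φ a) (φ b)))
    (ρ : V → W) (h' : ∀ a b : V, (a ⟶ b) → Nonempty (Quiver.Path (ρ a) (ρ b)))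
    (η : ∀ a, Nonempty (Quiver.Path a (φ (ρ a)))) (ε : ∀ a, Nonempty (Quiver.Path (ρ (φ a)) a)) :
    restrict (K := K) φ h ⊣ restrict ρ h' :=
  Adjunction.mkOfUnitCounit
    { unit :=
        { app := fun M => ⟨fun a => M.pathMap (η a).some, fun {a b} e =>
            LinearMap.ext fun x => by
              obtain ⟨z⟩ := nonempty_path_of_arrows h (h' a b e).some
              exact (M.pathMap_pathMap e.toPath (η b).some ((η a).some.comp z) x).trans
                ((M.pathMap_comp_apply _ _ x).trans (pathMap_restrict φ h M _ z _).symm)⟩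
          naturality := fun M N f => Hom.ext (funext fun a => (f.comm_path _).symm) }
      counit :=
        { app := fun N => ⟨fun a => N.pathMap (ε a).some, fun {a b} e =>
            LinearMap.ext fun x => by
              obtain ⟨z⟩ := nonempty_path_of_arrows h' (h a b e).some
              exact (congrArg (N.pathMap (ε b).some) (pathMap_restrict ρ h' N _ z x)).trans
                ((N.pathMap_pathMap z (ε b).some ((ε a).some.comp e.toPath) x).trans
                  (N.pathMap_comp_apply _ e.toPath x))⟩
          naturality := fun M N f => Hom.ext (funext fun a => (f.comm_path _).symm) }
      left_triangle := by
        ext M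
        refine hom_ext fun a x => ?_
        obtain ⟨z⟩ := nonempty_path_of_arrows h (ε a).some
        exact (pathMap_restrict φ h M (ε a).some z _).trans
          (M.pathMap_pathMap (η (φ a)).some z .nil x)
      right_triangle := by
        ext N
        refine hom_ext fun a x => ?_
        obtain ⟨z⟩ := nonempty_path_of_arrows h' (η a).some
        exact (congrArg (N.pathMap (ε (ρ a)).some)
          (pathMap_restrict ρ h' N (η a).some z _)).trans
          (N.pathMap_pathMap z (ε (ρ a)).some .nil x) }

/-- Makes the unit visible as a structure map of `M`, so that its bijectivity can be compared with
orthogonality. -/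
theorem restrictAdj_unit (φ : W → V)
    (h : ∀ a b : W, (a ⟶ b) → Nonempty (Quiver.Path (φ a) (φ b)))
    (ρ : V → W) (h' : ∀ a b : V, (a ⟶ b) → Nonempty (Quiver.Path (ρ a) (ρ b)))
    (η : ∀ a, Nonempty (Quiver.Path a (φ (ρ a)))) (ε : ∀ a, Nonempty (Quiver.Path (ρ (φ a)) a))
    (M : QRep K V) (a : V) :
    Hom.app ((restrictAdj (K := K) φ h ρ h' η ε).unit.app M) a = M.pathMap (η a).some := rfl

end Thin

end QRep

/-! ### The quivers are thin -/

/-- When all arrows that leave a vertex have the same head, each step of a path is forced. This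
applies to `TVert` and `AVert`, which flow to a single sink; `DVert` branches and needs the dual
argument. -/
theorem path_unique_of_length {V : Type} [Quiver.{0} V] [∀ a b : V, Subsingleton (a ⟶ b)]
    (hV : ∀ {a b c : V}, (a ⟶ b) → (a ⟶ c) → b = c) {a : V} :
    ∀ {b c : V} (x : Quiver.Path a b) (y : Quiver.Path a c), x.length = y.length →
      ∃ h : b = c, h ▸ x = y
  | _, _, .nil, .nil, _ => ⟨rfl, rfl⟩
  | _, _, .nil, .cons y f, h => by simp at h
  | _, _, .cons x e, .nil, h => by simp at h
  | _, _, .cons x e, .cons y f, h => by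
    obtain ⟨rfl, rfl⟩ := path_unique_of_length hV x y (by simpa using h)
    obtain rfl := hV e f
    exact ⟨rfl, by rw [Subsingleton.elim e f]⟩

instance TVert.subsingletonArrow {q : ℕ} (a b : TVert q) : Subsingleton (a ⟶ b) :=
  inferInstanceAs (Subsingleton (PLift (a.Adj b)))

instance AVert.subsingletonArrow {r : ℕ} (a b : AVert r) : Subsingleton (a ⟶ b) :=
  inferInstanceAs (Subsingleton (PLift (a.Adj b)))

/-- The height of a vertex. -/
def TVert.pos {q : ℕ} : TVert q → ℕ
  | .chain i => i.val + 1
  | .extra => q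
  | .sink => q + 1

theorem TVert.pos_arrow {q : ℕ} : ∀ {a b : TVert q}, (a ⟶ b) → b.pos = a.pos + 1
  | .chain _, .chain _, ⟨h⟩ => congrArg (· + 1) h
  | .chain _, .sink, ⟨h⟩ => congrArg (· + 1) (Eq.symm h)
  | .extra, .sink, _ => rfl

theorem TVert.pos_path {q : ℕ} {a b : TVert q} (x : Quiver.Path a b) :
    b.pos = a.pos + x.length := by
  induction x with
  | nil => rfl
  | cons x e ih => rw [TVert.pos_arrow e, ih, Quiver.Path.length_cons, Nat.add_assoc]

theorem TVert.head_unique {q : ℕ} : ∀ {a b c : TVert q}, (a ⟶ b) → (a ⟶ c) → b = c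
  | .chain _, .chain _, .chain _, ⟨h⟩, ⟨h'⟩ => congrArg _ (Fin.ext (Eq.trans h (Eq.symm h')))
  | .chain _, .chain j, .sink, ⟨h⟩, ⟨h'⟩ =>
    absurd j.isLt (by have h : _ = _ := h; have h' : _ = _ := h'; omega)
  | .chain _, .sink, .chain j, ⟨h⟩, ⟨h'⟩ =>
    absurd j.isLt (by have h : _ = _ := h; have h' : _ = _ := h'; omega)
  | .chain _, .sink, .sink, _, _ => rfl
  | .extra, .sink, .sink, _, _ => rfl

instance TVert.subsingletonPath {q : ℕ} (a b : TVert q) : Subsingleton (Quiver.Path a b) :=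
  ⟨fun x y => (path_unique_of_length TVert.head_unique x y (by
    have := TVert.pos_path x; have := TVert.pos_path y; omega)).2⟩

/-- The height of a vertex. -/
def AVert.pos {r : ℕ} : AVert r → ℕ
  | .chain i => i.val
  | .sink => r

theorem AVert.pos_arrow {r : ℕ} : ∀ {a b : AVert r}, (a ⟶ b) → b.pos = a.pos + 1
  | .chain _, .chain _, ⟨h⟩ => h
  | .chain _, .sink, ⟨h⟩ => Eq.symm h

theorem AVert.pos_path {r : ℕ} {a b : AVert r} (x : Quiver.Path a b) :
    b.pos = a.pos + x.length := by
  induction x with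
  | nil => rfl
  | cons x e ih => rw [AVert.pos_arrow e, ih, Quiver.Path.length_cons, Nat.add_assoc]

theorem AVert.head_unique {r : ℕ} : ∀ {a b c : AVert r}, (a ⟶ b) → (a ⟶ c) → b = c
  | .chain _, .chain _, .chain _, ⟨h⟩, ⟨h'⟩ => congrArg _ (Fin.ext (Eq.trans h (Eq.symm h')))
  | .chain _, .chain j, .sink, ⟨h⟩, ⟨h'⟩ =>
    absurd j.isLt (by have h : _ = _ := h; have h' : _ = _ := h'; omega)
  | .chain _, .sink, .chain j, ⟨h⟩, ⟨h'⟩ =>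
    absurd j.isLt (by have h : _ = _ := h; have h' : _ = _ := h'; omega)
  | .chain _, .sink, .sink, _, _ => rfl

instance AVert.subsingletonPath {r : ℕ} (a b : AVert r) : Subsingleton (Quiver.Path a b) :=
  ⟨fun x y => (path_unique_of_length AVert.head_unique x y (by
    have := AVert.pos_path x; have := AVert.pos_path y; omega)).2⟩

end

section

/-! ### Exceptional representations with one generator -/

namespace QRep

variable {K : Type w} [Field K] {V W : Type} [Quiver.{0} V] [Quiver.{0} W]

/-- A representation `E` of a thin quiver with spaces of dimension at most `1`, generated by a
vector at the vertex `g` with relations at the vertices `w` with `R w`. -/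
structure Presentation (E : QRep K V) (g : V) (R : V → Prop) where
  ε : ∀ a, E.X a
  coord : ∀ a, E.X a →ₗ[K] K
  coord_smul : ∀ a x, coord a x • ε a = x
  ε_ne : ε g ≠ 0
  map_ε : ∀ {a b : V} (e : a ⟶ b), ε a ≠ 0 → E.map e (ε a) = ε b
  reach : ∀ a, ε a ≠ 0 → Nonempty (Quiver.Path g a)
  rel_ε : ∀ a, R a → ε a = 0
  rel_of : ∀ {a b : V}, (a ⟶ b) → ε a ≠ 0 → ε b = 0 → R b
  -- A path from `g` to a vertex of the support or to a relation stays inside the support until its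
  -- last arrow, so it carries the generator through nonzero vectors.
  before : ∀ {a b : V}, Quiver.Path g a → (a ⟶ b) → (ε b ≠ 0 ∨ R b) → ε a ≠ 0

namespace Presentation

variable {E : QRep K V} {g : V} {R : V → Prop} (P : Presentation E g R)
include P

theorem coord_ε {a : V} (h : P.ε a ≠ 0) : P.coord a (P.ε a) = 1 := by
  have h1 : (P.coord a (P.ε a) - 1) • P.ε a = 0 := by
    rw [sub_smul, P.coord_smul, one_smul, sub_self]
  rcases smul_eq_zero.1 h1 with h2 | h2
  · exact sub_eq_zero.1 h2
  · exact absurd h2 h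

theorem eq_zero {a : V} (h : P.ε a = 0) (x : E.X a) : x = 0 := by
  rw [← P.coord_smul a x, h, smul_zero]

theorem pathMap_ε {a : V} (x : Quiver.Path g a) (ha : P.ε a ≠ 0) :
    E.pathMap x (P.ε g) = P.ε a := by
  induction x with
  | nil => rfl
  | cons x e ih =>
    have h := P.before x e (Or.inl ha)
    exact (congrArg (E.map e) (ih h)).trans (P.map_ε e h)

/-- Every vector of `E` is a multiple of the image of the generator along a path. -/
theorem hom_eq {M : QRep K V} {f f' : E ⟶ M} (h : f.app g (P.ε g) = f'.app g (P.ε g)) :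
    f = f' := by
  refine hom_ext fun a x => ?_
  by_cases ha : P.ε a = 0
  · rw [P.eq_zero ha x, map_zero, map_zero]
  · obtain ⟨y⟩ := P.reach a ha
    rw [← P.coord_smul a x, map_smul, map_smul, ← P.pathMap_ε y ha, comm_path_apply,
      comm_path_apply, h]

open Classical in
/-- The extension of `E` by `N` given by vectors at the relations. -/
def extension (N : QRep K V) (n : ∀ a, N.X a) : QRep K V where
  X a := N.X a × E.X a
  map {a b} e := (N.map e ∘ₗ LinearMap.fst K _ _ +
    (P.coord a).smulRight (if R b then n b else 0) ∘ₗ LinearMap.snd K _ _).prod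
      (E.map e ∘ₗ LinearMap.snd K _ _)

open Classical in
theorem extension_map (N : QRep K V) (n : ∀ a, N.X a) {a b : V} (e : a ⟶ b) (x : N.X a)
    (y : E.X a) : (P.extension N n).map e ((x, y) : N.X a × E.X a) =
      ((N.map e x + P.coord a y • (if R b then n b else 0), E.map e y) : N.X b × E.X b) := rfl

variable [∀ a b : V, Subsingleton (Quiver.Path a b)]

/-- The vector `m` is transported along the paths from `g`. Thinness makes this well defined, and
vanishing at the relations is what is needed where an arrow leaves the support of `E`. -/
theorem exists_hom (M : QRep K V) (m : M.X g)
    (hm : ∀ a, R a → ∀ x : Quiver.Path g a, M.pathMap x m = 0) :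
    ∃ f : E ⟶ M, f.app g (P.ε g) = m := by
  classical
  refine ⟨⟨fun a => if h : P.ε a ≠ 0 then
    (P.coord a).smulRight (M.pathMap (P.reach a h).some m) else 0, fun {a b} e => ?_⟩, ?_⟩
  · refine LinearMap.ext fun x => ?_
    by_cases ha : P.ε a = 0
    · rw [P.eq_zero ha x, map_zero, map_zero]
    · obtain ⟨c, rfl⟩ : ∃ c : K, x = c • P.ε a := ⟨_, (P.coord_smul a x).symm⟩
      rw [map_smul, map_smul]
      congr 1
      simp only [LinearMap.comp_apply]
      rw [P.map_ε e ha, dif_pos ha, LinearMap.smulRight_apply, P.coord_ε ha, one_smul]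
      have key : M.map e (M.pathMap (P.reach a ha).some m) =
        M.pathMap ((P.reach a ha).some.cons e) m := rfl
      rw [key]
      by_cases hb : P.ε b = 0
      · rw [dif_neg (by simpa using hb), hm b (P.rel_of e ha hb)]
        rfl
      · rw [dif_pos hb, LinearMap.smulRight_apply, P.coord_ε hb, one_smul]
        exact M.pathMap_congr _ _ _
  · change (dite _ _ _ : E.X g →ₗ[K] M.X g) _ = _
    rw [dif_pos P.ε_ne, LinearMap.smulRight_apply, P.coord_ε P.ε_ne, one_smul, M.pathMap_loop]

theorem homVanish_iff (N : QRep K V) : HomVanish E N ↔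
    ∀ m : N.X g, (∀ a, R a → ∀ x : Quiver.Path g a, N.pathMap x m = 0) → m = 0 := by
  constructor
  · intro h m hm
    obtain ⟨f, rfl⟩ := P.exists_hom N m hm
    rw [h f g]; rfl
  · intro h f v
    have h0 : f.app g (P.ε g) = 0 := h _ fun a ha x => by
      rw [← comm_path_apply, P.eq_zero (P.rel_ε a ha) (E.pathMap x _), map_zero]
    have : f = ⟨fun _ => 0, fun _ => by simp⟩ := P.hom_eq h0
    rw [this]

/-- A presentation computes Ext as a cokernel. A family `n` defines the extension in which the
generator takes the values `n` at the relations instead of vanishing there; conversely, lifting the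
generator to a given extension produces such a family. -/
theorem extVanish_iff (N : QRep K V) : ExtVanish E N ↔
    ∀ n : ∀ a, N.X a, ∃ m : N.X g, ∀ a, R a → ∀ x : Quiver.Path g a, N.pathMap x m = n a := by
  constructor
  · intro h n
    let i : N ⟶ P.extension N n := ⟨fun a => LinearMap.inl K _ _, fun {a b} e => by
      refine LinearMap.ext fun x => Eq.symm ((P.extension_map N n e x 0).trans ?_)
      exact Prod.ext (by simp only [map_zero, zero_smul, add_zero]; rfl) (map_zero _)⟩
    let p : P.extension N n ⟶ E := ⟨fun a => LinearMap.snd K _ _, fun {a b} e => rfl⟩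
    obtain ⟨s, hs⟩ := h _ i p (fun v => LinearMap.inl_injective) (fun v => LinearMap.snd_surjective)
      (fun v => LinearMap.range_inl K _ _)
    -- Inside the support the lift `(0, ε g)` is carried along without correction; at a relation it
    -- becomes `(n a, 0)`.
    have hi : ∀ {a} (x : Quiver.Path g a), P.ε a ≠ 0 →
        (P.extension N n).pathMap x ((0, P.ε g) : N.X g × E.X g) =
          ((0, P.ε a) : N.X a × E.X a) := by
      intro a x
      induction x with
      | nil => intro _; rfl
      | @cons b c x e ih =>
        intro ha
        have h := P.before x e (Or.inl ha)
        have hR : ¬ R c := fun h => ha (P.rel_ε _ h)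
        refine (congrArg ((P.extension N n).map e) (ih h)).trans
          ((P.extension_map N n e 0 _).trans (Prod.ext ?_ (P.map_ε e h)))
        simp [hR]
    have hR : ∀ {a} (x : Quiver.Path g a), R a →
        (P.extension N n).pathMap x ((0, P.ε g) : N.X g × E.X g) = ((n a, 0) : N.X a × E.X a) := by
      intro a x ha
      cases x with
      | nil => exact absurd (P.rel_ε g ha) P.ε_ne
      | cons x e =>
        have h := P.before x e (Or.inr ha)
        refine (congrArg ((P.extension N n).map e) (hi x h)).trans
          ((P.extension_map N n e 0 _).trans
            (Prod.ext ?_ ((P.map_ε e h).trans (P.rel_ε _ ha))))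
        simp [ha, P.coord_ε h]
    have hsε : (s.app g (P.ε g)).2 = P.ε g :=
      congrArg (fun f : E ⟶ E => f.app g (P.ε g)) hs
    -- The splitting sends the generator to some `(y, ε g)` that vanishes at every relation. The
    -- second part contributes `n a` there, so `-y` has the required values.
    refine ⟨-(s.app g (P.ε g)).1, fun a ha x => ?_⟩
    have h1 := comm_path_apply s x (P.ε g)
    rw [P.eq_zero (P.rel_ε a ha) (E.pathMap x _), map_zero] at h1
    have h2 : s.app g (P.ε g) = i.app g (s.app g (P.ε g)).1 +
        (show (P.extension N n).X g from ((0, P.ε g) : N.X g × E.X g)) :=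
      Prod.ext (add_zero _).symm (hsε.trans (zero_add _).symm)
    rw [h2, map_add, ← comm_path_apply] at h1
    have h3 : N.pathMap x (s.app g (P.ε g)).1 + n a = 0 :=
      ((congrArg Prod.fst h1).trans
        (congrArg (N.pathMap x (s.app g (P.ε g)).1 + ·) (congrArg Prod.fst (hR x ha)))).symm
    rw [map_neg]
    exact (eq_neg_of_add_eq_zero_right h3).symm
  · intro h M i p hi hp hip
    obtain ⟨m, hm⟩ := hp g (P.ε g)
    have hex : ∀ a, ∃ n : N.X a, R a → ∀ x : Quiver.Path g a, M.pathMap x m = i.app a n := by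
      intro a
      by_cases ha : R a ∧ Nonempty (Quiver.Path g a)
      · obtain ⟨ha, ⟨x⟩⟩ := ha
        have : M.pathMap x m ∈ LinearMap.range (i.app a) := by
          rw [hip, LinearMap.mem_ker]
          exact P.eq_zero (P.rel_ε a ha) _
        obtain ⟨n, hn⟩ := this
        exact ⟨n, fun _ y => (M.pathMap_congr y x m).trans hn.symm⟩
      · exact ⟨0, fun h x => absurd ⟨h, ⟨x⟩⟩ ha⟩
    choose n hn using hex
    obtain ⟨m', hm'⟩ := h n
    have hpi : ∀ y, p.app g (i.app g y) = 0 := fun y => by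
      rw [← LinearMap.mem_ker, ← hip]; exact ⟨y, rfl⟩
    -- The lift `m` fails the relations by vectors of `N`. Subtracting `m'` repairs this without
    -- changing the image in `E`.
    obtain ⟨s, hs⟩ := P.exists_hom M (m - i.app g m') fun a ha x => by
      rw [map_sub, ← comm_path_apply, hm' a ha, hn a ha, sub_self]
    refine ⟨s, P.hom_eq ?_⟩
    change p.app g (s.app g (P.ε g)) = P.ε g
    rw [hs, map_sub, hm, hpi, sub_zero]

/-- Uniqueness is the vanishing of Hom and existence is the vanishing of Ext. Together they have the
shape of a bijectivity statement, as the unit of an adjunction provides. -/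
theorem perp_iff (N : QRep K V) : Perp E N ↔
    ∀ n : ∀ a, N.X a, ∃! m : N.X g, ∀ a, R a → ∀ x : Quiver.Path g a, N.pathMap x m = n a := by
  rw [Perp, P.homVanish_iff, P.extVanish_iff]
  constructor
  · rintro ⟨h1, h2⟩ n
    obtain ⟨m, hm⟩ := h2 n
    refine ⟨m, hm, fun m' hm' => sub_eq_zero.1 (h1 _ fun a ha x => ?_)⟩
    rw [map_sub, hm a ha, hm' a ha, sub_self]
  · intro h
    refine ⟨fun m hm => ?_, fun n => (h n).exists⟩
    exact (h fun _ => 0).unique hm fun a ha x => map_zero _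

/-- An endomorphism is determined by a multiple of the generator, and self-extensions split because
`E` is zero at all its relations. -/
theorem isExceptional : IsExceptional E where
  ne_zero := ⟨g, ⟨P.ε g, 0, P.ε_ne⟩⟩
  scalar f := by
    refine ⟨P.coord g (f.app g (P.ε g)), fun v x => ?_⟩
    have : f = ⟨fun v => P.coord g (f.app g (P.ε g)) • LinearMap.id, fun e => by
        ext; simp⟩ :=
      P.hom_eq (P.coord_smul g _).symm
    exact congrArg (fun f : E ⟶ E => f.app v x) this
  ext := (P.extVanish_iff E).2 fun n => ⟨0, fun a ha x => by
    rw [P.eq_zero (P.rel_ε a ha) (n a), map_zero]⟩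

end Presentation

/-- The criterion for an orthogonal projection. -/
theorem isOrthogonalProjection_of_adj [∀ a b : V, Subsingleton (Quiver.Path a b)]
    {E : QRep K V} {g : V} {R : V → Prop} (P : Presentation E g R) {α : V → ℕ} {β : W → ℕ}
    {π : QRep K V ⥤ QRep K W} {ι : QRep K W ⥤ QRep K V} (adj : π ⊣ ι)
    (hι : ∀ N v, Function.Bijective (Hom.app (adj.counit.app N) v))
    (hπ : ∀ N, (∀ v, Function.Bijective (Hom.app (adj.unit.app N) v)) ↔
      ∀ n : ∀ a, N.X a, ∃! m : N.X g, ∀ a, R a → ∀ x : Quiver.Path g a, N.pathMap x m = n a)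
    (hdim : ∀ N, dimVec N = β → dimVec (ι.obj N) = α) :
    IsOrthogonalProjection E α β π := by
  have : ∀ N, IsIso (adj.counit.app N) := fun N => (isIso_iff _).2 (hι N)
  have : IsIso adj.counit := NatIso.isIso_of_isIso_app _
  have ff := adj.fullyFaithfulROfIsIsoCounit
  have := ff.full
  have := ff.faithful
  refine ⟨P.isExceptional, ι, ⟨adj⟩, ff.full, ff.faithful, fun N => ?_, hdim⟩
  -- For a reflective subcategory the essential image consists of the objects with invertible unit.
  rw [← adj.isIso_unit_app_iff_mem_essImage, isIso_iff, hπ, P.perp_iff]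

/-- Orthogonal projections can be composed with equivalences. -/
theorem IsOrthogonalProjection.comp_equivalence {U : Type} [Quiver.{0} U] {E : QRep K V}
    {α : V → ℕ} {β : W → ℕ} {γ : U → ℕ} {π : QRep K V ⥤ QRep K W}
    (h : IsOrthogonalProjection E α β π) (Φ : QRep K W ≌ QRep K U)
    (hΦ : ∀ N, dimVec N = γ → dimVec (Φ.inverse.obj N) = β) :
    IsOrthogonalProjection E α γ (π ⋙ Φ.functor) := by
  obtain ⟨hE, ι, ⟨adj⟩, hfull, hfaith, hess, hdim⟩ := h
  refine ⟨hE, Φ.inverse ⋙ ι, ⟨adj.comp Φ.toAdjunction⟩, inferInstance, inferInstance,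
    fun N => ?_, fun N hN => hdim _ (hΦ N hN)⟩
  rw [← hess]
  constructor
  · rintro ⟨X, ⟨i⟩⟩
    exact ⟨Φ.inverse.obj X, ⟨i⟩⟩
  · rintro ⟨X, ⟨i⟩⟩
    exact ⟨Φ.functor.obj X, ⟨(ι.mapIso (Φ.unitIso.app X)).symm ≪≫ i⟩⟩

/-- The simple representation at a vertex without loops is generated at this vertex, with
relations at the heads of the arrows that start there. -/
def simplePresentation [∀ a b : V, Subsingleton (Quiver.Path a b)] (pos : V → ℕ)
    (hpos : ∀ {a b : V}, (a ⟶ b) → pos a < pos b) (v : V) :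
    Presentation (simple K v) v (fun w => Nonempty (v ⟶ w)) := by
  classical
  have hε : ∀ a, (show PLift (a = v) → K from fun _ => 1) ≠ 0 ↔ a = v := fun a => by
    constructor
    · intro h
      by_contra ha
      exact h (funext fun x => absurd x.down ha)
    · rintro rfl h
      exact one_ne_zero (congrFun h ⟨rfl⟩)
  have hpath : ∀ {a b : V}, Quiver.Path a b → pos a ≤ pos b := fun x => by
    induction x with
    | nil => exact le_rfl
    | cons x e ih => exact ih.trans (hpos e).le
  exact
  { ε := fun a => show PLift (a = v) → K from fun _ => 1
    coord := fun a => if h : a = v then LinearMap.proj (⟨h⟩ : PLift (a = v)) else 0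
    coord_smul := fun a x => funext fun h => by
      obtain rfl := h.down
      refine (mul_one _).trans ?_
      exact LinearMap.congr_fun (dif_pos rfl :
        (dite (a = a) (fun h => LinearMap.proj (⟨h⟩ : PLift (a = a))) fun _ => 0 :
          (PLift (a = a) → K) →ₗ[K] K) = _) x
    ε_ne := (hε v).2 rfl
    map_ε := fun {a b} e h => by
      obtain rfl := (hε a).1 h
      by_contra hb
      obtain rfl := (hε b).1 fun h' => hb h'.symm
      exact (hpos e).ne rfl
    reach := fun a h => by obtain rfl := (hε a).1 h; exact ⟨.nil⟩
    rel_ε := fun a ha => by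
      by_contra h
      obtain rfl := (hε a).1 h
      exact (hpos ha.some).ne rfl
    rel_of := fun {a b} e h _ => by obtain rfl := (hε a).1 h; exact ⟨e⟩
    before := fun {a b} x e h => (hε a).2 (by
      rcases h with h | h
      · obtain rfl := (hε b).1 h
        exact absurd ((hpath x).trans_lt (hpos e)) (lt_irrefl _)
      · obtain ⟨f⟩ := h
        -- By thinness the path through `a` is the single arrow `f`, so the part before `e` is
        -- empty.
        have := congrArg Quiver.Path.length (Subsingleton.elim (x.cons e) f.toPath)
        exact (Quiver.Path.eq_of_length_zero x (by simpa using this)).symm) }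

end QRep

end

/-! ### Deletion of a vertex with a single outgoing arrow -/

section

namespace QRep

variable {K : Type w} [Field K] {V W : Type} [Quiver.{0} V] [Quiver.{0} W]
  [∀ a b : V, Subsingleton (Quiver.Path a b)] [∀ a b : W, Subsingleton (Quiver.Path a b)]

omit [∀ a b : W, Subsingleton (Quiver.Path a b)] in
theorem pathMap_bijective_of_eq (M : QRep K V) {a b : V} (h : a = b) (x : Quiver.Path a b) :
    Function.Bijective (M.pathMap x) := by
  subst h
  have : M.pathMap x = LinearMap.id := LinearMap.ext (M.pathMap_loop x)
  rw [this]
  exact Function.bijective_id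

/-- Deleting a vertex `v` with exactly one arrow `v ⟶ w` that starts there. -/
theorem isOrthogonalProjection_restrict (pos : V → ℕ)
    (hpos : ∀ {a b : V}, (a ⟶ b) → pos a < pos b) {v w : V} (e : v ⟶ w)
    (he : ∀ w' : V, (v ⟶ w') → w' = w) (φ : W → V)
    (h : ∀ a b : W, (a ⟶ b) → Nonempty (Quiver.Path (φ a) (φ b))) (ρ : V → W)
    (h' : ∀ a b : V, (a ⟶ b) → Nonempty (Quiver.Path (ρ a) (ρ b))) (hρ : ∀ a, ρ (φ a) = a)
    (hv : φ (ρ v) = w) (hφ : ∀ a, a ≠ v → φ (ρ a) = a) {α : V → ℕ} {β : W → ℕ}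
    (hαβ : ∀ a, α a = β (ρ a)) :
    IsOrthogonalProjection (simple K v) α β (restrict φ h) := by
  -- The map `φ ∘ ρ` moves only `v`, namely to `w`. Together with `ρ ∘ φ = id` this is the Galois
  -- connection behind the adjunction.
  have η : ∀ a, Nonempty (Quiver.Path a (φ (ρ a))) := fun a => by
    by_cases ha : a = v
    · subst ha; rw [hv]; exact ⟨e.toPath⟩
    · rw [hφ a ha]; exact ⟨.nil⟩
  have ε : ∀ a, Nonempty (Quiver.Path (ρ (φ a)) a) := fun a => by rw [hρ]; exact ⟨.nil⟩
  refine isOrthogonalProjection_of_adj (simplePresentation pos hpos v)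
    (restrictAdj φ h ρ h' η ε) (fun N a => ?_) (fun N => ?_) (fun N hN => ?_)
  · change Function.Bijective (N.pathMap (ε a).some)
    exact N.pathMap_bijective_of_eq (hρ a) _
  -- At `v` the unit is the map of the arrow `e` and elsewhere it is an identity. So it is
  -- invertible exactly if `N.map e` is bijective, which is orthogonality to `S_v`, whose only
  -- relation is at `w`.
  · have hvw : Function.Bijective (N.pathMap (η v).some) ↔ Function.Bijective (N.map e) := by
      generalize (η v).some = x
      generalize φ (ρ v) = c at x hv
      subst hv
      rw [Subsingleton.elim x e.toPath]
      rfl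
    simp only [restrictAdj_unit]
    constructor
    · intro h n
      obtain ⟨m, hm, hu⟩ := Function.bijective_iff_existsUnique _ |>.1 (hvw.1 (h v)) (n w)
      refine ⟨m, fun a ha x => ?_, fun m' hm' => hu m' (hm' w ⟨e⟩ e.toPath)⟩
      obtain rfl := he a ha.some
      exact (N.pathMap_congr x e.toPath m).trans hm
    · intro h a
      by_cases ha : a = v
      · subst ha
        classical
        refine hvw.2 ((Function.bijective_iff_existsUnique _).2 fun y => ?_)
        obtain ⟨m, hm, hu⟩ := h (Function.update 0 w y)
        refine ⟨m, (hm w ⟨e⟩ e.toPath).trans (Function.update_self _ _ _),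
          fun m' hm' => hu m' fun b hb x => ?_⟩
        obtain rfl := he b hb.some
        exact (N.pathMap_congr x e.toPath m').trans (hm'.trans (Function.update_self _ _ _).symm)
      · exact N.pathMap_bijective_of_eq (hφ a ha).symm _
  · funext a
    exact (congrFun hN (ρ a)).trans (hαβ a).symm

end QRep

/-! ### Projections through simple representations -/

/-- The vertex of the linear quiver at a given height. -/
def AVert.at (r n : ℕ) : AVert r := if h : n < r then .chain ⟨n, h⟩ else .sink

/-- The vertex of the linear part of `A¹_{q+2}` at a given height. -/
def TVert.at (q n : ℕ) : TVert q := if h : n < q then .chain ⟨n, h⟩ else .sink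

theorem AVert.at_lt {r n : ℕ} (h : n < r) : AVert.at r n = .chain ⟨n, h⟩ := dif_pos h
theorem AVert.at_self (r : ℕ) : AVert.at r r = .sink := dif_neg (lt_irrefl r)
theorem TVert.at_lt {q n : ℕ} (h : n < q) : TVert.at q n = .chain ⟨n, h⟩ := dif_pos h
theorem TVert.at_self (q : ℕ) : TVert.at q q = .sink := dif_neg (lt_irrefl q)

theorem AVert.reach_at {r m n : ℕ} (h : m ≤ n) (hn : n ≤ r) :
    Nonempty (Quiver.Path (AVert.at r m) (AVert.at r n)) := by
  rcases hn.lt_or_eq with hn | rfl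
  · rw [AVert.at_lt hn, AVert.at_lt (h.trans_lt hn)]
    exact AVert.reach_chain_chain _ (n - m) _ (by simp; omega)
  · rcases h.lt_or_eq with h | rfl
    · rw [AVert.at_lt h, AVert.at_self]
      exact AVert.reach_chain_sink _
    · exact ⟨.nil⟩

theorem TVert.reach_at {q m n : ℕ} (h : m ≤ n) (hn : n ≤ q) :
    Nonempty (Quiver.Path (TVert.at q m) (TVert.at q n)) := by
  rcases hn.lt_or_eq with hn | rfl
  · rw [TVert.at_lt hn, TVert.at_lt (h.trans_lt hn)]
    exact TVert.reach_chain_chain _ (n - m) _ (by simp; omega)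
  · rcases h.lt_or_eq with h | rfl
    · rw [TVert.at_lt h, TVert.at_self]
      exact TVert.reach_chain_sink _
    · exact ⟨.nil⟩

/-- The map of vertices that repeats the vertex at height `i`. -/
def AVert.repeatV {r : ℕ} (i : ℕ) : AVert (r + 1) → AVert r
  | .chain j => AVert.at r (if j.val ≤ i then j.val else j.val - 1)
  | .sink => .sink

/-- The map of vertices that repeats the vertex at height `i`. -/
def TVert.repeatV {q : ℕ} (i : ℕ) : TVert (q + 1) → TVert q
  | .chain j => TVert.at q (if j.val ≤ i then j.val else j.val - 1)
  | .extra => .extra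
  | .sink => .sink

theorem AVert.repeatV_arrow {r : ℕ} (i : ℕ) : ∀ a b : AVert (r + 1), (a ⟶ b) →
    Nonempty (Quiver.Path (repeatV i a) (repeatV i b))
  | .chain j, .chain l, ⟨h⟩ => AVert.reach_at (by
      have h : l.val = j.val + 1 := h
      split_ifs <;> omega) (by have := l.isLt; split_ifs <;> omega)
  | .chain j, .sink, _ => by
    change Nonempty (Quiver.Path _ AVert.sink)
    rw [← AVert.at_self]
    exact AVert.reach_at (by have := j.isLt; split_ifs <;> omega) le_rfl

theorem TVert.repeatV_arrow {q : ℕ} (i : ℕ) : ∀ a b : TVert (q + 1), (a ⟶ b) →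
    Nonempty (Quiver.Path (repeatV i a) (repeatV i b))
  | .chain j, .chain l, ⟨h⟩ => TVert.reach_at (by
      have h : l.val = j.val + 1 := h
      split_ifs <;> omega) (by have := l.isLt; split_ifs <;> omega)
  | .chain j, .sink, _ => by
    change Nonempty (Quiver.Path _ TVert.sink)
    rw [← TVert.at_self]
    exact TVert.reach_at (by have := j.isLt; split_ifs <;> omega) le_rfl
  | .extra, .sink, _ => TVert.reach_extra_sink

/-- Explicit values turn the identities between cofaces and codegeneracies into linear arithmetic.
-/
theorem Fin.succAbove_val {n : ℕ} (i : Fin (n + 1)) (j : Fin n) :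
    (i.succAbove j).val = if j.val < i.val then j.val else j.val + 1 := by
  simp only [Fin.succAbove, Fin.lt_def, Fin.val_castSucc]
  split_ifs <;> rfl

theorem Fin.predAbove_val {n : ℕ} (i : Fin n) (j : Fin (n + 1)) :
    (i.predAbove j).val = if j.val ≤ i.val then j.val else j.val - 1 := by
  simp only [Fin.predAbove, Fin.lt_def, Fin.val_castSucc]
  split_ifs <;> first | rfl | omega

variable (K : Type w) [Field K]

/-- The section places at `chain i` the space of its successor. For the last `i` the successor is
the sink, which is why `repeatV` takes the place of `Fin.predAbove`. -/
theorem aProj_isOrthogonalProjection {r : ℕ} (i : Fin (r + 1)) :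
    QRep.IsOrthogonalProjection (QRep.simple K (AVert.chain i)) (fun _ => 1) (fun _ => 1)
      (aProj K i) := by
  have hi := i.isLt
  have harr : Nonempty ((AVert.chain i : AVert (r + 1)) ⟶ AVert.at (r + 1) (i.val + 1)) := by
    rcases Nat.lt_or_ge (i.val + 1) (r + 1) with h | h
    · rw [AVert.at_lt h]; exact ⟨⟨rfl⟩⟩
    · have h : i.val + 1 = r + 1 := by omega
      rw [h, AVert.at_self]; exact ⟨⟨h⟩⟩
  refine QRep.isOrthogonalProjection_restrict AVert.pos
    (fun e => by rw [AVert.pos_arrow e]; exact Nat.lt_succ_self _) harr.some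
    (fun w' e => AVert.head_unique e harr.some) _ _ (AVert.repeatV i.val) (AVert.repeatV_arrow _)
    ?_ ?_ ?_ fun _ => rfl
  · rintro (j | _)
    · have hj := j.isLt
      simp only [AVert.mapV, AVert.repeatV, OrderEmbedding.toOrderHom_coe,
        Fin.succAboveOrderEmb_apply, Fin.succAbove_val]
      rw [← AVert.at_lt j.isLt]
      congr 1
      split_ifs <;> omega
    · rfl
  · simp only [AVert.repeatV, le_refl, if_true]
    rcases Nat.lt_or_ge i.val r with h | h
    · rw [AVert.at_lt h, AVert.at_lt (by omega)]
      simp [AVert.mapV, Fin.ext_iff, Fin.succAbove_val]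
    · have h : i.val = r := by omega
      rw [h, AVert.at_self, AVert.at_self]
      rfl
  · rintro (j | _) hj
    · have hji : j.val ≠ i.val := fun h => hj (congrArg _ (Fin.ext h))
      have hj := j.isLt
      simp only [AVert.repeatV]
      rw [AVert.at_lt (by split_ifs <;> omega)]
      simp only [AVert.mapV, OrderEmbedding.toOrderHom_coe,
        Fin.succAboveOrderEmb_apply, AVert.chain.injEq, Fin.ext_iff, Fin.succAbove_val]
      split_ifs <;> omega
    · rfl

theorem tProj_isOrthogonalProjection {q : ℕ} (i : Fin (q + 1)) :
    QRep.IsOrthogonalProjection (QRep.simple K (TVert.chain i)) (fun _ => 1) (fun _ => 1)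
      (tProj K i) := by
  have hi := i.isLt
  have harr : Nonempty ((TVert.chain i : TVert (q + 1)) ⟶ TVert.at (q + 1) (i.val + 1)) := by
    rcases Nat.lt_or_ge (i.val + 1) (q + 1) with h | h
    · rw [TVert.at_lt h]; exact ⟨⟨rfl⟩⟩
    · have h : i.val + 1 = q + 1 := by omega
      rw [h, TVert.at_self]; exact ⟨⟨h⟩⟩
  refine QRep.isOrthogonalProjection_restrict TVert.pos
    (fun e => by rw [TVert.pos_arrow e]; exact Nat.lt_succ_self _) harr.some
    (fun w' e => TVert.head_unique e harr.some) _ _ (TVert.repeatV i.val) (TVert.repeatV_arrow _)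
    ?_ ?_ ?_ fun _ => rfl
  · rintro (j | _ | _)
    · have hj := j.isLt
      simp only [TVert.mapV, TVert.repeatV, OrderEmbedding.toOrderHom_coe,
        Fin.succAboveOrderEmb_apply, Fin.succAbove_val]
      rw [← TVert.at_lt j.isLt]
      congr 1
      split_ifs <;> omega
    · rfl
    · rfl
  · simp only [TVert.repeatV, le_refl, if_true]
    rcases Nat.lt_or_ge i.val q with h | h
    · rw [TVert.at_lt h, TVert.at_lt (by omega)]
      simp [TVert.mapV, Fin.ext_iff, Fin.succAbove_val]
    · have h : i.val = q := by omega
      rw [h, TVert.at_self, TVert.at_self]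
      rfl
  · rintro (j | _ | _) hj
    · have hji : j.val ≠ i.val := fun h => hj (congrArg _ (Fin.ext h))
      have hj := j.isLt
      simp only [TVert.repeatV]
      rw [TVert.at_lt (by split_ifs <;> omega)]
      simp only [TVert.mapV, OrderEmbedding.toOrderHom_coe,
        Fin.succAboveOrderEmb_apply, TVert.chain.injEq, Fin.ext_iff, Fin.succAbove_val]
      split_ifs <;> omega
    · rfl
    · rfl

/-- The map of vertices that sends `extra` to the sink. -/
def TVert.collapseV {q : ℕ} : TVert q → AVert q
  | .chain i => .chain i
  | .extra => .sink
  | .sink => .sink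

theorem TVert.collapseV_arrow {q : ℕ} :
    ∀ a b : TVert q, (a ⟶ b) → Nonempty (Quiver.Path (collapseV a) (collapseV b))
  | .chain _, .chain _, ⟨h⟩ => ⟨Quiver.Path.nil.cons ⟨h⟩⟩
  | .chain i, .sink, _ => AVert.reach_chain_sink i
  | .extra, .sink, _ => ⟨.nil⟩

/-- The only arrow that leaves `extra` ends at the sink, so the section places a copy of the space
at the sink there. -/
theorem tForget_isOrthogonalProjection {q : ℕ} :
    QRep.IsOrthogonalProjection (QRep.simple K (TVert.extra (q := q))) (fun _ => 1) (fun _ => 1)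
      (tForget K) := by
  have e : (TVert.extra : TVert q) ⟶ TVert.sink := ⟨trivial⟩
  refine QRep.isOrthogonalProjection_restrict TVert.pos
    (fun e => by rw [TVert.pos_arrow e]; exact Nat.lt_succ_self _) e
    (fun w' e' => TVert.head_unique e' e) _ _ TVert.collapseV TVert.collapseV_arrow
    ?_ rfl ?_ fun _ => rfl
  · rintro (j | _) <;> rfl
  · rintro (j | _ | _) h
    · rfl
    · exact absurd rfl h
    · rfl

theorem DVert.pos_lt {p : ℕ} {a b : DVert p} (e : a ⟶ b) : a.pos < b.pos := by
  rw [DVert.pos_arrow e]; exact Nat.lt_succ_self _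

/-- The dimension vector `(1, 2, …, 2, 1, 1)`. -/
def DVert.delta {p : ℕ} : DVert p → ℕ
  | .src => 1
  | .mid _ => 2
  | .snk _ => 1

/-- A middle vertex other than the last has a single successor. The last one is followed by both
sinks and needs a section that is not a pull-back. -/
theorem dProj_castSucc_isOrthogonalProjection {p : ℕ} (i : Fin p) :
    QRep.IsOrthogonalProjection (QRep.simple K (DVert.mid i.castSucc)) DVert.delta DVert.delta
      (dProj K i.castSucc) := by
  have e : (DVert.mid i.castSucc : DVert (p + 1)) ⟶ DVert.mid i.succ := ⟨rfl⟩
  refine QRep.isOrthogonalProjection_restrict DVert.pos DVert.pos_lt e ?_ _ _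
    (DVert.mapV (Fin.predAboveOrderHom i) id) (DVert.mapV_arrow _ _) ?_ ?_ ?_ ?_
  · rintro (_ | j | b) ⟨h⟩
    · exact h.elim
    · exact congrArg _ (Fin.ext h)
    · have h : i.val + 1 = p + 1 := h
      omega
  · rintro (_ | j | b)
    · rfl
    · simp only [DVert.mapV, DVert.mid.injEq, Fin.ext_iff, OrderEmbedding.toOrderHom_coe,
        Fin.succAboveOrderEmb_apply, Fin.predAboveOrderHom_coe, Fin.predAbove_val,
        Fin.succAbove_val, Fin.val_castSucc]
      split_ifs <;> omega
    · rfl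
  · simp [DVert.mapV]
  · rintro (_ | j | b) hj
    · rfl
    · have hji : j.val ≠ i.val := fun h => hj (congrArg _ (Fin.ext h))
      simp only [DVert.mapV, DVert.mid.injEq, Fin.ext_iff, OrderEmbedding.toOrderHom_coe,
        Fin.succAboveOrderEmb_apply, Fin.predAboveOrderHom_coe, Fin.predAbove_val,
        Fin.succAbove_val, Fin.val_castSucc]
      split_ifs <;> omega
    · rfl
  · rintro (_ | j | b) <;> rfl

/-! ### Sections -/

theorem DVert.reach_mid_le {p : ℕ} {i j : Fin p} (h : i ≤ j) :
    Nonempty (Quiver.Path (DVert.mid i) (DVert.mid j)) :=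
  DVert.reach_mid_mid i (j.val - i.val) j (by rw [Fin.le_def] at h; omega)

theorem TVert.reach_chain_le {p : ℕ} {i j : Fin p} (h : i ≤ j) :
    Nonempty (Quiver.Path (TVert.chain i) (TVert.chain j)) :=
  TVert.reach_chain_chain i (j.val - i.val) j (by rw [Fin.le_def] at h; omega)

theorem AVert.reach_chain_le {p : ℕ} {i j : Fin p} (h : i ≤ j) :
    Nonempty (Quiver.Path (AVert.chain i) (AVert.chain j)) :=
  AVert.reach_chain_chain i (j.val - i.val) j (by rw [Fin.le_def] at h; omega)

/-- With `Fin.predAbove_succAbove_le` this makes the codegeneracy left adjoint to the coface as a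
monotone map, the Galois connection behind `dAdj`, `tAdj` and `aAdj`. -/
theorem Fin.le_succAbove_predAbove {n : ℕ} (i : Fin n) (j : Fin (n + 1)) :
    j ≤ i.castSucc.succAbove (i.predAbove j) := by
  rw [Fin.le_def, Fin.succAbove_val, Fin.predAbove_val, Fin.val_castSucc]
  split_ifs <;> omega

theorem Fin.predAbove_succAbove_le {n : ℕ} (i : Fin n) (j : Fin n) :
    i.predAbove (i.castSucc.succAbove j) ≤ j := by
  rw [Fin.le_def, Fin.predAbove_val, Fin.succAbove_val, Fin.val_castSucc]
  split_ifs <;> omega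

/-- The repetition at `mid i` is right adjoint to the contraction. -/
def dAdj {p : ℕ} (i : Fin p) : dProj K i.castSucc ⊣ dSect K i :=
  QRep.restrictAdj _ _ _ _
    (fun a => match a with
      | .src => ⟨.nil⟩
      | .mid j => DVert.reach_mid_le (Fin.le_succAbove_predAbove i j)
      | .snk _ => ⟨.nil⟩)
    (fun a => match a with
      | .src => ⟨.nil⟩
      | .mid j => DVert.reach_mid_le (Fin.predAbove_succAbove_le i j)
      | .snk _ => ⟨.nil⟩)

/-- The repetition at `chain i` is right adjoint to the contraction. -/
def tAdj {q : ℕ} (i : Fin q) : tProj K i.castSucc ⊣ tSect K i :=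
  QRep.restrictAdj _ _ _ _
    (fun a => match a with
      | .chain j => TVert.reach_chain_le (Fin.le_succAbove_predAbove i j)
      | .extra => ⟨.nil⟩
      | .sink => ⟨.nil⟩)
    (fun a => match a with
      | .chain j => TVert.reach_chain_le (Fin.predAbove_succAbove_le i j)
      | .extra => ⟨.nil⟩
      | .sink => ⟨.nil⟩)

/-- The repetition at `chain i` is right adjoint to the contraction. -/
def aAdj {r : ℕ} (i : Fin r) : aProj K i.castSucc ⊣ aSect K i :=
  QRep.restrictAdj _ _ _ _
    (fun a => match a with
      | .chain j => AVert.reach_chain_le (Fin.le_succAbove_predAbove i j)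
      | .sink => ⟨.nil⟩)
    (fun a => match a with
      | .chain j => AVert.reach_chain_le (Fin.predAbove_succAbove_le i j)
      | .sink => ⟨.nil⟩)

/-! ### Loops and the identification of `A_2` with `A¹_2` -/

/-- The exchange of the two sinks is an involution. -/
def dSwapSwap {p : ℕ} : dSwap K (p := p) ⋙ dSwap K ≅ 𝟭 _ :=
  QRep.restrictComp _ _ _ _ (fun a => a) (fun _ _ e => ⟨e.toPath⟩)
    (by rintro (_ | _ | b) <;> simp [DVert.mapV]) ≪≫ QRep.restrictId _ _ fun _ => rfl

/-- The exchange of the two sources is an involution. -/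
def tSwapSwap : tSwap K ⋙ tSwap K ≅ 𝟭 _ :=
  QRep.restrictComp _ _ _ _ (fun a => a) (fun _ _ e => ⟨e.toPath⟩)
    (by rintro (_ | _ | b) <;> simp [TVert.swapV, Fin.fin_one_eq_zero]) ≪≫
      QRep.restrictId _ _ fun _ => rfl

instance dSwap_isEquivalence {p : ℕ} : (dSwap K (p := p)).IsEquivalence :=
  Equivalence.isEquivalence_functor
    (CategoryTheory.Equivalence.mk (dSwap K) (dSwap K) (dSwapSwap K).symm (dSwapSwap K))

instance tSwap_isEquivalence : (tSwap K).IsEquivalence :=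
  Equivalence.isEquivalence_functor
    (CategoryTheory.Equivalence.mk (tSwap K) (tSwap K) (tSwapSwap K).symm (tSwapSwap K))

/-- The inverse of `AVert.foldV`. -/
def TVert.unfoldV : TVert 0 → AVert 1
  | .chain i => .chain i.castSucc
  | .extra => .chain 0
  | .sink => .sink

theorem TVert.unfoldV_arrow :
    ∀ a b : TVert 0, (a ⟶ b) → Nonempty (Quiver.Path (unfoldV a) (unfoldV b))
  | .chain i, _, _ => i.elim0
  | .extra, .sink, _ => AVert.reach_chain_sink 0

/-- The equivalence between the representations of `A¹_2` and of `A_2`. -/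
def tFoldEquivalence : QRep K (TVert 0) ≌ QRep K (AVert 1) :=
  CategoryTheory.Equivalence.mk (tFold K) (QRep.restrict TVert.unfoldV TVert.unfoldV_arrow)
    (QRep.restrictComp _ _ _ _ (fun a => a) (fun _ _ e => ⟨e.toPath⟩)
      (by rintro (i | _ | _); exacts [i.elim0, rfl, rfl]) ≪≫ QRep.restrictId _ _ fun _ => rfl).symm
    (QRep.restrictComp _ _ _ _ (fun a => a) (fun _ _ e => ⟨e.toPath⟩)
      (by rintro (i | _) <;> simp [AVert.foldV, TVert.unfoldV, Fin.fin_one_eq_zero]) ≪≫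
        QRep.restrictId _ _ fun _ => rfl)

theorem comp_tFold_isOrthogonalProjection {V : Type} [Quiver.{0} V] {E : QRep K V} {α : V → ℕ}
    {π : QRep K V ⥤ QRep K (TVert 0)}
    (h : QRep.IsOrthogonalProjection E α (fun _ => 1) π) :
    QRep.IsOrthogonalProjection E α (fun _ => 1) (π ⋙ tFold K) :=
  h.comp_equivalence (tFoldEquivalence K) fun _ hN => funext fun a =>
    congrFun hN (TVert.unfoldV a)

end

section

instance DVert.finite (p : ℕ) : Finite (DVert p) := by
  refine Finite.of_surjective (fun x : Unit ⊕ Fin p ⊕ Bool => match x with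
    | .inl _ => DVert.src
    | .inr (.inl i) => .mid i
    | .inr (.inr b) => .snk b) ?_
  rintro (_ | i | b)
  exacts [⟨.inl (), rfl⟩, ⟨.inr (.inl i), rfl⟩, ⟨.inr (.inr b), rfl⟩]

/-! ### Kan extensions -/

namespace QRep

section Ran

variable {K : Type w} [Field K] {V W : Type} [Quiver.{0} V] [Quiver.{0} W]
  [Finite W] [∀ a b : V, Subsingleton (Quiver.Path a b)]
  [∀ a b : W, Subsingleton (Quiver.Path a b)]

/-- The space of compatible families over the vertices `w` with a path from `a` to `φ w`. -/
def ranSpace (φ : W → V) (N : QRep K W) (a : V) :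
    Submodule K (∀ w, Quiver.Path a (φ w) → N.X w) where
  carrier := {n | ∀ (w w' : W) (e : w ⟶ w') (x : Quiver.Path a (φ w))
    (x' : Quiver.Path a (φ w')), n w' x' = N.map e (n w x)}
  add_mem' hn hn' w w' e x x' := by simp [hn w w' e x x', hn' w w' e x x']
  zero_mem' w w' e x x' := by simp
  smul_mem' c n hn w w' e x x' := by simp [hn w w' e x x']

/-- The right Kan extension. -/
def ran (φ : W → V) : QRep K W ⥤ QRep K V where
  obj N :=
    { X := fun a => ranSpace φ N a
      map := fun {a b} e =>
        { toFun := fun n => ⟨fun w x => n.1 w (e.toPath.comp x),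
            fun w w' f x x' => n.2 w w' f _ _⟩
          map_add' := fun _ _ => rfl
          map_smul' := fun _ _ => rfl } }
  map {N N'} f := ⟨fun a =>
    { toFun := fun n => ⟨fun w x => f.app w (n.1 w x), fun w w' e x x' =>
        (congrArg (f.app w') (n.2 w w' e x x')).trans (comm_apply f e _)⟩
      map_add' := fun n n' => Subtype.ext (funext fun w => funext fun x => map_add _ _ _)
      map_smul' := fun c n => Subtype.ext (funext fun w => funext fun x => map_smul _ _ _) },
    fun _ => rfl⟩
  map_id _ := rfl
  map_comp _ _ := rfl

omit [∀ a b : W, Subsingleton (Quiver.Path a b)] in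
theorem ran_pathMap (φ : W → V) (N : QRep K W) {a b : V} (y : Quiver.Path a b)
    (n : ranSpace φ N a) (w : W) (x : Quiver.Path b (φ w)) :
    Subtype.val (p := (· ∈ ranSpace φ N b)) (((ran φ).obj N).pathMap y n) w x =
      n.1 w (y.comp x) := by
  induction y with
  | nil => exact congrArg (n.1 w) (Subsingleton.elim _ _)
  | cons y e ih => exact (ih (e.toPath.comp x)).trans (congrArg (n.1 w) (Subsingleton.elim _ _))

omit [Finite W] [∀ a b : W, Subsingleton (Quiver.Path a b)] in
-- Compatibility extends from arrows to paths because `φ` preserves reachability and so supplies the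
-- intermediate paths from `a`.
theorem ranSpace_path {φ : W → V} {N : QRep K W} {a : V} (n : ranSpace φ N a) {w w' : W}
    (h : ∀ a b : W, (a ⟶ b) → Nonempty (Quiver.Path (φ a) (φ b)))
    (y : Quiver.Path w w') (x : Quiver.Path a (φ w)) (x' : Quiver.Path a (φ w')) :
    n.1 w' x' = N.pathMap y (n.1 w x) := by
  induction y with
  | nil => exact congrArg (n.1 w) (Subsingleton.elim _ _)
  | cons y e ih =>
    obtain ⟨z⟩ := nonempty_path_of_arrows h y
    exact (n.2 _ _ e (x.comp z) x').trans (congrArg (N.map e) (ih (x.comp z)))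

/-- The right Kan extension is right adjoint to the pull-back. -/
def ranAdj (φ : W → V) (h : ∀ a b : W, (a ⟶ b) → Nonempty (Quiver.Path (φ a) (φ b))) :
    restrict (K := K) φ h ⊣ ran φ :=
  Adjunction.mkOfUnitCounit
    { unit :=
        { app := fun M => ⟨fun a =>
            { toFun := fun m => ⟨fun w x => M.pathMap x m, fun w w' e x x' =>
                (M.pathMap_pathMap x (h w w' e).some x' m).symm⟩
              map_add' := fun n n' => Subtype.ext (funext fun w => funext fun x => map_add _ _ _)
              map_smul' := fun c n =>
                Subtype.ext (funext fun w => funext fun x => map_smul _ _ _) },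
            fun {a b} e => LinearMap.ext fun m => Subtype.ext (funext fun w => funext fun x =>
              (M.pathMap_comp_apply e.toPath x m).symm)⟩
          naturality := fun M N f => hom_ext fun a m => Subtype.ext (funext fun w =>
            funext fun x => (comm_path_apply f x m).symm) }
      counit :=
        { app := fun N => ⟨fun w =>
            { toFun := fun n => n.1 w .nil
              map_add' := fun _ _ => rfl
              map_smul' := fun _ _ => rfl },
            fun {w w'} e => LinearMap.ext fun n =>
              (ran_pathMap φ N (h w w' e).some n w' .nil).trans (n.2 w w' e .nil _)⟩
          naturality := fun M N f => rfl }
      left_triangle := rfl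
      right_triangle := by
        ext N
        refine hom_ext fun a n => Subtype.ext (funext fun w => funext fun x => ?_)
        exact ran_pathMap φ N x n w .nil }

/-- If `φ` reflects reachability, then `w` precedes all vertices that index the families at `φ w`,
so a family is determined by its value at `w`. -/
theorem ranAdj_counit_bijective (φ : W → V)
    (h : ∀ a b : W, (a ⟶ b) → Nonempty (Quiver.Path (φ a) (φ b)))
    (hφ : ∀ {a b : W}, Quiver.Path (φ a) (φ b) → Nonempty (Quiver.Path a b)) (N : QRep K W)
    (w : W) : Function.Bijective (Hom.app ((ranAdj φ h).counit.app N) w) := by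
  constructor
  · intro n n' hn
    refine Subtype.ext (funext fun w' => funext fun x => ?_)
    obtain ⟨y⟩ := hφ x
    rw [ranSpace_path n h y .nil x, ranSpace_path n' h y .nil x]
    exact congrArg _ hn
  · intro m
    refine ⟨⟨fun w' x => N.pathMap (hφ x).some m, fun w₁ w₂ e x x' => ?_⟩, N.pathMap_loop _ m⟩
    exact (N.pathMap_pathMap (hφ x).some e.toPath (hφ x').some m).symm

/-- The unit at `φ w` is a one-sided inverse of the bijective counit. -/
theorem ranAdj_unit_bijective (φ : W → V)
    (h : ∀ a b : W, (a ⟶ b) → Nonempty (Quiver.Path (φ a) (φ b)))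
    (hφ : ∀ {a b : W}, Quiver.Path (φ a) (φ b) → Nonempty (Quiver.Path a b)) (M : QRep K V)
    (w : W) : Function.Bijective (Hom.app ((ranAdj φ h).unit.app M) (φ w)) := by
  have h1 := ranAdj_counit_bijective φ h hφ ((restrict φ h).obj M) w
  have h2 : ∀ m, Hom.app ((ranAdj φ h).counit.app ((restrict φ h).obj M)) w
      (Hom.app ((ranAdj φ h).unit.app M) (φ w) m) = m := fun m => rfl
  constructor
  · intro m m' hm
    rw [← h2 m, ← h2 m', hm]
  · intro n
    exact ⟨_, h1.1 (h2 (Hom.app ((ranAdj φ h).counit.app ((restrict φ h).obj M)) w n))⟩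

theorem dimVec_ran (φ : W → V) (h : ∀ a b : W, (a ⟶ b) → Nonempty (Quiver.Path (φ a) (φ b)))
    (hφ : ∀ {a b : W}, Quiver.Path (φ a) (φ b) → Nonempty (Quiver.Path a b)) (N : QRep K W)
    (w : W) : dimVec ((ran φ).obj N) (φ w) = dimVec N w :=
  (LinearEquiv.ofBijective _ (ranAdj_counit_bijective φ h hφ N w)).finrank_eq

end Ran

end QRep

/-! ### Contraction at the last middle vertex -/

variable (K : Type w) [Field K]

theorem DVert.mid_of_path {p : ℕ} {i : Fin p} {a : DVert p} (x : Quiver.Path (DVert.mid i) a) :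
    (∃ j : Fin p, i ≤ j ∧ a = .mid j) ∨ ∃ b, a = .snk b := by
  have h := DVert.pos_path x
  rcases a with _ | j | b
  · simp only [DVert.pos] at h; omega
  · exact Or.inl ⟨j, by rw [Fin.le_def]; simp only [DVert.pos] at h; omega, rfl⟩
  · exact Or.inr ⟨b, rfl⟩

theorem DVert.eq_of_path_snk {p : ℕ} {b : Bool} {a : DVert p} (x : Quiver.Path (DVert.snk b) a) :
    a = .snk b := by
  induction x with
  | nil => rfl
  | cons x e ih => subst ih; exact e.down.elim

/-- Needed for the Kan extension along the inclusion that misses a middle vertex: `Fin.succAbove` is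
an order embedding, so reachability is reflected. -/
theorem DVert.path_of_mapV_succAbove {p : ℕ} (i : Fin (p + 1)) : ∀ {a b : DVert p},
    Quiver.Path (DVert.mapV (Fin.succAboveOrderEmb i).toOrderHom id a)
      (DVert.mapV (Fin.succAboveOrderEmb i).toOrderHom id b) → Nonempty (Quiver.Path a b)
  | .src, .src, _ => ⟨.nil⟩
  | .src, .mid j, _ => DVert.reach_src_mid j
  | .src, .snk b, _ => DVert.reach_src_snk b
  | .mid _, .src, x => by
    have := DVert.pos_path x
    simp only [DVert.pos, DVert.mapV] at this
    omega
  | .mid j, .mid l, x => DVert.reach_mid_le (by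
    have := DVert.pos_path x
    simp only [DVert.pos, DVert.mapV] at this
    have h : (Fin.succAboveOrderEmb i).toOrderHom j ≤ (Fin.succAboveOrderEmb i).toOrderHom l := by
      rw [Fin.le_def]; omega
    simpa using h)
  | .mid j, .snk b, _ => DVert.reach_mid_snk j b
  | .snk _, .src, x => by cases DVert.eq_of_path_snk x
  | .snk _, .mid _, x => by cases DVert.eq_of_path_snk x
  | .snk _, .snk _, x => by cases DVert.eq_of_path_snk x; exact ⟨.nil⟩

/-- Two arrows leave the last middle vertex, so no single vertex supplies the missing space. The Kan
extension places the product of the spaces at the two sinks there. Its dimension is `1 + 1`, the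
entry of `δ`, and orthogonality to the simple representation says that the space at this vertex maps
isomorphically to the product. -/
theorem dProj_last_isOrthogonalProjection {p : ℕ} :
    QRep.IsOrthogonalProjection (QRep.simple K (DVert.mid (Fin.last p))) DVert.delta DVert.delta
      (dProj K (Fin.last p)) := by
  have e : ∀ b, (DVert.mid (Fin.last p) : DVert (p + 1)) ⟶ DVert.snk b := fun b => ⟨rfl⟩
  have hsnk : ∀ {a}, Quiver.Path (DVert.mid (Fin.last p))
      (DVert.mapV (Fin.succAboveOrderEmb (Fin.last p)).toOrderHom id a) → ∃ b, a = .snk b := by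
    intro a x
    rcases a with _ | j | b
    · rcases DVert.mid_of_path x with ⟨j, _, h⟩ | ⟨b, h⟩ <;> cases h
    · rcases DVert.mid_of_path x with ⟨l, hl, h⟩ | ⟨b, h⟩
      · injection h with h
        have : j.castSucc = l := by simpa using h
        subst this
        exact absurd hl (not_le_of_gt (Fin.castSucc_lt_last j))
      · cases h
    · exact ⟨b, rfl⟩
  -- The families at the deleted vertex live over the sinks only. No arrow starts there, so
  -- compatibility is an empty condition.
  have hcompat : ∀ {N : QRep K (DVert p)} (n : ∀ w, Quiver.Path (DVert.mid (Fin.last p))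
      (DVert.mapV (Fin.succAboveOrderEmb (Fin.last p)).toOrderHom id w) → N.X w),
      n ∈ QRep.ranSpace _ N (DVert.mid (Fin.last p)) := by
    intro N n w w' f x x'
    obtain ⟨b, rfl⟩ := hsnk x
    exact f.down.elim
  refine QRep.isOrthogonalProjection_of_adj
    (QRep.simplePresentation DVert.pos DVert.pos_lt (DVert.mid (Fin.last p)))
    (QRep.ranAdj _ _) (fun N w => QRep.ranAdj_counit_bijective _ _
      (DVert.path_of_mapV_succAbove _) N w) (fun N => ?_) (fun N hN => ?_)
  · constructor
    · intro h n
      obtain ⟨m, hm, hu⟩ := (Function.bijective_iff_existsUnique _).1 (h (DVert.mid (Fin.last p)))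
        ⟨fun w _ => n (DVert.mapV (Fin.succAboveOrderEmb (Fin.last p)).toOrderHom id w),
          hcompat _⟩
      refine ⟨m, ?_, fun m' hm' => hu m' (Subtype.ext (funext fun w => funext fun x => ?_))⟩
      · rintro (_ | j | b) ⟨f⟩ x
        · exact f.down.elim
        · have h : j.val = p + 1 := f.down
          omega
        · exact congrFun (congrFun (congrArg Subtype.val hm) (.snk b)) x
      · obtain ⟨b, rfl⟩ := hsnk x
        exact hm' (.snk b) ⟨e b⟩ x
    · rintro h (_ | j | b)
      · exact QRep.ranAdj_unit_bijective _ _ (DVert.path_of_mapV_succAbove _) N .src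
      · rcases Fin.eq_castSucc_or_eq_last j with ⟨j, rfl⟩ | rfl
        · have hj : (DVert.mid j.castSucc : DVert (p + 1)) =
              DVert.mapV (Fin.succAboveOrderEmb (Fin.last p)).toOrderHom id (.mid j) := by
            simp [DVert.mapV]
          rw [hj]
          exact QRep.ranAdj_unit_bijective _ _ (DVert.path_of_mapV_succAbove _) N (.mid j)
        · refine (Function.bijective_iff_existsUnique _).2 fun n => ?_
          -- Only the entries at the sinks matter; the others are set to zero.
          obtain ⟨m, hm, hu⟩ := h fun a => match a with
            | .src => 0
            | .mid _ => 0
            | .snk b => n.1 (.snk b) (e b).toPath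
          refine ⟨m, Subtype.ext (funext fun w => funext fun x => ?_), fun m' hm' => hu m' ?_⟩
          · obtain ⟨b, rfl⟩ := hsnk x
            exact (hm (.snk b) ⟨e b⟩ x).trans (congrArg (n.1 _) (Subsingleton.elim _ _))
          · rintro (_ | j | b) ⟨f⟩ x
            · exact f.down.elim
            · have h : j.val = p + 1 := f.down
              omega
            · exact (congrFun (congrFun (congrArg Subtype.val hm') (.snk b)) x).trans
                (congrArg (n.1 (.snk b)) (Subsingleton.elim _ _))
      · exact QRep.ranAdj_unit_bijective _ _ (DVert.path_of_mapV_succAbove _) N (.snk b)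
  · have hd := fun w => (QRep.dimVec_ran _ (DVert.mapV_arrow _ _)
      (DVert.path_of_mapV_succAbove (Fin.last p)) N w).trans (congrFun hN w)
    funext a
    rcases a with _ | j | b
    · exact hd .src
    · rcases Fin.eq_castSucc_or_eq_last j with ⟨j, rfl⟩ | rfl
      · simpa [DVert.mapV, DVert.delta] using hd (.mid j)
      · let E : QRep.ranSpace (DVert.mapV (Fin.succAboveOrderEmb (Fin.last p)).toOrderHom id) N
            (DVert.mid (Fin.last p)) ≃ₗ[K] (∀ b, N.X (.snk b)) :=
          { toFun := fun n b => n.1 (.snk b) (e b).toPath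
            map_add' := fun _ _ => rfl
            map_smul' := fun _ _ => rfl
            invFun := fun m => ⟨fun w x => match w with
              | .src => 0
              | .mid _ => 0
              | .snk b => m b, hcompat _⟩
            left_inv := fun n => Subtype.ext (funext fun w => funext fun x => by
              obtain ⟨b, rfl⟩ := hsnk x
              exact congrArg (n.1 (.snk b)) (Subsingleton.elim _ _))
            right_inv := fun m => rfl }
        refine E.finrank_eq.trans ?_
        rw [Module.finrank_pi_fintype]
        have h0 : ∀ b, Module.finrank K (N.X (.snk b)) = 1 := fun b => congrFun hN (.snk b)
        simp [h0, DVert.delta]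
    · exact hd (.snk b)

end

section

variable (K : Type w) [Field K]

/-! ### Projections through injective representations -/

theorem DVert.eq_of_arrow_into_or {p : ℕ} {a c : DVert p} (e : a ⟶ c) (b : Bool) :
    Nonempty (Quiver.Path a (.snk b)) := by
  rcases a with _ | i | b'
  · exact DVert.reach_src_snk b
  · exact DVert.reach_mid_snk i b
  · exact e.down.elim

/-- The injective representation at a sink is generated at the source with a relation at the
other sink. -/
def injectivePresentation {p : ℕ} (b : Bool) :
    QRep.Presentation (QRep.injective K (V := DVert p) (.snk b)) .src (fun a => a = .snk (!b)) := by
  classical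
  have hε : ∀ a : DVert p, (show Quiver.Path a (.snk b) → K from fun _ => 1) ≠ 0 ↔
      Nonempty (Quiver.Path a (.snk b)) := fun a => by
    constructor
    · intro h
      by_contra ha
      exact h (funext fun x => absurd ⟨x⟩ ha)
    · rintro ⟨x⟩ h
      exact one_ne_zero (congrFun h x)
  have hsnk : ¬ Nonempty (Quiver.Path (DVert.snk (!b) : DVert p) (.snk b)) := by
    rintro ⟨x⟩
    have := DVert.eq_of_path_snk x
    simp at this
  exact
  { ε := fun a => show Quiver.Path a (.snk b) → K from fun _ => 1
    coord := fun a => if h : Nonempty (Quiver.Path a (.snk b)) then LinearMap.proj h.some else 0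
    coord_smul := fun a x => funext fun y => by
      refine (mul_one _).trans ?_
      refine (LinearMap.congr_fun (dif_pos ⟨y⟩ :
        (dite (Nonempty (Quiver.Path a (.snk b))) (fun h => LinearMap.proj h.some) fun _ => 0 :
          (Quiver.Path a (.snk b) → K) →ₗ[K] K) = _) x).trans ?_
      exact congrArg x (Subsingleton.elim _ _)
    ε_ne := (hε _).2 (DVert.reach_src_snk b)
    map_ε := fun {a b} e h => rfl
    reach := fun a h => match a with
      | .src => ⟨.nil⟩
      | .mid i => DVert.reach_src_mid i
      | .snk c => DVert.reach_src_snk c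
    rel_ε := fun a ha => by
      subst ha
      exact not_not.1 fun h => hsnk ((hε _).1 h)
    rel_of := fun {a c} e h h0 => by
      rcases c with _ | i | c
      · rcases a with _ | _ | _ <;> exact e.down.elim
      · exact absurd h0 ((hε _).2 (DVert.reach_mid_snk i b))
      · rcases Bool.eq_or_eq_not c b with rfl | rfl
        · exact absurd h0 ((hε _).2 ⟨.nil⟩)
        · rfl
    before := fun {a c} x e h => (hε a).2 (DVert.eq_of_arrow_into_or e b) }

/-! ### The explicit section of the projection through an injective representation -/

section Section

variable {K} {p : ℕ}

theorem midImage_eq (M : QRep K (DVert p)) {i : Fin p} (x : Quiver.Path DVert.src (DVert.mid i)) :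
    midImage M i = LinearMap.range (M.pathMap x) :=
  le_antisymm (iSup_le fun y => by rw [Subsingleton.elim y x]) (le_iSup_of_le x le_rfl)

theorem snkImage_eq (M : QRep K (DVert p)) (x : Quiver.Path DVert.src (DVert.snk false))
    (y : Quiver.Path DVert.src (DVert.snk true)) :
    snkImage M = LinearMap.range ((M.pathMap x).prod (M.pathMap y)) :=
  le_antisymm (iSup_le fun z => by rw [Subsingleton.elim z (x, y)])
    (le_iSup_of_le (x, y) le_rfl)

/-- The vertex of `A¹_{p+2}` whose space is placed at a sink of `D*_{p+3}`. -/
def iSectV : Bool → Bool → TVert p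
  | false, false => .sink
  | true, true => .sink
  | false, true => .extra
  | true, false => .extra

/-- The spaces of the section of the projection through `I_{snk b}`. -/
def iSectX (b : Bool) (N : QRep K (TVert p)) : DVert p → Type w
  | .src => N.X .extra
  | .mid i => N.X (.chain i) × N.X .extra
  | .snk c => N.X (iSectV b c)

instance (b : Bool) (N : QRep K (TVert p)) : ∀ v, AddCommGroup (iSectX b N v)
  | .src => inferInstanceAs (AddCommGroup (N.X .extra))
  | .mid i => inferInstanceAs (AddCommGroup (N.X (.chain i) × N.X .extra))
  | .snk c => inferInstanceAs (AddCommGroup (N.X (iSectV b c)))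

instance (b : Bool) (N : QRep K (TVert p)) : ∀ v, Module K (iSectX b N v)
  | .src => inferInstanceAs (Module K (N.X .extra))
  | .mid i => inferInstanceAs (Module K (N.X (.chain i) × N.X .extra))
  | .snk c => inferInstanceAs (Module K (N.X (iSectV b c)))

instance (b : Bool) (N : QRep K (TVert p)) : ∀ v, Module.Finite K (iSectX b N v)
  | .src => inferInstanceAs (Module.Finite K (N.X .extra))
  | .mid i => inferInstanceAs (Module.Finite K (N.X (.chain i) × N.X .extra))
  | .snk c => inferInstanceAs (Module.Finite K (N.X (iSectV b c)))

/-- The two projections, distributed over the sinks. -/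
def iSectSnk (N : QRep K (TVert p)) :
    ∀ b c : Bool, N.X .sink × N.X .extra →ₗ[K] N.X (iSectV b c)
  | false, false => LinearMap.fst K (N.X .sink) (N.X .extra)
  | true, true => LinearMap.fst K (N.X .sink) (N.X .extra)
  | false, true => LinearMap.snd K (N.X .sink) (N.X .extra)
  | true, false => LinearMap.snd K (N.X .sink) (N.X .extra)

/-- The arrow that starts at `extra`. -/
def TVert.extraArrow : (TVert.extra : TVert p) ⟶ TVert.sink := ⟨trivial⟩

/-- The maps of the section of the projection through `I_{snk b}`. -/
def iSectMap (b : Bool) (N : QRep K (TVert p)) :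
    ∀ {a c : DVert p}, (a ⟶ c) → (iSectX b N a →ₗ[K] iSectX b N c)
  | .src, .mid i, _ => LinearMap.inr K (N.X (.chain i)) (N.X .extra)
  | .src, .snk c, _ => iSectSnk N b c ∘ₗ (-N.map TVert.extraArrow).prod LinearMap.id
  | .mid i, .mid j, ⟨h⟩ =>
    (N.map (show TVert.chain i ⟶ TVert.chain j from ⟨h⟩)).prodMap LinearMap.id
  | .mid i, .snk c, ⟨h⟩ => iSectSnk N b c ∘ₗ
      (N.map (show TVert.chain i ⟶ TVert.sink from ⟨h⟩) ∘ₗ LinearMap.fst K _ _ -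
        N.map TVert.extraArrow ∘ₗ LinearMap.snd K _ _).prod (LinearMap.snd K _ _)

/-- The components of the section on morphisms. -/
def iSectApp (b : Bool) {M N : QRep K (TVert p)} (f : M ⟶ N) :
    ∀ v, iSectX b M v →ₗ[K] iSectX b N v
  | .src => f.app .extra
  | .mid i => (f.app (.chain i)).prodMap (f.app .extra)
  | .snk c => f.app (iSectV b c)

theorem iSectSnk_app {M N : QRep K (TVert p)} (f : M ⟶ N) (b c : Bool) (x : M.X .sink)
    (y : M.X .extra) : f.app (iSectV b c) (iSectSnk M b c (x, y)) =
      iSectSnk N b c (f.app _ x, f.app _ y) := by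
  cases b <;> cases c <;> rfl

theorem iSectApp_comm (b : Bool) {M N : QRep K (TVert p)} (f : M ⟶ N) :
    ∀ {a c : DVert p} (e : a ⟶ c),
      iSectApp b f c ∘ₗ iSectMap b M e = iSectMap b N e ∘ₗ iSectApp b f a
  | .src, .mid i, _ => LinearMap.ext fun x => Prod.ext (map_zero (f.app (.chain i))) rfl
  | .src, .snk c, _ => LinearMap.ext fun x =>
    (iSectSnk_app f b c (-M.map TVert.extraArrow x) x).trans
      (congrArg (iSectSnk N b c) (Prod.ext
        ((map_neg _ _).trans (congrArg _ (QRep.comm_apply f TVert.extraArrow x))) rfl))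
  | .mid i, .mid j, ⟨h⟩ => LinearMap.ext fun x => Prod.ext
      (QRep.comm_apply f (show TVert.chain i ⟶ TVert.chain j from ⟨h⟩) x.1) rfl
  | .mid i, .snk c, ⟨h⟩ => LinearMap.ext fun x =>
    (iSectSnk_app f b c (M.map (show TVert.chain i ⟶ TVert.sink from ⟨h⟩) x.1 -
        M.map TVert.extraArrow x.2) x.2).trans
      (congrArg (iSectSnk N b c) (Prod.ext
        ((map_sub _ _ _).trans (congrArg₂ _
          (QRep.comm_apply f (show TVert.chain i ⟶ TVert.sink from ⟨h⟩) x.1)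
          (QRep.comm_apply f TVert.extraArrow x.2))) rfl))

variable (K)

/-- The section of the projection through `I_{snk b}`. -/
def iSect (b : Bool) : QRep K (TVert p) ⥤ QRep K (DVert p) where
  obj N := { X := iSectX b N, map := fun e => iSectMap b N e }
  map f := ⟨iSectApp b f, fun e => iSectApp_comm b f e⟩
  map_id M := QRep.Hom.ext (funext fun v => by
    cases v <;> rfl)
  map_comp f g := QRep.Hom.ext (funext fun v => by cases v <;> rfl)

variable {K}

/-- The canonical map from the space at the source. -/
def iSectSrc (b : Bool) (N : QRep K (TVert p)) : ∀ v, N.X .extra →ₗ[K] iSectX b N v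
  | .src => LinearMap.id
  | .mid i => LinearMap.inr K (N.X (.chain i)) (N.X .extra)
  | .snk c => iSectSnk N b c ∘ₗ (-N.map TVert.extraArrow).prod LinearMap.id

theorem iSectMap_src (b : Bool) (N : QRep K (TVert p)) (y : N.X .extra) :
    ∀ {a c : DVert p} (e : a ⟶ c), iSectMap b N e (iSectSrc b N a y) = iSectSrc b N c y
  | .src, .mid i, _ => rfl
  | .src, .snk c, _ => rfl
  | .mid i, .mid j, ⟨h⟩ =>
    Prod.ext (map_zero (N.map (show TVert.chain i ⟶ TVert.chain j from ⟨h⟩))) rfl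
  | .mid i, .snk c, ⟨h⟩ => congrArg (iSectSnk N b c)
      (Prod.ext (show N.map (show TVert.chain i ⟶ TVert.sink from ⟨h⟩) 0 -
        N.map TVert.extraArrow y = -N.map TVert.extraArrow y by rw [map_zero, zero_sub]) rfl)

/-- The canonical vectors are compatible with every arrow, hence with every path. This computes the
images of `src` that the projection divides out. -/
theorem iSect_pathMap_src (b : Bool) (N : QRep K (TVert p)) (y : N.X .extra) {a c : DVert p}
    (x : Quiver.Path a c) :
    ((iSect K b).obj N).pathMap x (iSectSrc b N a y) = iSectSrc b N c y := by
  induction x with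
  | nil => rfl
  | cons x e ih => exact (congrArg (iSectMap b N e) ih).trans (iSectMap_src b N y e)

/-- The canonical map to the space at `extra`. -/
def iSectSnd (N : QRep K (TVert p)) : ∀ (b : Bool) (v : DVert p), iSectX b N v →ₗ[K] N.X .extra
  | _, .src => LinearMap.id
  | _, .mid _ => LinearMap.snd K _ _
  | false, .snk false => 0
  | true, .snk true => 0
  | false, .snk true => LinearMap.id
  | true, .snk false => LinearMap.id

theorem iSectMap_snd (b : Bool) (N : QRep K (TVert p)) :
    ∀ {a c : DVert p} (e : a ⟶ c), c ≠ .snk b → ∀ y : iSectX b N a,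
      iSectSnd N b c (iSectMap b N e y) = iSectSnd N b a y
  | .src, .mid i, _, _, y => rfl
  | .src, .snk c, _, h, y => by
    cases b <;> cases c <;> first | rfl | exact absurd rfl h
  | .mid i, .mid j, ⟨h⟩, _, y => rfl
  | .mid i, .snk c, ⟨_⟩, h, y => by
    cases b <;> cases c <;> first | rfl | exact absurd rfl h

/-- Away from `snk b` all maps of the section keep the `extra` coordinate. This evaluates the paths
to the other sink that occur in the unit. -/
theorem iSect_pathMap_snd (b : Bool) (N : QRep K (TVert p)) {a c : DVert p}
    (x : Quiver.Path a c) (hc : c ≠ .snk b) (y : iSectX b N a) :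
    iSectSnd N b c (((iSect K b).obj N).pathMap x y) = iSectSnd N b a y := by
  induction x with
  | nil => rfl
  | @cons d c x e ih =>
    have hd : d ≠ .snk b := by rintro rfl; exact e.down.elim
    exact (iSectMap_snd b N e hc _).trans (ih hd)

/-- The components of the unit. -/
def iUnit (b : Bool) (M : QRep K (DVert p)) : ∀ v, M.X v →ₗ[K] iSectX b ((iProj K b).obj M) v
  | .src => match b with
    | false => M.pathMap (DVert.reach_src_snk true).some
    | true => M.pathMap (DVert.reach_src_snk false).some
  | .mid i => (midImage M i).mkQ.prod (M.pathMap (DVert.reach_mid_snk i (!b)).some)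
  | .snk c => match b, c with
    | false, false => (snkImage M).mkQ ∘ₗ LinearMap.inl K _ _
    | true, true => (snkImage M).mkQ ∘ₗ LinearMap.inr K _ _
    | false, true => LinearMap.id
    | true, false => LinearMap.id

theorem iUnit_src (b : Bool) (M : QRep K (DVert p)) (x : Quiver.Path DVert.src (DVert.snk (!b))) :
    iUnit b M .src = M.pathMap x := by
  refine LinearMap.ext fun m => ?_
  cases b
  · exact M.pathMap_congr (DVert.reach_src_snk true).some x m
  · exact M.pathMap_congr (DVert.reach_src_snk false).some x m

theorem mkQ_snkImage (M : QRep K (DVert p)) (x : Quiver.Path DVert.src (DVert.snk false))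
    (y : Quiver.Path DVert.src (DVert.snk true)) (m : M.X .src) :
    (snkImage M).mkQ (M.pathMap x m, M.pathMap y m) = 0 := by
  rw [← LinearMap.mem_ker, Submodule.ker_mkQ, snkImage_eq M x y]
  exact ⟨m, rfl⟩

theorem mkQ_midImage (M : QRep K (DVert p)) {i : Fin p}
    (x : Quiver.Path DVert.src (DVert.mid i)) (m : M.X .src) :
    (midImage M i).mkQ (M.pathMap x m) = 0 := by
  rw [← LinearMap.mem_ker, Submodule.ker_mkQ, midImage_eq M x]
  exact ⟨m, rfl⟩

theorem iUnit_comm (b : Bool) (M : QRep K (DVert p)) : ∀ {a c : DVert p} (e : a ⟶ c),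
    iUnit b M c ∘ₗ M.map e = iSectMap b ((iProj K b).obj M) e ∘ₗ iUnit b M a
  | .src, .mid i, e => LinearMap.ext fun x => by
    rw [iUnit_src b M (e.toPath.comp (DVert.reach_mid_snk i (!b)).some)]
    exact Prod.ext (mkQ_midImage M e.toPath x) (M.pathMap_comp_apply e.toPath
      (DVert.reach_mid_snk i (!b)).some x).symm
  | .src, .snk c, ⟨h⟩ => LinearMap.ext fun x => by
    have e : ∀ b, (DVert.src : DVert p) ⟶ .snk b := fun b => ⟨h⟩
    rw [iUnit_src b M (e (!b)).toPath]
    -- The images of `x` at the two sinks cancel in the quotient. This is the origin of the sign in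
    -- `iSectMap`.
    have h0 : (snkImage M).mkQ (M.map (e false) x, 0) + (snkImage M).mkQ (0, M.map (e true) x) =
        0 := by
      rw [← map_add, Prod.mk_add_mk, add_zero, zero_add]
      exact mkQ_snkImage M (e false).toPath (e true).toPath x
    cases b <;> cases c
    · exact eq_neg_of_add_eq_zero_left h0
    · rfl
    · rfl
    · exact eq_neg_of_add_eq_zero_right h0
  | .mid i, .mid j, e => LinearMap.ext fun x => by
    exact Prod.ext rfl (M.pathMap_pathMap e.toPath _ _ x)
  | .mid i, .snk c, ⟨h⟩ => LinearMap.ext fun x => by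
    have e : ∀ b, (DVert.mid i : DVert p) ⟶ .snk b := fun b => ⟨h⟩
    have h0 : (snkImage M).mkQ (M.map (e false) x, M.map (e true) x) =
        (snkImage M).mkQ (M.map (e false) x, 0) + (snkImage M).mkQ (0, M.map (e true) x) := by
      rw [← map_add, Prod.mk_add_mk, add_zero, zero_add]
    have h1 : ∀ b, M.pathMap (DVert.reach_mid_snk i b).some x = M.map (e b) x := fun b =>
      M.pathMap_congr _ (e b).toPath x
    cases b <;> cases c
    · exact (eq_sub_of_add_eq h0.symm).trans (congrArg (fun y =>
        (snkImage M).mkQ (M.map (e false) x, M.map (e true) x) - (snkImage M).mkQ (0, y))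
          (h1 true).symm)
    · exact (h1 true).symm
    · exact (h1 false).symm
    · exact (eq_sub_of_add_eq' h0.symm).trans (congrArg (fun y =>
        (snkImage M).mkQ (M.map (e false) x, M.map (e true) x) - (snkImage M).mkQ (y, 0))
          (h1 false).symm)

theorem iUnit_natural (b : Bool) {M N : QRep K (DVert p)} (f : M ⟶ N) : ∀ v,
    iUnit b N v ∘ₗ f.app v = iSectApp b ((iProj K b).map f) v ∘ₗ iUnit b M v
  | .src => LinearMap.ext fun x => by
    cases b <;> exact (QRep.comm_path_apply f _ x).symm
  | .mid i => LinearMap.ext fun x => Prod.ext rfl (QRep.comm_path_apply f _ x).symm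
  | .snk c => LinearMap.ext fun x => by
    cases b <;> cases c
    · exact congrArg (snkImage N).mkQ (Prod.ext rfl (map_zero (f.app (.snk true))).symm)
    · rfl
    · rfl
    · exact congrArg (snkImage N).mkQ (Prod.ext (map_zero (f.app (.snk false))).symm rfl)

/-- The map from the sum over the sinks to the space at the sink of `A¹_{p+2}`. -/
def iCounitSnk (N : QRep K (TVert p)) : ∀ b : Bool,
    (iSectX b N (.snk false) × iSectX b N (.snk true)) →ₗ[K] N.X .sink
  | false => LinearMap.coprod (M := N.X .sink) (M₂ := N.X .extra) LinearMap.id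
      (N.map TVert.extraArrow)
  | true => LinearMap.coprod (M := N.X .extra) (M₂ := N.X .sink) (N.map TVert.extraArrow)
      LinearMap.id

theorem snkImage_iSect (N : QRep K (TVert p)) (b : Bool) (z) :
    z ∈ snkImage ((iSect K b).obj N) ↔ ∃ y : N.X .extra,
      z = ((iSectSrc b N (.snk false) y, iSectSrc b N (.snk true) y) :
        iSectX b N (.snk false) × iSectX b N (.snk true)) := by
  rw [snkImage_eq _ (DVert.reach_src_snk false).some (DVert.reach_src_snk true).some]
  constructor
  · rintro ⟨y, rfl⟩
    exact ⟨y, Prod.ext (iSect_pathMap_src b N y _) (iSect_pathMap_src b N y _)⟩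
  · rintro ⟨y, rfl⟩
    exact ⟨y, Prod.ext (iSect_pathMap_src b N y _) (iSect_pathMap_src b N y _)⟩

/-- The space at `src` enters each middle space as the second summand, so the quotient returns the
space at `chain i`. -/
theorem midImage_iSect (N : QRep K (TVert p)) (b : Bool) (i : Fin p)
    (z : N.X (.chain i) × N.X .extra) :
    z ∈ midImage ((iSect K b).obj N) i ↔ z.1 = 0 := by
  rw [midImage_eq _ (DVert.reach_src_mid i).some]
  constructor
  · rintro ⟨y, rfl⟩
    exact congrArg Prod.fst (iSect_pathMap_src b N y (DVert.reach_src_mid i).some)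
  · intro h
    exact ⟨z.2, (iSect_pathMap_src b N z.2 (DVert.reach_src_mid i).some).trans
      (Prod.ext h.symm rfl)⟩

/-- Up to the order of the sinks, `src` maps to the pairs `(-f y, y)`, where `f` is the map of the
arrow from `extra`. These are the pairs `(x, y)` with `x + f y = 0`. -/
theorem iCounitSnk_eq_zero (N : QRep K (TVert p)) (b : Bool)
    (z : iSectX b N (.snk false) × iSectX b N (.snk true)) :
    iCounitSnk N b z = 0 ↔ z ∈ snkImage ((iSect K b).obj N) := by
  refine Iff.trans ?_ (snkImage_iSect N b z).symm
  obtain ⟨x, y⟩ := z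
  cases b
  · constructor
    · intro h
      exact ⟨y, Prod.ext (eq_neg_of_add_eq_zero_left h) rfl⟩
    · rintro ⟨y, h⟩
      rw [h]
      exact neg_add_cancel (N.map TVert.extraArrow y)
  · constructor
    · intro h
      exact ⟨x, Prod.ext rfl (eq_neg_of_add_eq_zero_right h)⟩
    · rintro ⟨y, h⟩
      rw [h]
      exact add_neg_cancel (N.map TVert.extraArrow y)

/-- The components of the counit. -/
def iCounit (b : Bool) (N : QRep K (TVert p)) : ∀ v, iProjX b ((iSect K b).obj N) v →ₗ[K] N.X v
  | .chain i => (midImage ((iSect K b).obj N) i).liftQ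
      (LinearMap.fst K (N.X (.chain i)) (N.X .extra)) fun z hz => (midImage_iSect N b i z).1 hz
  | .extra => match b with
    | false => LinearMap.id
    | true => LinearMap.id
  | .sink => (snkImage ((iSect K b).obj N)).liftQ (iCounitSnk N b) fun z hz =>
      (iCounitSnk_eq_zero N b z).2 hz

theorem iCounit_comm (b : Bool) (N : QRep K (TVert p)) : ∀ {a c : TVert p} (e : a ⟶ c),
    iCounit b N c ∘ₗ iProjMap b ((iSect K b).obj N) e = N.map e ∘ₗ iCounit b N a
  | .chain i, .chain j, ⟨h⟩ => Submodule.linearMap_qext _ rfl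
  | .chain i, .sink, ⟨h⟩ => Submodule.linearMap_qext _ (LinearMap.ext fun x => by
    cases b
    · exact sub_add_cancel _ _
    · exact add_sub_cancel _ _)
  | .extra, .sink, _ => LinearMap.ext fun x => by
    cases b
    · exact zero_add _
    · exact add_zero _

/-- Each component on a quotient is induced by a surjection whose kernel is the submodule divided
out. -/
theorem iCounit_bijective (b : Bool) (N : QRep K (TVert p)) :
    ∀ v, Function.Bijective (iCounit b N v)
  | .chain i => by
    constructor
    · rw [← LinearMap.ker_eq_bot]
      exact Submodule.ker_liftQ_eq_bot _ _ _ fun z hz => (midImage_iSect N b i z).2 hz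
    · intro x
      exact ⟨(midImage ((iSect K b).obj N) i).mkQ ((x, 0) : N.X (.chain i) × N.X .extra), rfl⟩
  | .extra => by cases b <;> exact Function.bijective_id
  | .sink => by
    constructor
    · rw [← LinearMap.ker_eq_bot]
      exact Submodule.ker_liftQ_eq_bot _ _ _ fun z hz => (iCounitSnk_eq_zero N b z).1 hz
    · intro x
      cases b
      · exact ⟨(snkImage ((iSect K false).obj N)).mkQ ((x, 0) : N.X .sink × N.X .extra),
          (congrArg (x + ·) (map_zero (N.map TVert.extraArrow))).trans (add_zero x)⟩
      · exact ⟨(snkImage ((iSect K true).obj N)).mkQ ((0, x) : N.X .extra × N.X .sink),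
          (congrArg (· + x) (map_zero (N.map TVert.extraArrow))).trans (zero_add x)⟩

variable (K) in
/-- The adjunction between the projection through `I_{snk b}` and its section. -/
def iAdj (b : Bool) : iProj K b (p := p) ⊣ iSect K b :=
  Adjunction.mkOfUnitCounit
    { unit :=
        { app := fun M => ⟨iUnit b M, fun e => iUnit_comm b M e⟩
          naturality := fun M N f => QRep.Hom.ext (funext (iUnit_natural b f)) }
      counit :=
        { app := fun N => ⟨iCounit b N, fun e => iCounit_comm b N e⟩
          naturality := fun M N f => QRep.Hom.ext (funext fun v => by
            cases v with
            | chain i => exact Submodule.linearMap_qext _ rfl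
            | extra => cases b <;> rfl
            | sink =>
              refine Submodule.linearMap_qext _ (LinearMap.ext fun x => ?_)
              cases b
              · exact ((map_add _ _ _).trans
                  (congrArg _ (QRep.comm_apply f TVert.extraArrow x.2))).symm
              · exact ((map_add _ _ _).trans
                  (congrArg (fun y : N.X .sink => y + f.app .sink x.2)
                    (QRep.comm_apply f TVert.extraArrow x.1))).symm) }
      left_triangle := by
        ext M
        refine QRep.Hom.ext (funext fun v => ?_)
        cases v with
        | chain i => exact Submodule.linearMap_qext _ rfl
        | extra => cases b <;> rfl
        | sink =>
          refine Submodule.linearMap_qext _ (LinearMap.ext fun x => ?_)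
          have h0 : (snkImage M).mkQ (x.1, 0) + (snkImage M).mkQ (0, x.2) =
              (snkImage M).mkQ x := by
            rw [← map_add, Prod.mk_add_mk, add_zero, zero_add]
            rfl
          cases b <;> exact h0
      right_triangle := by
        ext N
        refine QRep.Hom.ext (funext fun v => LinearMap.ext fun x => ?_)
        cases v with
        | src =>
          cases b
          · exact iSect_pathMap_snd false N (DVert.reach_src_snk true).some (by simp) x
          · exact iSect_pathMap_snd true N (DVert.reach_src_snk false).some (by simp) x
        | mid i =>
          refine Prod.ext rfl ?_
          cases b
          · exact iSect_pathMap_snd false N (DVert.reach_mid_snk i true).some (by simp) x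
          · exact iSect_pathMap_snd true N (DVert.reach_mid_snk i false).some (by simp) x
        | snk c =>
          cases b <;> cases c
          · exact (congrArg (x + ·) (map_zero (N.map TVert.extraArrow))).trans (add_zero x)
          · rfl
          · rfl
          · exact (congrArg (· + x) (map_zero (N.map TVert.extraArrow))).trans (zero_add x) }

/-- If `src` is isomorphic to `snk (!b)`, it splits off everywhere: a middle space is the sum of its
quotient and the space at that sink, and modulo `src` each pair of vectors at the sinks has a unique
representative supported at `snk b`. -/
theorem iUnit_bijective (b : Bool) (M : QRep K (DVert p))
    (h : Function.Bijective (M.pathMap (DVert.reach_src_snk (!b)).some)) :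
    ∀ v, Function.Bijective (iUnit b M v)
  | .src => by rw [iUnit_src b M]; exact h
  | .mid i => by
    have hx := fun m => M.pathMap_pathMap (DVert.reach_src_mid i).some
      (DVert.reach_mid_snk i (!b)).some (DVert.reach_src_snk (!b)).some m
    constructor
    · refine LinearMap.ker_eq_bot.1 (LinearMap.ker_eq_bot'.2 fun m hm => ?_)
      have h1 : m ∈ midImage M i := by
        rw [← Submodule.ker_mkQ (midImage M i)]
        exact congrArg Prod.fst hm
      rw [midImage_eq M (DVert.reach_src_mid i).some] at h1
      obtain ⟨y, rfl⟩ := h1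
      have h2 : M.pathMap (DVert.reach_src_snk (!b)).some y = 0 :=
        (hx y).symm.trans (congrArg Prod.snd hm)
      rw [h.1 (h2.trans (map_zero _).symm), map_zero]
    · rintro ⟨z, y⟩
      obtain ⟨m, rfl⟩ := (midImage M i).mkQ_surjective z
      -- A vector from `src` adjusts the value at `snk (!b)` without changing the class modulo
      -- `src`.
      obtain ⟨s, hs⟩ := h.2 ((show M.X (.snk (!b)) from by cases b <;> exact y) -
        M.pathMap (DVert.reach_mid_snk i (!b)).some m)
      refine ⟨m + M.pathMap (DVert.reach_src_mid i).some s, Prod.ext ?_ ?_⟩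
      · refine (map_add (midImage M i).mkQ _ _).trans ?_
        rw [mkQ_midImage, add_zero]
      · refine (map_add (M.pathMap (DVert.reach_mid_snk i (!b)).some) _ _).trans ?_
        rw [hx, hs, add_sub_cancel]
        cases b <;> rfl
  | .snk c => by
    have h0 : ∀ z, z ∈ snkImage M ↔ ∃ y, (M.pathMap (DVert.reach_src_snk false).some y,
        M.pathMap (DVert.reach_src_snk true).some y) = z := fun z => by
      rw [snkImage_eq M (DVert.reach_src_snk false).some (DVert.reach_src_snk true).some]
      rfl
    cases b <;> cases c
    · constructor
      · refine LinearMap.ker_eq_bot.1 (LinearMap.ker_eq_bot'.2 fun m hm => ?_)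
        obtain ⟨y, hy⟩ := (h0 (m, 0)).1 ((Submodule.Quotient.mk_eq_zero _).1 hm)
        have hy0 := h.1 ((congrArg Prod.snd hy).trans (map_zero _).symm)
        rw [hy0, map_zero] at hy
        exact (congrArg Prod.fst hy).symm
      · intro z
        obtain ⟨⟨u, v⟩, rfl⟩ := (snkImage M).mkQ_surjective z
        obtain ⟨s, hs⟩ := h.2 v
        -- Subtracting the image of `s` from `(u, v)` makes the second entry zero.
        refine ⟨u - M.pathMap (DVert.reach_src_snk false).some s, ?_⟩
        refine (Submodule.Quotient.eq _).2 ((h0 _).2 ⟨-s, ?_⟩)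
        rw [map_neg, map_neg]
        refine Prod.ext ?_ ?_
        · exact (sub_sub_cancel_left _ _).symm
        · exact (congrArg Neg.neg hs).trans (zero_sub _).symm
    · exact Function.bijective_id
    · exact Function.bijective_id
    · constructor
      · refine LinearMap.ker_eq_bot.1 (LinearMap.ker_eq_bot'.2 fun m hm => ?_)
        obtain ⟨y, hy⟩ := (h0 (0, m)).1 ((Submodule.Quotient.mk_eq_zero _).1 hm)
        have hy0 := h.1 ((congrArg Prod.fst hy).trans (map_zero _).symm)
        rw [hy0, map_zero, map_zero] at hy
        exact (congrArg Prod.snd hy).symm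
      · intro z
        obtain ⟨⟨u, v⟩, rfl⟩ := (snkImage M).mkQ_surjective z
        obtain ⟨s, hs⟩ := h.2 u
        refine ⟨v - M.pathMap (DVert.reach_src_snk true).some s, ?_⟩
        refine (Submodule.Quotient.eq _).2 ((h0 _).2 ⟨-s, ?_⟩)
        rw [map_neg, map_neg]
        refine Prod.ext ?_ ?_
        · exact (congrArg Neg.neg hs).trans (zero_sub _).symm
        · exact (sub_sub_cancel_left _ _).symm

end Section

/-- The injective representation has its generator at `src` and its only relation at the other sink.
So orthogonality and invertibility of the unit both mean that `M(src) → M(snk (!b))` is bijective.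
-/
theorem iProj_isOrthogonalProjection {p : ℕ} (b : Bool) :
    QRep.IsOrthogonalProjection (QRep.injective K (V := DVert p) (.snk b)) DVert.delta
      (fun _ => 1) (iProj K b) := by
  refine QRep.isOrthogonalProjection_of_adj (injectivePresentation K b) (iAdj K b)
    (fun N v => iCounit_bijective b N v) (fun M => ?_) (fun N hN => ?_)
  · have hM : (∀ v, Function.Bijective (iUnit b M v)) ↔
        Function.Bijective (M.pathMap (DVert.reach_src_snk (!b)).some) := by
      refine ⟨fun h => ?_, iUnit_bijective b M⟩
      rw [← iUnit_src b M]; exact h .src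
    refine hM.trans ?_
    rw [Function.bijective_iff_existsUnique]
    constructor
    · intro h n
      obtain ⟨m, hm, hu⟩ := h (n _)
      refine ⟨m, fun a ha x => ?_, fun m' hm' => hu m' (hm' _ rfl _)⟩
      subst ha
      exact (M.pathMap_congr _ _ m).trans hm
    · intro h y
      classical
      obtain ⟨m, hm, hu⟩ := h (Function.update 0 _ y)
      refine ⟨m, (hm _ rfl _).trans (Function.update_self _ _ _), fun m' hm' => hu m' ?_⟩
      rintro a rfl x
      rw [Function.update_self, ← hm']
      exact M.pathMap_congr _ _ m'
  · funext v
    rcases v with _ | i | c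
    · exact congrFun hN .extra
    · have h0 : Module.finrank K (N.X (.chain i)) = 1 := congrFun hN (.chain i)
      have h1 : Module.finrank K (N.X .extra) = 1 := congrFun hN .extra
      exact (Module.finrank_prod (R := K) (M := N.X (.chain i)) (M' := N.X .extra)).trans
        (by rw [h0, h1]; rfl)
    · exact congrFun hN (iSectV b c)

/-- The first half of the main theorem. -/
theorem isQECwd (N : ℕ) : IsQECwd K N where
  projection e E h := by
    have hdim : ∀ (p : ℕ) (h : p ≤ N), (CVert.D p h).dim = DVert.delta (p := p) := fun p h =>
      funext fun x => by cases x <;> rfl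
    cases h with
    | dS p h i =>
      rw [hdim, hdim]
      rcases Fin.eq_castSucc_or_eq_last i with ⟨i, rfl⟩ | rfl
      · exact dProj_castSucc_isOrthogonalProjection K i
      · exact dProj_last_isOrthogonalProjection K
    | dI q h b => rw [hdim]; exact iProj_isOrthogonalProjection K b
    | dIZero h b =>
      rw [hdim]
      exact comp_tFold_isOrthogonalProjection K (iProj_isOrthogonalProjection K b)
    | tS q h i => exact tProj_isOrthogonalProjection K i
    | tSZero h => exact comp_tFold_isOrthogonalProjection K (tProj_isOrthogonalProjection K 0)
    | tE q h => exact tForget_isOrthogonalProjection K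
    | aS r h i => exact aProj_isOrthogonalProjection K i
  section_adj e s h := by
    cases h with
    | d p h i => exact ⟨dAdj K i⟩
    | t q h i => exact ⟨tAdj K i⟩
    | a r h i => exact ⟨aAdj K i⟩
  loop {u} e := by
    cases e with
    | dT p h =>
      refine ⟨dSwap_isEquivalence K, fun M hM => ?_⟩
      funext x
      rcases x with _ | i | b
      · exact congrFun hM .src
      · exact congrFun hM (.mid i)
      · exact congrFun hM (.snk !b)
    | tT h =>
      exact ⟨tSwap_isEquivalence K, fun M hM => funext fun x => congrFun hM (TVert.swapV x)⟩

end

section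

/-! ### Isomorphisms between composite functors -/

section Isomorphisms

variable {K : Type w} [Field K] {p q : ℕ}

/-- Along the chain the structure maps of the projection are induced by those of `M`. The remaining
cases are void, since no arrow leads from `extra` or from the sink to a chain vertex. -/
theorem iProj_pathMap_chain (b : Bool) (M : QRep K (DVert p)) {i : Fin p} (m : M.X (.mid i)) :
    ∀ {j : Fin p} (y : Quiver.Path (TVert.chain i) (TVert.chain j))
      (y' : Quiver.Path (DVert.mid i) (DVert.mid j)),
      ((iProj K b).obj M).pathMap y ((midImage M i).mkQ m) = (midImage M j).mkQ (M.pathMap y' m)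
  | _, .nil, y' => congrArg (midImage M i).mkQ (M.pathMap_loop y' m).symm
  | j, .cons (b := .chain l) y e, y' => by
    have e' : (DVert.mid l : DVert p) ⟶ .mid j := ⟨e.down⟩
    obtain ⟨y₁⟩ : Nonempty (Quiver.Path (DVert.mid i) (DVert.mid l)) :=
      DVert.reach_mid_le (by
        have := TVert.pos_path y
        simp only [TVert.pos] at this
        rw [Fin.le_def]; omega)
    refine (congrArg (iProjMap b M e) (iProj_pathMap_chain b M m y y₁)).trans ?_
    exact congrArg (midImage M j).mkQ (M.pathMap_congr (y₁.cons e') y' m)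
  | _, .cons (b := .extra) _ e, _ => e.down.elim
  | _, .cons (b := .sink) _ e, _ => e.down.elim

theorem iProj_pathMap_sink (b : Bool) (M : QRep K (DVert p)) {i : Fin p} (m : M.X (.mid i))
    (y : Quiver.Path (TVert.chain i) TVert.sink) (y₀ : Quiver.Path (DVert.mid i) (DVert.snk false))
    (y₁ : Quiver.Path (DVert.mid i) (DVert.snk true)) :
    ((iProj K b).obj M).pathMap y ((midImage M i).mkQ m) =
      (snkImage M).mkQ (M.pathMap y₀ m, M.pathMap y₁ m) := by
  match y with
  | .cons (b := .chain l) y e =>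
    have e' : ∀ b, (DVert.mid l : DVert p) ⟶ .snk b := fun b => ⟨e.down⟩
    obtain ⟨z⟩ : Nonempty (Quiver.Path (DVert.mid i) (DVert.mid l)) :=
      DVert.reach_mid_le (by
        have := TVert.pos_path y
        simp only [TVert.pos] at this
        rw [Fin.le_def]; omega)
    refine (congrArg (iProjMap b M e) (iProj_pathMap_chain b M m y z)).trans ?_
    exact congrArg (snkImage M).mkQ (Prod.ext (M.pathMap_congr (z.cons (e' false)) y₀ m)
      (M.pathMap_congr (z.cons (e' true)) y₁ m))
  | .cons (b := .extra) (.cons (b := .chain _) _ e) _ => exact e.down.elim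
  | .cons (b := .extra) (.cons (b := .extra) _ e) _ => exact e.down.elim
  | .cons (b := .extra) (.cons (b := .sink) _ e) _ => exact e.down.elim
  | .cons (b := .sink) _ e => exact e.down.elim

/-- The pull-back keeps `src`, so the same submodules are divided out before and after it. -/
theorem midImage_restrict (f : Fin q →o Fin p) (M : QRep K (DVert p)) (i : Fin q) :
    midImage ((QRep.restrict (DVert.mapV f id) (DVert.mapV_arrow f id)).obj M) i =
      midImage M (f i) := by
  rw [midImage_eq _ (DVert.reach_src_mid i).some, midImage_eq M (DVert.reach_src_mid (f i)).some]
  exact congrArg LinearMap.range (LinearMap.ext fun m => QRep.pathMap_restrict _ _ M _ _ m)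

theorem snkImage_restrict (f : Fin q →o Fin p) (M : QRep K (DVert p)) :
    snkImage ((QRep.restrict (DVert.mapV f id) (DVert.mapV_arrow f id)).obj M) = snkImage M := by
  rw [snkImage_eq _ (DVert.reach_src_snk false).some (DVert.reach_src_snk true).some,
    snkImage_eq M (DVert.reach_src_snk false).some (DVert.reach_src_snk true).some]
  exact congrArg LinearMap.range (LinearMap.ext fun m => Prod.ext
    (QRep.pathMap_restrict _ _ M _ _ m) (QRep.pathMap_restrict _ _ M _ _ m))

/-- The components of `restrictIProj`. -/
def restrictIProjApp (b : Bool) (f : Fin q →o Fin p) (M : QRep K (DVert p)) : ∀ v,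
    iProjX b ((QRep.restrict (DVert.mapV f id) (DVert.mapV_arrow f id)).obj M) v ≃ₗ[K]
      iProjX b M (TVert.mapV f v)
  | .chain i => Submodule.quotEquivOfEq _ _ (midImage_restrict f M i)
  | .extra => LinearEquiv.refl K (M.X (.snk (!b)))
  | .sink => Submodule.quotEquivOfEq _ _ (snkImage_restrict f M)

/-- Pull-back along maps of the linear parts commutes with the projections through `I_{snk b}`. -/
def restrictIProj (b : Bool) (f : Fin q →o Fin p) :
    QRep.restrict (K := K) (DVert.mapV f id) (DVert.mapV_arrow f id) ⋙ iProj K b ≅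
      iProj K b ⋙ QRep.restrict (TVert.mapV f) (TVert.mapV_arrow f) :=
  NatIso.ofComponents (fun M => QRep.isoMk (restrictIProjApp b f M) (by
    intro a c e x
    match a, c, e with
    | .chain i, .chain j, ⟨h⟩ =>
      obtain ⟨m, rfl⟩ := Submodule.mkQ_surjective _ x
      exact (iProj_pathMap_chain b M m (TVert.mapV_arrow f _ _ ⟨h⟩).some
        (DVert.mapV_arrow f id (.mid i) (.mid j) ⟨h⟩).some).symm
    | .chain i, .sink, ⟨h⟩ =>
      obtain ⟨m, rfl⟩ := Submodule.mkQ_surjective _ x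
      exact (iProj_pathMap_sink b M m (TVert.mapV_arrow f _ _ ⟨h⟩).some
        (DVert.mapV_arrow f id (.mid i) (.snk false) ⟨h⟩).some
        (DVert.mapV_arrow f id (.mid i) (.snk true) ⟨h⟩).some).symm
    | .extra, .sink, ⟨h⟩ =>
      refine Eq.trans ?_ (((iProj K b).obj M).pathMap_congr TVert.extraArrow.toPath _ x)
      cases b <;> rfl))
    fun {M N} g => QRep.Hom.ext (funext fun v => by
      cases v with
      | chain i => exact Submodule.linearMap_qext _ rfl
      | extra => rfl
      | sink => exact Submodule.linearMap_qext _ rfl)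

theorem dSwap_pathMap (M : QRep K (DVert p)) {a c : DVert p} (x : Quiver.Path a c)
    (y : Quiver.Path (DVert.mapV OrderHom.id not a) (DVert.mapV OrderHom.id not c)) (m) :
    ((dSwap K).obj M).pathMap x m = M.pathMap y m := QRep.pathMap_restrict _ _ M x y m

theorem midImage_dSwap (M : QRep K (DVert p)) (i : Fin p) :
    midImage ((dSwap K).obj M) i = midImage M i := by
  rw [midImage_eq _ (DVert.reach_src_mid i).some, midImage_eq M (DVert.reach_src_mid i).some]
  exact congrArg LinearMap.range (LinearMap.ext fun m => dSwap_pathMap M _ _ m)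

/-- The sum over the sinks is formed in a fixed order, so the exchange of the sinks acts on it by
exchanging the coordinates. -/
theorem snkImage_dSwap (M : QRep K (DVert p)) :
    (snkImage ((dSwap K).obj M)).map
      (LinearEquiv.prodComm K (M.X (.snk true)) (M.X (.snk false))).toLinearMap = snkImage M := by
  rw [snkImage_eq _ (DVert.reach_src_snk false).some (DVert.reach_src_snk true).some,
    snkImage_eq M (DVert.reach_src_snk false).some (DVert.reach_src_snk true).some]
  refine (LinearMap.range_comp _ _).symm.trans (congrArg LinearMap.range ?_)
  exact LinearMap.ext fun m => Prod.ext (dSwap_pathMap M _ _ m) (dSwap_pathMap M _ _ m)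

/-- The components of `dSwapIProj`. -/
def dSwapIProjApp (b : Bool) (M : QRep K (DVert p)) : ∀ v,
    iProjX b ((dSwap K).obj M) v ≃ₗ[K] iProjX (!b) M v
  | .chain i => Submodule.quotEquivOfEq _ _ (midImage_dSwap M i)
  | .extra => LinearEquiv.refl K (M.X (.snk (!!b)))
  | .sink => Submodule.Quotient.equiv (snkImage ((dSwap K).obj M)) (snkImage M)
      (LinearEquiv.prodComm K (M.X (.snk true)) (M.X (.snk false))) (snkImage_dSwap M)

/-- The exchange of the sinks exchanges the projections through `I_{snk b}`. -/
def dSwapIProj (b : Bool) : dSwap K (p := p) ⋙ iProj K b ≅ iProj K (!b) :=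
  NatIso.ofComponents (fun M => QRep.isoMk (dSwapIProjApp b M) (by
    intro a c e x
    match a, c, e with
    | .chain i, .chain j, ⟨h⟩ =>
      obtain ⟨m, rfl⟩ := Submodule.mkQ_surjective _ x
      have e' : (DVert.mid i : DVert p) ⟶ .mid j := ⟨h⟩
      exact congrArg (midImage M j).mkQ (dSwap_pathMap M e'.toPath e'.toPath m)
    | .chain i, .sink, ⟨h⟩ =>
      obtain ⟨m, rfl⟩ := Submodule.mkQ_surjective _ x
      have e' : ∀ b, (DVert.mid i : DVert p) ⟶ .snk b := fun _ => ⟨h⟩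
      exact congrArg (snkImage M).mkQ (Prod.ext
        (dSwap_pathMap M (e' true).toPath (e' false).toPath m)
        (dSwap_pathMap M (e' false).toPath (e' true).toPath m))
    | .extra, .sink, ⟨h⟩ => cases b <;> rfl))
    fun {M N} g => QRep.Hom.ext (funext fun v => by
      cases v with
      | chain i => exact Submodule.linearMap_qext _ rfl
      | extra => rfl
      | sink => exact Submodule.linearMap_qext _ rfl)

/-- The components of `iProjForget`. -/
def iProjForgetApp (b : Bool) (M : QRep K (DVert p)) : ∀ v : AVert p,
    iProjX b M (AVert.toTVert v) ≃ₗ[K] iProjX (!b) M (AVert.toTVert v)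
  | .chain i => LinearEquiv.refl K (M.X (.mid i) ⧸ midImage M i)
  | .sink => LinearEquiv.refl K ((M.X (.snk false) × M.X (.snk true)) ⧸ snkImage M)

/-- The projections through the two injective representations agree after `extra` has been
forgotten. -/
def iProjForget (b : Bool) : iProj K b (p := p) ⋙ tForget K ≅ iProj K (!b) ⋙ tForget K :=
  NatIso.ofComponents (fun M => QRep.isoMk (iProjForgetApp b M) (by
    intro a c e x
    match a, c, e with
    | .chain i, .chain j, ⟨h⟩ =>
      obtain ⟨m, rfl⟩ := Submodule.mkQ_surjective _ x
      have y := DVert.reach_mid_mid i 1 j h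
      exact (iProj_pathMap_chain b M m _ y.some).trans
        (iProj_pathMap_chain (!b) M m (AVert.toTVert_arrow _ _ ⟨h⟩).some y.some).symm
    | .chain i, .sink, ⟨h⟩ =>
      obtain ⟨m, rfl⟩ := Submodule.mkQ_surjective _ x
      have y := DVert.reach_mid_snk i
      exact (iProj_pathMap_sink b M m _ (y false).some (y true).some).trans
        (iProj_pathMap_sink (!b) M m (AVert.toTVert_arrow _ _ ⟨h⟩).some
          (y false).some (y true).some).symm))
    fun {M N} g => QRep.Hom.ext (funext fun v => by
      cases v with
      | chain i => rfl
      | sink => rfl)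

/-- The two projections agree on the last vertex. -/
def iProjFoldProj (b : Bool) : (iProj K b ⋙ tFold K) ⋙ aProj K (0 : Fin 1) ≅
    (iProj K (!b) ⋙ tFold K) ⋙ aProj K (0 : Fin 1) :=
  NatIso.ofComponents (fun M => QRep.isoMk (fun v => match v with
      | .sink => LinearEquiv.refl K ((M.X (.snk false) × M.X (.snk true)) ⧸ snkImage M)) (by
    intro a c e x
    match a, c, e with
    | .sink, .sink, e => exact e.down.elim))
    fun {M N} g => QRep.Hom.ext (funext fun v => by
      cases v with
      | chain i => exact i.elim0
      | sink => rfl)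

end Isomorphisms

end

section

/-! ### Simplicial systems of elements of a ring -/

/-- Elements of a ring that satisfy the identities of an augmented simplicial object with `p`
vertices in degree `p`, up to degree `L`. The element `d p i` goes from degree `p + 1` to degree
`p`, and `s p i` from degree `p` to degree `p + 1`. -/
structure SimplicialSystem {A : Type*} [Ring A] (L : ℕ) (ν : ℕ → A) (d s : ℕ → ℕ → A) : Prop where
  ν_ν : ∀ p, ν p * ν p = ν p
  ν_d : ∀ p i, ν p * d p i = d p i
  d_ν : ∀ p i, d p i * ν (p + 1) = d p i
  ν_s : ∀ p i, ν (p + 1) * s p i = s p i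
  s_ν : ∀ p i, s p i * ν p = s p i
  d_d : ∀ p i j, p + 2 ≤ L → i < j → j < p + 2 → d p i * d (p + 1) j = d p (j - 1) * d (p + 1) i
  d_s_lt : ∀ p i j, p + 2 ≤ L → i < j → j < p + 1 →
    d (p + 1) i * s (p + 1) j = s p (j - 1) * d p i
  d_s_self : ∀ p j, p + 1 ≤ L → j < p → d p j * s p j = ν p
  d_s_succ : ∀ p j, p + 1 ≤ L → j < p → d p (j + 1) * s p j = ν p
  d_s_gt : ∀ p i j, p + 2 ≤ L → j + 1 < i → i < p + 2 →
    d (p + 1) i * s (p + 1) j = s p j * d p (i - 1)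
  s_s : ∀ p i j, p + 2 ≤ L → j < i → i < p + 1 → s (p + 1) j * s p (i - 1) = s (p + 1) i * s p j

namespace SimplicialSystem

section

variable {A : Type*} [Ring A]

/-- The partial products of the normalizing idempotent in degree `p + 1`. -/
def partialIdem (ν : ℕ → A) (d s : ℕ → ℕ → A) (p : ℕ) : ℕ → A
  | 0 => ν (p + 1)
  | j + 1 => (ν (p + 1) - s p j * d p j) * partialIdem ν d s p j

/-- The normalizing idempotent in degree `p`. -/
def idem (ν : ℕ → A) (d s : ℕ → ℕ → A) : ℕ → A
  | 0 => ν 0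
  | p + 1 => partialIdem ν d s p p

variable {L : ℕ} {ν : ℕ → A} {d s : ℕ → ℕ → A} (S : SimplicialSystem L ν d s)
include S

theorem ν_partialIdem (p j : ℕ) :
    ν (p + 1) * partialIdem ν d s p j = partialIdem ν d s p j := by
  cases j with
  | zero => exact S.ν_ν _
  | succ j =>
    rw [partialIdem, ← mul_assoc, mul_sub, S.ν_ν, ← mul_assoc, S.ν_s]

theorem partialIdem_ν (p j : ℕ) :
    partialIdem ν d s p j * ν (p + 1) = partialIdem ν d s p j := by
  induction j with
  | zero => exact S.ν_ν _
  | succ j ih => rw [partialIdem, mul_assoc, ih]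

omit S in
-- Each factor `ν - s_j d_j` fixes an element that is killed by `d_j`.
theorem partialIdem_mul {p j : ℕ} {x : A} (hx : ν (p + 1) * x = x)
    (h : ∀ i < j, d p i * x = 0) : partialIdem ν d s p j * x = x := by
  induction j with
  | zero => exact hx
  | succ j ih =>
    rw [partialIdem, mul_assoc, ih fun i hi => h i (hi.trans j.lt_succ_self), sub_mul, hx,
      mul_assoc, h j j.lt_succ_self, mul_zero, sub_zero]

/-- For `i < j` the simplicial identities move `d_i` past the factor `ν - s_j d_j`, and both
resulting terms have `d_i` directly before the earlier product. For `i = j` the factor is killed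
because `d_j s_j = ν`. -/
theorem d_partialIdem {p : ℕ} (hp : p + 1 ≤ L) : ∀ {j i : ℕ}, i < j → j ≤ p →
    d p i * partialIdem ν d s p j = 0
  | j + 1, i, hi, hj => by
    rw [partialIdem, ← mul_assoc, mul_sub, S.d_ν, ← mul_assoc]
    rcases (Nat.lt_succ_iff_lt_or_eq.1 hi) with h | rfl
    · obtain ⟨p, rfl⟩ : ∃ q, p = q + 1 := ⟨p - 1, by omega⟩
      rw [S.d_s_lt p i j hp h (by omega), mul_assoc (s p (j - 1)), S.d_d p i j hp h (by omega),
        sub_mul, d_partialIdem hp h (by omega), mul_assoc, mul_assoc (d p _),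
        d_partialIdem hp h (by omega), mul_zero, mul_zero, sub_zero]
    · rw [S.d_s_self p i hp (by omega), S.ν_d, sub_self, zero_mul]

/-- All factors have an index `j` below `i`, and then `s_j d_j s_i = s_i s_j d_j`, where the degree
on the right is lower by one. -/
theorem partialIdem_s {p : ℕ} (hp : p + 2 ≤ L) : ∀ {j i : ℕ}, j ≤ i → i < p + 1 →
    partialIdem ν d s (p + 1) j * s (p + 1) i = s (p + 1) i * partialIdem ν d s p j
  | 0, i, _, _ => by rw [partialIdem, partialIdem, S.ν_s, S.s_ν]
  | j + 1, i, hj, hi => by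
    rw [partialIdem, partialIdem, mul_assoc, partialIdem_s hp (by omega) hi, ← mul_assoc,
      ← mul_assoc, sub_mul, mul_sub, S.ν_s, S.s_ν, mul_assoc (s (p + 1) j),
      S.d_s_lt p j i hp (by omega) hi, ← mul_assoc, S.s_s p i j hp (by omega) hi, mul_assoc]

/-- The factors with smaller index move past `s_i`, and the factor with index `i` gives `(ν - s_i
d_i) s_i = 0`. -/
theorem partialIdem_s_eq_zero {p : ℕ} (hp : p + 1 ≤ L) : ∀ {j i : ℕ}, i < j → j ≤ p →
    partialIdem ν d s p j * s p i = 0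
  | j + 1, i, hi, hj => by
    rw [partialIdem, mul_assoc]
    rcases (Nat.lt_succ_iff_lt_or_eq.1 hi) with h | rfl
    · rw [partialIdem_s_eq_zero hp h (by omega), mul_zero]
    · obtain ⟨p, rfl⟩ : ∃ q, p = q + 1 := ⟨p - 1, by omega⟩
      rw [S.partialIdem_s hp le_rfl (by omega), ← mul_assoc, sub_mul, S.ν_s, mul_assoc,
        S.d_s_self _ _ hp (by omega), S.s_ν, sub_self, zero_mul]

theorem ν_idem (p : ℕ) : ν p * idem ν d s p = idem ν d s p := by
  cases p with
  | zero => exact S.ν_ν 0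
  | succ p => exact S.ν_partialIdem p p

theorem idem_ν (p : ℕ) : idem ν d s p * ν p = idem ν d s p := by
  cases p with
  | zero => exact S.ν_ν 0
  | succ p => exact S.partialIdem_ν p p

theorem d_idem {p i : ℕ} (hp : p + 1 ≤ L) (hi : i < p) : d p i * idem ν d s (p + 1) = 0 :=
  S.d_partialIdem hp hi le_rfl

theorem idem_s {p i : ℕ} (hp : p + 1 ≤ L) (hi : i < p) : idem ν d s (p + 1) * s p i = 0 :=
  S.partialIdem_s_eq_zero hp hi le_rfl

omit S in
-- With `d_idem` this identifies the image of the idempotent as the common kernel of all faces but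
-- the last, the normalized part of the Dold–Kan correspondence.
theorem idem_mul {p : ℕ} {x : A} (hx : ν p * x = x)
    (h : ∀ i q, p = q + 1 → i < q → d q i * x = 0) : idem ν d s p * x = x := by
  cases p with
  | zero => exact hx
  | succ p => exact partialIdem_mul hx fun i hi => h i p rfl hi

theorem idem_idem {p : ℕ} (hp : p ≤ L) : idem ν d s p * idem ν d s p = idem ν d s p :=
  idem_mul (S.ν_idem p) fun i q hq hi => by subst hq; exact S.d_idem hp hi

/-- The last face maps the normalized part to the normalized part. -/
theorem idem_d_last {p : ℕ} (hp : p + 1 ≤ L) :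
    idem ν d s p * (d p p * idem ν d s (p + 1)) = d p p * idem ν d s (p + 1) := by
  refine idem_mul (by rw [← mul_assoc, S.ν_d]) fun i q hq hi => ?_
  subst hq
  rw [← mul_assoc, S.d_d q i (q + 1) hp (by omega) (by omega), Nat.add_sub_cancel, mul_assoc,
    S.d_idem hp (by omega), mul_zero]

/-- A simplicial identity turns `d_p d_{p+1}` into `d_p d_p`, and the inner `d_p` is not the last
face in its degree, so it kills the normalized part. -/
theorem d_last_d_last {p : ℕ} (hp : p + 2 ≤ L) :
    d p p * (d (p + 1) (p + 1) * idem ν d s (p + 2)) = 0 := by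
  rw [← mul_assoc, S.d_d p p (p + 1) hp (by omega) (by omega), Nat.add_sub_cancel, mul_assoc,
    S.d_idem hp (by omega), mul_zero]

/-- A face of a degenerate element is the element or degenerate. -/
theorem d_mul_s {p i j : ℕ} (hp : p + 1 ≤ L) (hi : i < p + 1) (hj : j < p) :
    d p i * s p j = ν p ∨ ∃ q i' j', d p i * s p j = s q j' * d q i' := by
  rcases lt_trichotomy i j with h | rfl | h
  · obtain ⟨p, rfl⟩ : ∃ q, p = q + 1 := ⟨p - 1, by omega⟩
    exact .inr ⟨_, _, _, S.d_s_lt p i j hp h hj⟩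
  · exact .inl (S.d_s_self p i hp hj)
  · rcases eq_or_lt_of_le (Nat.succ_le_of_lt h) with rfl | h
    · exact .inl (S.d_s_succ p j hp hj)
    · obtain ⟨p, rfl⟩ : ∃ q, p = q + 1 := ⟨p - 1, by omega⟩
      exact .inr ⟨_, _, _, S.d_s_gt p i j hp h hi⟩

/-- An ideal that contains the normalizing idempotents contains all `ν p`. -/
theorem ν_mem (J : TwoSidedIdeal A) (hJ : ∀ p ≤ L, idem ν d s p ∈ J) : ∀ p ≤ L, ν p ∈ J
  | 0, h => hJ 0 h
  | p + 1, h => by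
    have hp := ν_mem J hJ p (by omega)
    -- The difference is a sum of terms that contain some `s_j d_j`, hence factor through degree
    -- `p`.
    have key : ∀ j, ν (p + 1) - partialIdem ν d s p j ∈ J := by
      intro j
      induction j with
      | zero => rw [partialIdem, sub_self]; exact J.zero_mem
      | succ j ih =>
        rw [partialIdem, sub_mul, S.ν_partialIdem, sub_sub_eq_add_sub, add_sub_right_comm]
        refine J.add_mem ih (J.mul_mem_right _ _ ?_)
        rw [← S.ν_d, ← mul_assoc]
        exact J.mul_mem_right _ _ (J.mul_mem_left _ _ hp)
    have := J.add_mem (key p) (hJ (p + 1) h)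
    rwa [idem, sub_add_cancel] at this

end

end SimplicialSystem

end

section

/-! ### Path algebras -/

section PathAlgebra

variable (k : Type u) [CommRing k] {V : Type} [Fintype V] [Quiver.{0} V]

theorem vertexElt_mul_self (v : V) : vertexElt k v * vertexElt k v = vertexElt k v := by
  rw [vertexElt, ← map_mul]
  exact RingQuot.mkAlgHom_rel k (PathRel.idem v)

theorem vertexElt_mul_of_ne {v v' : V} (h : v ≠ v') : vertexElt k v * vertexElt k v' = 0 := by
  rw [vertexElt, vertexElt, ← map_mul, RingQuot.mkAlgHom_rel k (PathRel.orth v v' h), map_zero]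

theorem sum_vertexElt : ∑ v : V, vertexElt k v = 1 := by
  have := RingQuot.mkAlgHom_rel k (PathRel.one (k := k) (V := V))
  rw [map_sum, map_one] at this
  exact this

theorem vertexElt_mul_arrowElt {a b : V} (e : a ⟶ b) :
    vertexElt k b * arrowElt k e = arrowElt k e := by
  rw [vertexElt, arrowElt, ← map_mul]
  exact RingQuot.mkAlgHom_rel k (PathRel.head a b e)

theorem arrowElt_mul_vertexElt {a b : V} (e : a ⟶ b) :
    arrowElt k e * vertexElt k a = arrowElt k e := by
  rw [vertexElt, arrowElt, ← map_mul]
  exact RingQuot.mkAlgHom_rel k (PathRel.tail a b e)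

theorem vertexElt_mul_pathElt {a b : V} (x : Quiver.Path a b) :
    vertexElt k b * pathElt k x = pathElt k x := by
  cases x with
  | nil => exact vertexElt_mul_self k a
  | cons x e => rw [pathElt, ← mul_assoc, vertexElt_mul_arrowElt]

theorem pathElt_mul_vertexElt {a b : V} (x : Quiver.Path a b) :
    pathElt k x * vertexElt k a = pathElt k x := by
  induction x with
  | nil => exact vertexElt_mul_self k a
  | cons x e ih => rw [pathElt, mul_assoc, ih]

/-- The universal property of the path algebra. -/
def pathAlgLift {R : Type*} [Ring R] [Algebra k R] (φ : V → R) (ψ : ∀ {a b : V}, (a ⟶ b) → R)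
    (hφ : ∀ v, φ v * φ v = φ v) (hφ' : ∀ v v', v ≠ v' → φ v * φ v' = 0) (h1 : ∑ v, φ v = 1)
    (hψ : ∀ {a b : V} (e : a ⟶ b), φ b * ψ e = ψ e)
    (hψ' : ∀ {a b : V} (e : a ⟶ b), ψ e * φ a = ψ e) : PathAlg k V →ₐ[k] R :=
  RingQuot.liftAlgHom k ⟨FreeAlgebra.lift k (fun g : PathGen V => match g with
    | .inl v => φ v
    | .inr ⟨_, _, e⟩ => ψ e), fun x y h => by
    cases h with
    | idem v => simpa using hφ v
    | orth v v' h => simpa using hφ' v v' h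
    | one => simpa using h1
    | head a b e => simpa using hψ e
    | tail a b e => simpa using hψ' e⟩

theorem pathAlgLift_vertexElt {R : Type*} [Ring R] [Algebra k R] (φ : V → R)
    (ψ : ∀ {a b : V}, (a ⟶ b) → R) (hφ hφ' h1 hψ hψ') (v : V) :
    pathAlgLift k φ ψ hφ hφ' h1 hψ hψ' (vertexElt k v) = φ v := by
  rw [pathAlgLift, vertexElt, RingQuot.liftAlgHom_mkAlgHom_apply, FreeAlgebra.lift_ι_apply]

theorem pathAlgLift_arrowElt {R : Type*} [Ring R] [Algebra k R] (φ : V → R)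
    (ψ : ∀ {a b : V}, (a ⟶ b) → R) (hφ hφ' h1 hψ hψ') {a b : V} (e : a ⟶ b) :
    pathAlgLift k φ ψ hφ hφ' h1 hψ hψ' (arrowElt k e) = ψ e := by
  rw [pathAlgLift, arrowElt, RingQuot.liftAlgHom_mkAlgHom_apply, FreeAlgebra.lift_ι_apply]

/-- A linear property that is stable under multiplication by vertices and arrows is stable under
multiplication by all elements of the path algebra. -/
theorem pathAlg_mul_mem {R : Type*} [Ring R] [Algebra k R] (f : PathAlg k V →ₐ[k] R)
    (P : R → Prop) (hadd : ∀ x y, P x → P y → P (x + y)) (hsmul : ∀ (r : k) x, P x → P (r • x))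
    (hv : ∀ v, ∀ s, P s → P (f (vertexElt k v) * s))
    (ha : ∀ {a b : V} (e : a ⟶ b), ∀ s, P s → P (f (arrowElt k e) * s)) (x : PathAlg k V) :
    ∀ s, P s → P (f x * s) := by
  obtain ⟨x, rfl⟩ := RingQuot.mkAlgHom_surjective k _ x
  induction x using FreeAlgebra.induction with
  | grade0 r => intro s hs; rw [AlgHom.commutes, AlgHom.commutes, ← Algebra.smul_def]
                exact hsmul r s hs
  | grade1 g =>
    rcases g with v | ⟨a, b, e⟩
    · exact hv v
    · exact ha e
  | mul x y hx hy => intro s hs; rw [map_mul, map_mul, mul_assoc]; exact hx _ (hy s hs)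
  | add x y hx hy => intro s hs; rw [map_add, map_add, add_mul]; exact hadd _ _ (hx s hs) (hy s hs)

end PathAlgebra

/-! ### Identities in the algebra of the configuration -/

section Config

variable (K : Type w) [Field K] (k : Type u) [CommRing k] {N : ℕ}

/-- A path of the configuration as an element of the algebra. -/
def cfg {u v : CVert N} (x : Quiver.Path u v) : ConfigAlg K k N :=
  RingQuot.mkAlgHom k _ (pathElt k x)

/-- A vertex of the configuration as an element of the algebra. -/
def cfgV (v : CVert N) : ConfigAlg K k N := RingQuot.mkAlgHom k _ (vertexElt k v)

/-- An arrow of the configuration as an element of the algebra. -/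
def cfgA {u v : CVert N} (e : CArrow N u v) : ConfigAlg K k N :=
  RingQuot.mkAlgHom k _ (arrowElt k (V := CVert N) (a := u) (b := v) e)

theorem cfgV_mul_self (v : CVert N) : cfgV K k v * cfgV K k v = cfgV K k v := by
  rw [cfgV, ← map_mul, vertexElt_mul_self]

theorem cfgV_mul_of_ne {v v' : CVert N} (h : v ≠ v') : cfgV K k v * cfgV K k v' = 0 := by
  rw [cfgV, cfgV, ← map_mul, vertexElt_mul_of_ne k h, map_zero]

theorem sum_cfgV : ∑ v : CVert N, cfgV K k v = 1 := by
  simp only [cfgV]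
  rw [← map_sum, sum_vertexElt, map_one]

theorem cfgV_mul_cfgA {u v : CVert N} (e : CArrow N u v) :
    cfgV K k v * cfgA K k e = cfgA K k e := by
  rw [cfgV, cfgA, ← map_mul, vertexElt_mul_arrowElt]

theorem cfgA_mul_cfgV {u v : CVert N} (e : CArrow N u v) :
    cfgA K k e * cfgV K k u = cfgA K k e := by
  rw [cfgV, cfgA, ← map_mul, arrowElt_mul_vertexElt]

theorem cfg_nil (v : CVert N) : cfg K k (Quiver.Path.nil : Quiver.Path v v) = cfgV K k v := rfl

theorem cfg_cons {u v x : CVert N} (p : Quiver.Path u v) (e : CArrow N v x) :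
    cfg K k (Quiver.Path.cons p e) = cfgA K k e * cfg K k p := by
  rw [cfg, pathElt, map_mul]; rfl

theorem cfg_eq {u v : CVert N} (x y : Quiver.Path u v)
    (h : Nonempty (evalPath K x ≅ evalPath K y)) : cfg K k x = cfg K k y :=
  RingQuot.mkAlgHom_rel k (ConfigRel.mk x y h)

theorem cfg_one {u v : CVert N} (e : CArrow N u v) :
    cfg K k (Quiver.Path.cons .nil e) = cfgA K k e := by
  rw [cfg_cons, cfg_nil, cfgA_mul_cfgV]

theorem cfg_two {u v x : CVert N} (e : CArrow N u v) (f : CArrow N v x) :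
    cfg K k (Quiver.Path.cons (Quiver.Path.cons .nil e) f) = cfgA K k f * cfgA K k e := by
  rw [cfg_cons, cfg_one]

/-- The passage from functors to algebra: an isomorphism of composite functors is all that a
commutation rule between arrows needs. -/
theorem cfgA_mul_eq {u v v' x : CVert N} {e : CArrow N u v} {f : CArrow N v x}
    {e' : CArrow N u v'} {f' : CArrow N v' x}
    (h : Nonempty (e.functor K ⋙ f.functor K ≅ e'.functor K ⋙ f'.functor K)) :
    cfgA K k f * cfgA K k e = cfgA K k f' * cfgA K k e' := by
  rw [← cfg_two, ← cfg_two]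
  exact cfg_eq K k _ _ h

theorem cfgA_mul_eq_cfgA {u v x : CVert N} {e : CArrow N u v} {f : CArrow N v x}
    {g : CArrow N u x} (h : Nonempty (e.functor K ⋙ f.functor K ≅ g.functor K)) :
    cfgA K k f * cfgA K k e = cfgA K k g := by
  rw [← cfg_two, ← cfg_one]
  exact cfg_eq K k _ _ h

theorem cfgA_mul_eq_cfgV {u v : CVert N} {e : CArrow N u v} {f : CArrow N v u}
    (h : Nonempty (e.functor K ⋙ f.functor K ≅ 𝟭 _)) :
    cfgA K k f * cfgA K k e = cfgV K k u := by
  rw [← cfg_two, ← cfg_nil]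
  exact cfg_eq K k _ _ h

/-- Composites of pull-backs are pull-backs along the composite maps, so the question is reduced to
maps of vertices. -/
theorem DVert.restrict_comp_iso {p q q' r : ℕ} (f : Fin q →o Fin p) (g : Fin r →o Fin q)
    (f' : Fin q' →o Fin p) (g' : Fin r →o Fin q') (a b a' b' : Bool → Bool)
    (h : ∀ i, (f (g i)).val = (f' (g' i)).val) (h' : ∀ i, a (b i) = a' (b' i)) :
    Nonempty (QRep.restrict (K := K) (DVert.mapV f a) (DVert.mapV_arrow f a) ⋙
        QRep.restrict (DVert.mapV g b) (DVert.mapV_arrow g b) ≅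
      QRep.restrict (DVert.mapV f' a') (DVert.mapV_arrow f' a') ⋙
        QRep.restrict (DVert.mapV g' b') (DVert.mapV_arrow g' b')) := by
  refine ⟨QRep.restrictComp _ _ _ _ (DVert.mapV (f.comp g) (a ∘ b)) (DVert.mapV_arrow _ _) ?_ ≪≫
    (QRep.restrictComp _ _ _ _ (DVert.mapV (f.comp g) (a ∘ b)) (DVert.mapV_arrow _ _) ?_).symm⟩
  · rintro (_ | i | c) <;> rfl
  · rintro (_ | i | c)
    · rfl
    · exact congrArg _ (Fin.ext (h i).symm)
    · exact congrArg _ (h' c).symm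

theorem TVert.restrict_comp_iso {p q q' r : ℕ} (f : Fin q →o Fin p) (g : Fin r →o Fin q)
    (f' : Fin q' →o Fin p) (g' : Fin r →o Fin q')
    (h : ∀ i, (f (g i)).val = (f' (g' i)).val) :
    Nonempty (QRep.restrict (K := K) (TVert.mapV f) (TVert.mapV_arrow f) ⋙
        QRep.restrict (TVert.mapV g) (TVert.mapV_arrow g) ≅
      QRep.restrict (TVert.mapV f') (TVert.mapV_arrow f') ⋙
        QRep.restrict (TVert.mapV g') (TVert.mapV_arrow g')) := by
  refine ⟨QRep.restrictComp _ _ _ _ (TVert.mapV (f.comp g)) (TVert.mapV_arrow _) ?_ ≪≫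
    (QRep.restrictComp _ _ _ _ (TVert.mapV (f.comp g)) (TVert.mapV_arrow _) ?_).symm⟩
  · rintro (i | _ | _) <;> rfl
  · rintro (i | _ | _)
    · exact congrArg _ (Fin.ext (h i).symm)
    · rfl
    · rfl

theorem AVert.restrict_comp_iso {p q q' r : ℕ} (f : Fin q →o Fin p) (g : Fin r →o Fin q)
    (f' : Fin q' →o Fin p) (g' : Fin r →o Fin q')
    (h : ∀ i, (f (g i)).val = (f' (g' i)).val) :
    Nonempty (QRep.restrict (K := K) (AVert.mapV f) (AVert.mapV_arrow f) ⋙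
        QRep.restrict (AVert.mapV g) (AVert.mapV_arrow g) ≅
      QRep.restrict (AVert.mapV f') (AVert.mapV_arrow f') ⋙
        QRep.restrict (AVert.mapV g') (AVert.mapV_arrow g')) := by
  refine ⟨QRep.restrictComp _ _ _ _ (AVert.mapV (f.comp g)) (AVert.mapV_arrow _) ?_ ≪≫
    (QRep.restrictComp _ _ _ _ (AVert.mapV (f.comp g)) (AVert.mapV_arrow _) ?_).symm⟩
  · rintro (i | _) <;> rfl
  · rintro (i | _)
    · exact congrArg _ (Fin.ext (h i).symm)
    · rfl

theorem DVert.restrict_id_iso {p q : ℕ} (f : Fin q →o Fin p) (g : Fin p →o Fin q)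
    (a b : Bool → Bool) (h : ∀ i, (f (g i)).val = i.val) (h' : ∀ i, a (b i) = i) :
    Nonempty (QRep.restrict (K := K) (DVert.mapV f a) (DVert.mapV_arrow f a) ⋙
        QRep.restrict (DVert.mapV g b) (DVert.mapV_arrow g b) ≅ 𝟭 _) := by
  refine ⟨QRep.restrictComp _ _ _ _ (fun v => v) (fun _ _ e => ⟨e.toPath⟩) ?_ ≪≫
    QRep.restrictId _ _ fun _ => rfl⟩
  rintro (_ | i | c)
  · rfl
  · exact congrArg _ (Fin.ext (h i))
  · exact congrArg _ (h' c)

theorem TVert.restrict_id_iso {p q : ℕ} (f : Fin q →o Fin p) (g : Fin p →o Fin q)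
    (h : ∀ i, (f (g i)).val = i.val) :
    Nonempty (QRep.restrict (K := K) (TVert.mapV f) (TVert.mapV_arrow f) ⋙
        QRep.restrict (TVert.mapV g) (TVert.mapV_arrow g) ≅ 𝟭 _) := by
  refine ⟨QRep.restrictComp _ _ _ _ (fun v => v) (fun _ _ e => ⟨e.toPath⟩) ?_ ≪≫
    QRep.restrictId _ _ fun _ => rfl⟩
  rintro (i | _ | _)
  · exact congrArg _ (Fin.ext (h i))
  · rfl
  · rfl

theorem AVert.restrict_id_iso {p q : ℕ} (f : Fin q →o Fin p) (g : Fin p →o Fin q)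
    (h : ∀ i, (f (g i)).val = i.val) :
    Nonempty (QRep.restrict (K := K) (AVert.mapV f) (AVert.mapV_arrow f) ⋙
        QRep.restrict (AVert.mapV g) (AVert.mapV_arrow g) ≅ 𝟭 _) := by
  refine ⟨QRep.restrictComp _ _ _ _ (fun v => v) (fun _ _ e => ⟨e.toPath⟩) ?_ ≪≫
    QRep.restrictId _ _ fun _ => rfl⟩
  rintro (i | _)
  · exact congrArg _ (Fin.ext (h i))
  · rfl

/-! ### The three simplicial systems of the configuration -/

/-- A vertex of the configuration, or zero. -/
def vertD (N p : ℕ) : ConfigAlg K k N := if h : p ≤ N then cfgV K k (.D p h) else 0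

/-- A projection between the `D`, or zero. -/
def faceD (N p i : ℕ) : ConfigAlg K k N :=
  if h : p + 1 ≤ N ∧ i < p + 1 then cfgA K k (.dS p h.1 ⟨i, h.2⟩) else 0

/-- A section between the `D`, or zero. -/
def degD (N p i : ℕ) : ConfigAlg K k N :=
  if h : p + 1 ≤ N ∧ i < p then cfgA K k (.dR p h.1 ⟨i, h.2⟩) else 0

/-- A vertex of the configuration, or zero. -/
def vertT (N : ℕ) : ℕ → ConfigAlg K k N
  | 0 => if h : 1 ≤ N then cfgV K k (.A 1 h) else 0
  | q + 1 => if h : q < N then cfgV K k (.T q h) else 0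

/-- A projection between the `T`, or zero. -/
def faceT (N : ℕ) : ℕ → ℕ → ConfigAlg K k N
  | 0, i => if h : 0 < N ∧ i = 0 then cfgA K k (.tSZero h.1) else 0
  | q + 1, i => if h : q + 1 < N ∧ i < q + 2 then cfgA K k (.tS q h.1 ⟨i, h.2⟩) else 0

/-- A section between the `T`, or zero. -/
def degT (N : ℕ) : ℕ → ℕ → ConfigAlg K k N
  | 0, _ => 0
  | q + 1, i => if h : q + 1 < N ∧ i < q + 1 then cfgA K k (.tR q h.1 ⟨i, h.2⟩) else 0

/-- A vertex of the configuration, or zero. -/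
def vertA (N r : ℕ) : ConfigAlg K k N := if h : r ≤ N then cfgV K k (.A r h) else 0

/-- A projection between the `A`, or zero. -/
def faceA (N r i : ℕ) : ConfigAlg K k N :=
  if h : r + 1 ≤ N ∧ i < r + 1 then cfgA K k (.aS r h.1 ⟨i, h.2⟩) else 0

/-- A section between the `A`, or zero. -/
def degA (N r i : ℕ) : ConfigAlg K k N :=
  if h : r + 1 ≤ N ∧ i < r then cfgA K k (.aR r h.1 ⟨i, h.2⟩) else 0

/-- Contractions are pull-backs along cofaces and sections are pull-backs along codegeneracies, so
the simplicial identities are inherited from monotone maps. The elements out of range are zero,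
which makes the identities with `ν` valid in all degrees. -/
theorem dSystem : SimplicialSystem N (vertD K k N) (faceD K k N) (degD K k N) where
  ν_ν p := by
    unfold vertD; split_ifs
    · exact cfgV_mul_self K k _
    · exact mul_zero _
  ν_d p i := by
    unfold faceD; split_ifs with h
    · rw [vertD, dif_pos (by omega)]; exact cfgV_mul_cfgA K k _
    · exact mul_zero _
  d_ν p i := by
    unfold faceD; split_ifs with h
    · rw [vertD, dif_pos (by omega)]; exact cfgA_mul_cfgV K k _
    · exact zero_mul _
  ν_s p i := by
    unfold degD; split_ifs with h
    · rw [vertD, dif_pos (by omega)]; exact cfgV_mul_cfgA K k _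
    · exact mul_zero _
  s_ν p i := by
    unfold degD; split_ifs with h
    · rw [vertD, dif_pos (by omega)]; exact cfgA_mul_cfgV K k _
    · exact zero_mul _
  d_d p i j hp hij hj := by
    rw [faceD, faceD, faceD, faceD, dif_pos ⟨by omega, by omega⟩, dif_pos ⟨by omega, by omega⟩,
      dif_pos ⟨by omega, by omega⟩, dif_pos ⟨by omega, by omega⟩]
    refine cfgA_mul_eq K k (DVert.restrict_comp_iso K _ _ _ _ _ _ _ _ (fun l => ?_) fun _ => rfl)
    simp only [OrderEmbedding.toOrderHom_coe, Fin.succAboveOrderEmb_apply, Fin.succAbove_val]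
    split_ifs <;> omega
  d_s_lt p i j hp hij hj := by
    rw [faceD, faceD, degD, degD, dif_pos ⟨by omega, by omega⟩, dif_pos ⟨by omega, by omega⟩,
      dif_pos ⟨by omega, by omega⟩, dif_pos ⟨by omega, by omega⟩]
    refine cfgA_mul_eq K k (DVert.restrict_comp_iso K _ _ _ _ _ _ _ _ (fun l => ?_) fun _ => rfl)
    simp only [OrderEmbedding.toOrderHom_coe, Fin.succAboveOrderEmb_apply, Fin.succAbove_val,
      Fin.predAboveOrderHom_coe, Fin.predAbove_val]
    split_ifs <;> omega
  d_s_self p j hp hj := by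
    rw [faceD, degD, vertD, dif_pos ⟨by omega, by omega⟩, dif_pos ⟨by omega, by omega⟩,
      dif_pos (by omega)]
    refine cfgA_mul_eq_cfgV K k (DVert.restrict_id_iso K _ _ _ _ (fun l => ?_) fun _ => rfl)
    simp only [OrderEmbedding.toOrderHom_coe, Fin.succAboveOrderEmb_apply, Fin.succAbove_val,
      Fin.predAboveOrderHom_coe, Fin.predAbove_val]
    split_ifs <;> omega
  d_s_succ p j hp hj := by
    rw [faceD, degD, vertD, dif_pos ⟨by omega, by omega⟩, dif_pos ⟨by omega, by omega⟩,
      dif_pos (by omega)]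
    refine cfgA_mul_eq_cfgV K k (DVert.restrict_id_iso K _ _ _ _ (fun l => ?_) fun _ => rfl)
    simp only [OrderEmbedding.toOrderHom_coe, Fin.succAboveOrderEmb_apply, Fin.succAbove_val,
      Fin.predAboveOrderHom_coe, Fin.predAbove_val]
    split_ifs <;> omega
  d_s_gt p i j hp hij hj := by
    rw [faceD, faceD, degD, degD, dif_pos ⟨by omega, by omega⟩, dif_pos ⟨by omega, by omega⟩,
      dif_pos ⟨by omega, by omega⟩, dif_pos ⟨by omega, by omega⟩]
    refine cfgA_mul_eq K k (DVert.restrict_comp_iso K _ _ _ _ _ _ _ _ (fun l => ?_) fun _ => rfl)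
    simp only [OrderEmbedding.toOrderHom_coe, Fin.succAboveOrderEmb_apply, Fin.succAbove_val,
      Fin.predAboveOrderHom_coe, Fin.predAbove_val]
    split_ifs <;> omega
  s_s p i j hp hij hj := by
    rw [degD, degD, degD, degD, dif_pos ⟨by omega, by omega⟩, dif_pos ⟨by omega, by omega⟩,
      dif_pos ⟨by omega, by omega⟩, dif_pos ⟨by omega, by omega⟩]
    refine cfgA_mul_eq K k (DVert.restrict_comp_iso K _ _ _ _ _ _ _ _ (fun l => ?_) fun _ => rfl)
    simp only [Fin.predAboveOrderHom_coe, Fin.predAbove_val]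
    split_ifs <;> omega

/-- The degree is the number of chain vertices: degree `q + 1` belongs to `T q`, and degree `0` to
the vertex `A 1`, which stands for `A¹_2`. No section starts in degree `0`. -/
theorem tSystem : SimplicialSystem N (vertT K k N) (faceT K k N) (degT K k N) where
  ν_ν p := by
    cases p <;> simp only [vertT] <;> split_ifs <;>
      first | exact cfgV_mul_self K k _ | exact mul_zero _
  ν_d p i := by
    cases p <;> simp only [vertT, faceT] <;> split_ifs <;>
      first | exact cfgV_mul_cfgA K k _ | exact mul_zero _ | omega
  d_ν p i := by
    cases p <;> simp only [vertT, faceT] <;> split_ifs <;>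
      first | exact cfgA_mul_cfgV K k _ | exact zero_mul _ | omega
  ν_s p i := by
    cases p <;> simp only [vertT, degT] <;> split_ifs <;>
      first | exact cfgV_mul_cfgA K k _ | exact mul_zero _ | omega
  s_ν p i := by
    cases p <;> simp only [vertT, degT] <;> split_ifs <;>
      first | exact cfgA_mul_cfgV K k _ | exact zero_mul _ | omega
  d_d p i j hp hij hj := by
    rcases p with _ | p
    · obtain rfl : i = 0 := by omega
      obtain rfl : j = 1 := by omega
      -- In the lowest degree both composites contract the whole chain; the identification of `A¹_2`
      -- with `A_2` comes afterwards.
      change faceT K k N 0 0 * faceT K k N 1 1 = faceT K k N 0 0 * faceT K k N 1 0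
      rw [faceT, faceT, faceT, dif_pos ⟨by omega, rfl⟩, dif_pos ⟨by omega, by omega⟩,
        dif_pos ⟨by omega, by omega⟩]
      refine cfgA_mul_eq K k ((TVert.restrict_comp_iso K _ _ _ _ fun l => l.elim0).map fun α =>
        Functor.isoWhiskerRight α (tFold K))
    · simp only [faceT]
      rw [dif_pos ⟨by omega, by omega⟩, dif_pos ⟨by omega, by omega⟩,
        dif_pos ⟨by omega, by omega⟩, dif_pos ⟨by omega, by omega⟩]
      refine cfgA_mul_eq K k (TVert.restrict_comp_iso K _ _ _ _ fun l => ?_)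
      simp only [OrderEmbedding.toOrderHom_coe, Fin.succAboveOrderEmb_apply, Fin.succAbove_val]
      split_ifs <;> omega
  d_s_lt p i j hp hij hj := by
    rcases p with _ | p
    · omega
    · simp only [faceT, degT]
      rw [dif_pos ⟨by omega, by omega⟩, dif_pos ⟨by omega, by omega⟩,
        dif_pos ⟨by omega, by omega⟩, dif_pos ⟨by omega, by omega⟩]
      refine cfgA_mul_eq K k (TVert.restrict_comp_iso K _ _ _ _ fun l => ?_)
      simp only [OrderEmbedding.toOrderHom_coe, Fin.succAboveOrderEmb_apply, Fin.succAbove_val,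
        Fin.predAboveOrderHom_coe, Fin.predAbove_val]
      split_ifs <;> omega
  d_s_self p j hp hj := by
    rcases p with _ | p
    · omega
    · simp only [faceT, degT, vertT]
      rw [dif_pos ⟨by omega, by omega⟩, dif_pos ⟨by omega, by omega⟩, dif_pos (by omega)]
      refine cfgA_mul_eq_cfgV K k (TVert.restrict_id_iso K _ _ fun l => ?_)
      simp only [OrderEmbedding.toOrderHom_coe, Fin.succAboveOrderEmb_apply, Fin.succAbove_val,
        Fin.predAboveOrderHom_coe, Fin.predAbove_val]
      split_ifs <;> omega
  d_s_succ p j hp hj := by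
    rcases p with _ | p
    · omega
    · simp only [faceT, degT, vertT]
      rw [dif_pos ⟨by omega, by omega⟩, dif_pos ⟨by omega, by omega⟩, dif_pos (by omega)]
      refine cfgA_mul_eq_cfgV K k (TVert.restrict_id_iso K _ _ fun l => ?_)
      simp only [OrderEmbedding.toOrderHom_coe, Fin.succAboveOrderEmb_apply, Fin.succAbove_val,
        Fin.predAboveOrderHom_coe, Fin.predAbove_val]
      split_ifs <;> omega
  d_s_gt p i j hp hij hj := by
    rcases p with _ | p
    · omega
    · simp only [faceT, degT]
      rw [dif_pos ⟨by omega, by omega⟩, dif_pos ⟨by omega, by omega⟩,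
        dif_pos ⟨by omega, by omega⟩, dif_pos ⟨by omega, by omega⟩]
      refine cfgA_mul_eq K k (TVert.restrict_comp_iso K _ _ _ _ fun l => ?_)
      simp only [OrderEmbedding.toOrderHom_coe, Fin.succAboveOrderEmb_apply, Fin.succAbove_val,
        Fin.predAboveOrderHom_coe, Fin.predAbove_val]
      split_ifs <;> omega
  s_s p i j hp hij hj := by
    rcases p with _ | p
    · omega
    · simp only [degT]
      rw [dif_pos ⟨by omega, by omega⟩, dif_pos ⟨by omega, by omega⟩,
        dif_pos ⟨by omega, by omega⟩, dif_pos ⟨by omega, by omega⟩]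
      refine cfgA_mul_eq K k (TVert.restrict_comp_iso K _ _ _ _ fun l => ?_)
      simp only [Fin.predAboveOrderHom_coe, Fin.predAbove_val]
      split_ifs <;> omega

theorem aSystem : SimplicialSystem N (vertA K k N) (faceA K k N) (degA K k N) where
  ν_ν p := by
    unfold vertA; split_ifs
    · exact cfgV_mul_self K k _
    · exact mul_zero _
  ν_d p i := by
    unfold faceA; split_ifs with h
    · rw [vertA, dif_pos (by omega)]; exact cfgV_mul_cfgA K k _
    · exact mul_zero _
  d_ν p i := by
    unfold faceA; split_ifs with h
    · rw [vertA, dif_pos (by omega)]; exact cfgA_mul_cfgV K k _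
    · exact zero_mul _
  ν_s p i := by
    unfold degA; split_ifs with h
    · rw [vertA, dif_pos (by omega)]; exact cfgV_mul_cfgA K k _
    · exact mul_zero _
  s_ν p i := by
    unfold degA; split_ifs with h
    · rw [vertA, dif_pos (by omega)]; exact cfgA_mul_cfgV K k _
    · exact zero_mul _
  d_d p i j hp hij hj := by
    rw [faceA, faceA, faceA, faceA, dif_pos ⟨by omega, by omega⟩, dif_pos ⟨by omega, by omega⟩,
      dif_pos ⟨by omega, by omega⟩, dif_pos ⟨by omega, by omega⟩]
    refine cfgA_mul_eq K k (AVert.restrict_comp_iso K _ _ _ _ fun l => ?_)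
    simp only [OrderEmbedding.toOrderHom_coe, Fin.succAboveOrderEmb_apply, Fin.succAbove_val]
    split_ifs <;> omega
  d_s_lt p i j hp hij hj := by
    rw [faceA, faceA, degA, degA, dif_pos ⟨by omega, by omega⟩, dif_pos ⟨by omega, by omega⟩,
      dif_pos ⟨by omega, by omega⟩, dif_pos ⟨by omega, by omega⟩]
    refine cfgA_mul_eq K k (AVert.restrict_comp_iso K _ _ _ _ fun l => ?_)
    simp only [OrderEmbedding.toOrderHom_coe, Fin.succAboveOrderEmb_apply, Fin.succAbove_val,
      Fin.predAboveOrderHom_coe, Fin.predAbove_val]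
    split_ifs <;> omega
  d_s_self p j hp hj := by
    rw [faceA, degA, vertA, dif_pos ⟨by omega, by omega⟩, dif_pos ⟨by omega, by omega⟩,
      dif_pos (by omega)]
    refine cfgA_mul_eq_cfgV K k (AVert.restrict_id_iso K _ _ fun l => ?_)
    simp only [OrderEmbedding.toOrderHom_coe, Fin.succAboveOrderEmb_apply, Fin.succAbove_val,
      Fin.predAboveOrderHom_coe, Fin.predAbove_val]
    split_ifs <;> omega
  d_s_succ p j hp hj := by
    rw [faceA, degA, vertA, dif_pos ⟨by omega, by omega⟩, dif_pos ⟨by omega, by omega⟩,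
      dif_pos (by omega)]
    refine cfgA_mul_eq_cfgV K k (AVert.restrict_id_iso K _ _ fun l => ?_)
    simp only [OrderEmbedding.toOrderHom_coe, Fin.succAboveOrderEmb_apply, Fin.succAbove_val,
      Fin.predAboveOrderHom_coe, Fin.predAbove_val]
    split_ifs <;> omega
  d_s_gt p i j hp hij hj := by
    rw [faceA, faceA, degA, degA, dif_pos ⟨by omega, by omega⟩, dif_pos ⟨by omega, by omega⟩,
      dif_pos ⟨by omega, by omega⟩, dif_pos ⟨by omega, by omega⟩]
    refine cfgA_mul_eq K k (AVert.restrict_comp_iso K _ _ _ _ fun l => ?_)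
    simp only [OrderEmbedding.toOrderHom_coe, Fin.succAboveOrderEmb_apply, Fin.succAbove_val,
      Fin.predAboveOrderHom_coe, Fin.predAbove_val]
    split_ifs <;> omega
  s_s p i j hp hij hj := by
    rw [degA, degA, degA, degA, dif_pos ⟨by omega, by omega⟩, dif_pos ⟨by omega, by omega⟩,
      dif_pos ⟨by omega, by omega⟩, dif_pos ⟨by omega, by omega⟩]
    refine cfgA_mul_eq K k (AVert.restrict_comp_iso K _ _ _ _ fun l => ?_)
    simp only [Fin.predAboveOrderHom_coe, Fin.predAbove_val]
    split_ifs <;> omega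

end Config

end

section

/-! ### Corners and Morita equivalence -/

section Corner

/-- Idempotents of a ring. -/
abbrev IsRingIdem {A : Type u} [Ring A] (e : A) : Prop := IsIdempotentElem e

variable {k : Type u} [CommRing k] {A : Type u} [Ring A] [Algebra k A] {e : A}
  (he : IsIdempotentElem e)

theorem IsIdempotentElem.Corner.mul_left (x : he.Corner) : e * x.1 = x.1 :=
  ((Subsemigroup.mem_corner_iff he).1 x.2).1

theorem IsIdempotentElem.Corner.mul_right (x : he.Corner) : x.1 * e = x.1 :=
  ((Subsemigroup.mem_corner_iff he).1 x.2).2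

/-- The element `e x e` of the corner. -/
def IsIdempotentElem.cut (x : A) : he.Corner := ⟨e * x * e, x, rfl⟩

/-- The ring structure of the corner. -/
@[reducible] def cornerRing : Ring he.Corner := inferInstance

instance IsIdempotentElem.cornerAlgebra : Algebra k he.Corner :=
  RingHom.toAlgebra'
    { toFun := fun r => ⟨r • e, (Subsemigroup.mem_corner_iff he).2
        ⟨by rw [mul_smul_comm, he.eq], by rw [smul_mul_assoc, he.eq]⟩⟩
      map_one' := Subtype.ext (one_smul k e)
      map_mul' := fun r s => Subtype.ext (by
        change (r * s) • e = (r • e) * (s • e)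
        rw [smul_mul_smul_comm, he.eq])
      map_zero' := Subtype.ext (zero_smul k e)
      map_add' := fun r s => Subtype.ext (add_smul r s e) }
    fun r x => Subtype.ext (by
      change (r • e) * x.1 = x.1 * (r • e)
      rw [smul_mul_assoc, mul_smul_comm, Corner.mul_left, Corner.mul_right])

/-- The inclusion of the corner. -/
def IsIdempotentElem.cornerIncl : he.Corner →ₗ[k] A where
  toFun x := x.1
  map_add' _ _ := rfl
  map_smul' r x := by
    change (r • e) * x.1 = r • x.1
    rw [smul_mul_assoc, Corner.mul_left]

/-- Fullness becomes an explicit decomposition of `1`, from which modules and maps are rebuilt out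
of their `e`-parts. -/
theorem TwoSidedIdeal.exists_sum_mul_mul_eq {e : A} (h : (1 : A) ∈ TwoSidedIdeal.span {e}) :
    ∃ l : List (A × A), (l.map fun z => z.1 * e * z.2).sum = 1 := by
  rw [TwoSidedIdeal.mem_span_iff_mem_addSubgroup_closure] at h
  refine AddSubgroup.closure_induction (p := fun x _ =>
    ∃ l : List (A × A), (l.map fun z => z.1 * e * z.2).sum = x) ?_ ⟨[], rfl⟩ ?_ ?_ h
  · rintro _ ⟨_, ⟨x, -, _, rfl, rfl⟩, y, -, rfl⟩
    exact ⟨[(x, y)], by simp⟩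
  · rintro _ _ _ _ ⟨l, rfl⟩ ⟨l', rfl⟩
    exact ⟨l ++ l', by simp⟩
  · rintro _ _ ⟨l, rfl⟩
    refine ⟨l.map fun z => (-z.1, z.2), ?_⟩
    have := map_list_sum (-AddMonoidHom.id A) (l.map fun z => z.1 * e * z.2)
    rw [List.map_map] at this ⊢
    refine Eq.trans (congrArg List.sum (List.map_congr_left fun z _ => ?_)) this.symm
    simp
/-- The `e`-part of a module. -/
def idemPart (_ : IsIdempotentElem e) (M : Type u) [AddCommGroup M] [Module A M] :
    AddSubgroup M where
  carrier := {m | e • m = m}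
  zero_mem' := smul_zero e
  add_mem' {a b} ha hb := by
    change e • (a + b) = a + b
    rw [smul_add, ha, hb]
  neg_mem' {a} ha := by
    change e • (-a) = -a
    rw [smul_neg, ha]

instance (M : Type u) [AddCommGroup M] [Module A M] : Module he.Corner (idemPart he M) where
  smul c m := ⟨c.1 • m.1, by
    change e • c.1 • m.1 = c.1 • m.1
    rw [← mul_smul, IsIdempotentElem.Corner.mul_left]⟩
  one_smul m := Subtype.ext m.2
  mul_smul c c' m := Subtype.ext (mul_smul c.1 c'.1 m.1)
  smul_zero c := Subtype.ext (smul_zero c.1)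
  smul_add c m m' := Subtype.ext (smul_add c.1 m.1 m'.1)
  add_smul c c' m := Subtype.ext (add_smul c.1 c'.1 m.1)
  zero_smul m := Subtype.ext (zero_smul A m.1)

/-- The element `e y m` of the `e`-part. -/
def toIdemPart {M : Type u} [AddCommGroup M] [Module A M] (y : A) : M →+ idemPart he M where
  toFun m := ⟨e • y • m, by
    change e • e • y • m = e • y • m
    rw [← mul_smul, he.eq]⟩
  map_zero' := Subtype.ext (by simp)
  map_add' a b := Subtype.ext (by simp)

/-- The functor which takes a module to its `e`-part. -/
def idemFunctor : ModuleCat.{u} A ⥤ ModuleCat.{u} he.Corner where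
  obj M := ModuleCat.of _ (idemPart he M)
  map {M N} g := ModuleCat.ofHom
    { toFun := fun m => ⟨g.hom m.1, by
        change e • g.hom m.1 = g.hom m.1
        rw [← map_smul, m.2]⟩
      map_add' := fun m m' => Subtype.ext (map_add g.hom m.1 m'.1)
      map_smul' := fun c m => Subtype.ext (map_smul g.hom c.1 m.1) }
  map_id _ := rfl
  map_comp _ _ := rfl

/-- Inserting the decomposition of `1` expresses `m` through the elements `e y m`. -/
theorem sum_smul_toIdemPart {l : List (A × A)} (hl : (l.map fun z => z.1 * e * z.2).sum = 1)
    {M : Type u} [AddCommGroup M] [Module A M] (m : M) :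
    (l.map fun z => z.1 • (toIdemPart he z.2 m).1).sum = m := by
  conv_rhs => rw [← one_smul A m, ← hl, List.sum_smul, List.map_map]
  simp [toIdemPart, mul_smul, Function.comp_def]

theorem idemFunctor_faithful {l : List (A × A)}
    (hl : (l.map fun z => z.1 * e * z.2).sum = 1) : (idemFunctor he).Faithful where
  map_injective {M N} g g' h := by
    refine ModuleCat.hom_ext (LinearMap.ext fun m => ?_)
    have key : ∀ x : idemPart he M, g.hom x.1 = g'.hom x.1 := fun x =>
      congrArg Subtype.val (LinearMap.congr_fun (congrArg ModuleCat.Hom.hom h) x)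
    rw [← sum_smul_toIdemPart he hl m, map_list_sum, map_list_sum, List.map_map, List.map_map]
    simp [Function.comp_def, key]

theorem coe_cut_smul {M : Type u} [AddCommGroup M] [Module A M] (y : A) (m : idemPart he M) :
    (he.cut y • m).1 = e • y • m.1 := by
  change (e * y * e) • m.1 = _
  rw [mul_smul, m.2, mul_smul]

/-- Linear maps of the `e`-parts extend. -/
theorem exists_linearMap_extending {l : List (A × A)}
    (hl : (l.map fun z => z.1 * e * z.2).sum = 1) {M N : Type u} [AddCommGroup M] [Module A M]
    [AddCommGroup N] [Module A N] (g : idemPart he M →ₗ[he.Corner] idemPart he N) :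
    ∃ G : M →ₗ[A] N, ∀ m : idemPart he M, G m.1 = (g m).1 := by
  let G : M → N := fun m => (l.map fun z => z.1 • (g (toIdemPart he z.2 m)).1).sum
  have hG : ∀ (a : A) (m : M), G (a • m) = a • G m := by
    intro a m
    have h1 : ∀ y : A, (g (toIdemPart he y (a • m))).1 = e • y • a • G m := by
      intro y
      -- The element `e y a m` is a combination of the elements `e z.2 m` with coefficients in the
      -- corner, over which `g` is linear.
      have : toIdemPart he y (a • m) = (l.map fun z =>
          he.cut (y * a * z.1) • toIdemPart he z.2 m).sum := by
        refine Subtype.ext ?_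
        rw [AddSubgroup.val_list_sum, List.map_map]
        conv_lhs => rw [← sum_smul_toIdemPart he hl m]
        change e • y • a • _ = _
        rw [List.smul_sum, List.smul_sum, List.smul_sum, List.map_map, List.map_map, List.map_map]
        refine congrArg List.sum (List.map_congr_left fun z _ => ?_)
        simp only [Function.comp_apply, coe_cut_smul, mul_smul]
      rw [this, map_list_sum, AddSubgroup.val_list_sum, List.map_map, List.map_map, List.smul_sum,
        List.smul_sum, List.smul_sum, List.map_map, List.map_map, List.map_map]
      refine congrArg List.sum (List.map_congr_left fun z _ => ?_)
      simp only [Function.comp_apply, map_smul, coe_cut_smul, mul_smul]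
    change (l.map fun z => z.1 • (g (toIdemPart he z.2 (a • m))).1).sum = _
    simp only [h1]
    exact sum_smul_toIdemPart he hl (a • G m)
  refine ⟨{ toFun := G, map_add' := fun m m' => ?_, map_smul' := hG }, fun m => ?_⟩
  · simp only [G, map_add, AddSubgroup.coe_add, smul_add]
    exact List.sum_map_add
  · change G m.1 = (g m).1
    have : ∀ y : A, (g (toIdemPart he y m.1)).1 = e • y • (g m).1 := by
      intro y
      have h1 : toIdemPart he y m.1 = he.cut y • m := Subtype.ext (coe_cut_smul he y m).symm
      rw [h1, map_smul, coe_cut_smul]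
    simp only [G, this]
    exact sum_smul_toIdemPart he hl _

theorem idemFunctor_full {l : List (A × A)}
    (hl : (l.map fun z => z.1 * e * z.2).sum = 1) : (idemFunctor he).Full where
  map_surjective {M N} g := by
    obtain ⟨G, hG⟩ := exists_linearMap_extending he hl (M := M) (N := N) g.hom
    exact ⟨ModuleCat.ofHom G, ModuleCat.hom_ext (LinearMap.ext fun m => Subtype.ext (hG m))⟩

/-- The module coinduced from a module over the corner. -/
def cornerCoind (X : Type u) [AddCommGroup X] [Module he.Corner X] : AddSubgroup (A →+ X) where
  carrier := {f | ∀ (c : he.Corner) (x : A), f (c.1 * x) = c • f x}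
  zero_mem' c x := (smul_zero c).symm
  add_mem' {f g} hf hg c x := by
    change f _ + g _ = c • (f x + g x)
    rw [hf, hg, smul_add]
  neg_mem' {f} hf c x := by
    change -f _ = c • -f x
    rw [hf, smul_neg]

instance (X : Type u) [AddCommGroup X] [Module he.Corner X] : Module A (cornerCoind he X) where
  smul a f := ⟨f.1.comp (AddMonoidHom.mulRight a), fun c x => by
    change f.1 (c.1 * x * a) = c • f.1 (x * a)
    rw [mul_assoc, f.2]⟩
  one_smul f := Subtype.ext (AddMonoidHom.ext fun x => congrArg f.1 (mul_one x))
  mul_smul a b f := Subtype.ext (AddMonoidHom.ext fun x => congrArg f.1 (mul_assoc x a b).symm)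
  smul_zero _ := rfl
  smul_add _ _ _ := rfl
  add_smul a b f := Subtype.ext (AddMonoidHom.ext fun x => by
    change f.1 (x * (a + b)) = f.1 (x * a) + f.1 (x * b)
    rw [mul_add, map_add])
  zero_smul f := Subtype.ext (AddMonoidHom.ext fun x => by
    change f.1 (x * 0) = 0
    rw [mul_zero, map_zero])

/-- The `e`-part of the coinduced module is the given module. -/
def cornerCoindEquiv (X : Type u) [AddCommGroup X] [Module he.Corner X] :
    idemPart he (cornerCoind he X) ≃ₗ[he.Corner] X where
  toFun f := f.1.1 e
  map_add' _ _ := rfl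
  map_smul' c f := by
    change f.1.1 (e * c.1) = c • f.1.1 e
    rw [← f.1.2, IsIdempotentElem.Corner.mul_left, IsIdempotentElem.Corner.mul_right]
  invFun p := ⟨⟨{ toFun := fun x => he.cut x • p
                  map_zero' := by
                    rw [show he.cut (0 : A) = 0 from Subtype.ext (by
                      change e * 0 * e = 0
                      rw [mul_zero, zero_mul])]
                    exact zero_smul he.Corner p
                  map_add' := fun x y => by
                    rw [← add_smul]
                    exact congrArg (· • p) (Subtype.ext (by
                      change e * (x + y) * e = e * x * e + e * y * e
                      rw [mul_add, add_mul])) }, fun c x => by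
      change he.cut _ • p = c • he.cut x • p
      rw [← mul_smul]
      exact congrArg (· • p) (Subtype.ext (by
        change e * (c.1 * x) * e = c.1 * (e * x * e)
        rw [← mul_assoc, IsIdempotentElem.Corner.mul_left, ← mul_assoc, ← mul_assoc,
          IsIdempotentElem.Corner.mul_right]))⟩,
    Subtype.ext (AddMonoidHom.ext fun x => by
      change he.cut (x * e) • p = he.cut x • p
      exact congrArg (· • p) (Subtype.ext (by
        change e * (x * e) * e = e * x * e
        rw [mul_assoc, mul_assoc x, he.eq, mul_assoc])))⟩
  left_inv f := by
    refine Subtype.ext (Subtype.ext (AddMonoidHom.ext fun x => ?_))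
    change he.cut x • f.1.1 e = f.1.1 x
    rw [← f.1.2]
    change f.1.1 (e * x * e * e) = _
    have h1 : ∀ y, f.1.1 (y * e) = f.1.1 y := fun y =>
      DFunLike.congr_fun (congrArg Subtype.val f.2) y
    rw [h1, h1]
    exact (f.1.2 1 x).trans (one_smul _ _)
  right_inv p := by
    change he.cut e • p = p
    rw [show he.cut e = 1 from Subtype.ext (by
      change e * e * e = e
      rw [he.eq, he.eq]), one_smul]

theorem idemFunctor_essSurj : (idemFunctor he).EssSurj where
  mem_essImage X := ⟨ModuleCat.of A (cornerCoind he X), ⟨(cornerCoindEquiv he X).toModuleIso⟩⟩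

open scoped ModuleCat.Algebra in
theorem idemFunctor_linear : (idemFunctor he).Linear k where
  map_smul {M N} g r := by
    refine ModuleCat.hom_ext (LinearMap.ext fun m => Subtype.ext ?_)
    change algebraMap k A r • g.hom m.1 = (r • e) • g.hom m.1
    rw [Algebra.smul_def, mul_smul, ← map_smul g.hom e, m.2]

/-- An algebra is Morita equivalent to the corner of a full idempotent. -/
theorem isMoritaEquivalent_corner (h : (1 : A) ∈ TwoSidedIdeal.span {e}) :
    IsMoritaEquivalent k A he.Corner := by
  obtain ⟨l, hl⟩ := TwoSidedIdeal.exists_sum_mul_mul_eq h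
  have := idemFunctor_faithful he hl
  have := idemFunctor_full he hl
  have := idemFunctor_essSurj he
  have : (idemFunctor he).IsEquivalence := {}
  exact ⟨⟨⟨(idemFunctor he).asEquivalence, idemFunctor_linear he⟩⟩⟩

end Corner

end

section

/-! ### Relations between the families of arrows of the configuration -/

section Config

variable (K : Type w) [Field K] (k : Type u) [CommRing k] {N : ℕ}

/-- Two composites of restrictions agree if the maps of vertices do. -/
theorem QRep.restrict_comp_restrict {V W W' U : Type} [Quiver.{0} V] [Quiver.{0} W]
    [Quiver.{0} W'] [Quiver.{0} U] [∀ a b : V, Subsingleton (Quiver.Path a b)] {φ : W → V}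
    (h : ∀ a b : W, (a ⟶ b) → Nonempty (Quiver.Path (φ a) (φ b))) {ψ : U → W}
    (h' : ∀ a b : U, (a ⟶ b) → Nonempty (Quiver.Path (ψ a) (ψ b))) {φ' : W' → V}
    (g : ∀ a b : W', (a ⟶ b) → Nonempty (Quiver.Path (φ' a) (φ' b))) {ψ' : U → W'}
    (g' : ∀ a b : U, (a ⟶ b) → Nonempty (Quiver.Path (ψ' a) (ψ' b)))
    (H : ∀ a, φ (ψ a) = φ' (ψ' a)) :
    Nonempty (QRep.restrict (K := K) φ h ⋙ QRep.restrict ψ h' ≅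
      QRep.restrict φ' g ⋙ QRep.restrict ψ' g') :=
  ⟨QRep.restrictComp φ h ψ h' (fun a => φ (ψ a))
      (fun a b e => QRep.nonempty_path_of_arrows h (h' a b e).some) (fun _ => rfl) ≪≫
    (QRep.restrictComp φ' g ψ' g' (fun a => φ (ψ a)) _ fun a => (H a).symm).symm⟩

/-- The inclusion of `A_2` in `A¹_3` that misses `chain 0`. -/
def AVert.toExtra : AVert 1 → TVert 1
  | .chain _ => .extra
  | .sink => .sink

theorem AVert.toExtra_arrow :
    ∀ a b : AVert 1, (a ⟶ b) → Nonempty (Quiver.Path (toExtra a) (toExtra b))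
  | .chain i, .chain j, ⟨h⟩ => absurd h (by
      have := i.isLt
      have := j.isLt
      change ¬ (j.val = i.val + 1)
      omega)
  | .chain _, .sink, _ => TVert.reach_extra_sink

/-- The functor assigned to the last projection of `A¹_3` as a restriction. -/
def tProjFold : tProj K (0 : Fin 1) ⋙ tFold K ≅
    QRep.restrict AVert.toExtra AVert.toExtra_arrow :=
  QRep.restrictComp _ _ _ _ _ _ (by rintro (_ | _) <;> rfl)

theorem cfg_dT_dT (p : ℕ) (h : p ≤ N) :
    cfgA K k (.dT p h) * cfgA K k (.dT p h) = cfgV K k (.D p h) :=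
  cfgA_mul_eq_cfgV K k ⟨dSwapSwap K⟩

theorem cfg_dT_dS (p : ℕ) (h : p + 1 ≤ N) (i : Fin (p + 1)) :
    cfgA K k (.dT p (Nat.le_of_succ_le h)) * cfgA K k (.dS p h i) =
      cfgA K k (.dS p h i) * cfgA K k (.dT (p + 1) h) :=
  cfgA_mul_eq K k (DVert.restrict_comp_iso K _ _ _ _ _ _ _ _ (fun _ => rfl) fun _ => rfl)

theorem cfg_dT_dR (p : ℕ) (h : p + 1 ≤ N) (i : Fin p) :
    cfgA K k (.dT (p + 1) h) * cfgA K k (.dR p h i) =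
      cfgA K k (.dR p h i) * cfgA K k (.dT p (Nat.le_of_succ_le h)) :=
  cfgA_mul_eq K k (DVert.restrict_comp_iso K _ _ _ _ _ _ _ _ (fun _ => rfl) fun _ => rfl)

theorem cfg_tT_tT (h : 0 < N) :
    cfgA K k (.tT h) * cfgA K k (.tT h) = cfgV K k (.T 0 h) :=
  cfgA_mul_eq_cfgV K k ⟨tSwapSwap K⟩

/-- After the exchange of the sources the contraction keeps the arrow that started at `chain 0`,
which is what remains when `extra` is forgotten. So the arrow `b` at `A¹_3` is `(a'/b) t` and needs
no generator of its own. -/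
theorem cfg_tSZero_tT (h : 0 < N) :
    cfgA K k (.tSZero h) * cfgA K k (.tT h) = cfgA K k (.tE 0 h) := by
  refine cfgA_mul_eq_cfgA K k ⟨Functor.isoWhiskerLeft (tSwap K) (tProjFold K) ≪≫
      QRep.restrictComp _ _ _ _ AVert.toTVert AVert.toTVert_arrow ?_⟩
  rintro (a | _)
  · obtain rfl := Fin.fin_one_eq_zero a
    rfl
  · rfl

/-- Both composites keep only the space at the sink. -/
theorem cfg_aS_tSZero (h : 0 < N) :
    cfgA K k (.aS 0 h 0) * cfgA K k (.tSZero h) = cfgA K k (.aS 0 h 0) * cfgA K k (.tE 0 h) := by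
  obtain ⟨α⟩ := QRep.restrict_comp_restrict K AVert.toExtra_arrow
    (AVert.mapV_arrow (Fin.succAboveOrderEmb (0 : Fin 1)).toOrderHom) AVert.toTVert_arrow
    (AVert.mapV_arrow (Fin.succAboveOrderEmb (0 : Fin 1)).toOrderHom) (by
      rintro (a | _)
      · exact a.elim0
      · rfl)
  exact cfgA_mul_eq K k ⟨Functor.isoWhiskerRight (tProjFold K) _ ≪≫ α⟩

theorem cfg_aS_tE (q : ℕ) (h : q + 1 < N) (i : Fin (q + 2)) :
    cfgA K k (.aS (q + 1) h i) * cfgA K k (.tE (q + 1) h) =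
      cfgA K k (.tE q (Nat.lt_of_succ_lt h)) * cfgA K k (.tS q h i) :=
  cfgA_mul_eq K k (QRep.restrict_comp_restrict K _ _ _ _ (by rintro (a | _) <;> rfl))

theorem cfg_tE_tR (q : ℕ) (h : q + 1 < N) (i : Fin (q + 1)) :
    cfgA K k (.tE (q + 1) h) * cfgA K k (.tR q h i) =
      cfgA K k (.aR (q + 1) h i) * cfgA K k (.tE q (Nat.lt_of_succ_lt h)) :=
  cfgA_mul_eq K k (QRep.restrict_comp_restrict K _ _ _ _ (by rintro (a | _) <;> rfl))

theorem cfg_dI_dS (q : ℕ) (h : q + 2 ≤ N) (b : Bool) (i : Fin (q + 2)) :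
    cfgA K k (.dI q (Nat.le_of_succ_le h) b) * cfgA K k (.dS (q + 1) h i) =
      cfgA K k (.tS q h i) * cfgA K k (.dI (q + 1) h b) :=
  cfgA_mul_eq K k ⟨restrictIProj b _⟩

theorem cfg_dI_dR (q : ℕ) (h : q + 2 ≤ N) (b : Bool) (i : Fin (q + 1)) :
    cfgA K k (.dI (q + 1) h b) * cfgA K k (.dR (q + 1) h i) =
      cfgA K k (.tR q h i) * cfgA K k (.dI q (Nat.le_of_succ_le h) b) :=
  cfgA_mul_eq K k ⟨restrictIProj b _⟩

theorem cfg_dIZero_dS (h : 1 ≤ N) (b : Bool) :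
    cfgA K k (.dIZero h b) * cfgA K k (.dS 0 h 0) =
      cfgA K k (.tSZero h) * cfgA K k (.dI 0 h b) :=
  cfgA_mul_eq K k ⟨Functor.isoWhiskerRight (restrictIProj b _) (tFold K)⟩

theorem cfg_dI_dT (q : ℕ) (h : q + 1 ≤ N) (b : Bool) :
    cfgA K k (.dI q h b) * cfgA K k (.dT (q + 1) h) = cfgA K k (.dI q h (!b)) :=
  cfgA_mul_eq_cfgA K k ⟨dSwapIProj b⟩

theorem cfg_dIZero_dT (h : 1 ≤ N) (b : Bool) :
    cfgA K k (.dIZero h b) * cfgA K k (.dT 0 (Nat.zero_le N)) = cfgA K k (.dIZero h (!b)) :=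
  cfgA_mul_eq_cfgA K k ⟨Functor.isoWhiskerRight (dSwapIProj b) (tFold K)⟩

theorem cfg_tE_dI (q : ℕ) (h : q + 1 ≤ N) (b : Bool) :
    cfgA K k (.tE q h) * cfgA K k (.dI q h b) = cfgA K k (.tE q h) * cfgA K k (.dI q h (!b)) :=
  cfgA_mul_eq K k ⟨iProjForget b⟩

theorem cfg_aS_dIZero (h : 1 ≤ N) (b : Bool) :
    cfgA K k (.aS 0 h 0) * cfgA K k (.dIZero h b) =
      cfgA K k (.aS 0 h 0) * cfgA K k (.dIZero h (!b)) :=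
  cfgA_mul_eq K k ⟨iProjFoldProj b⟩

end Config

end

section

/-! ### The normalizing idempotents of the configuration -/

section Config

variable (K : Type w) [Field K] (k : Type u) [CommRing k] {N : ℕ}

theorem vertD_eq (p : ℕ) (h : p ≤ N) : vertD K k N p = cfgV K k (.D p h) := dif_pos h

theorem vertT_eq (q : ℕ) (h : q < N) : vertT K k N (q + 1) = cfgV K k (.T q h) := dif_pos h

theorem vertA_eq (r : ℕ) (h : r ≤ N) : vertA K k N r = cfgV K k (.A r h) := dif_pos h

theorem faceD_eq (p : ℕ) (h : p + 1 ≤ N) (i : Fin (p + 1)) :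
    faceD K k N p i = cfgA K k (.dS p h i) := dif_pos ⟨h, i.isLt⟩

theorem faceT_eq (q : ℕ) (h : q + 1 < N) (i : Fin (q + 2)) :
    faceT K k N (q + 1) i = cfgA K k (.tS q h i) := dif_pos ⟨h, i.isLt⟩

theorem faceT_zero (h : 0 < N) : faceT K k N 0 0 = cfgA K k (.tSZero h) := dif_pos ⟨h, rfl⟩

theorem faceA_eq (r : ℕ) (h : r + 1 ≤ N) (i : Fin (r + 1)) :
    faceA K k N r i = cfgA K k (.aS r h i) := dif_pos ⟨h, i.isLt⟩

theorem degD_eq (p : ℕ) (h : p + 1 ≤ N) (i : Fin p) :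
    degD K k N p i = cfgA K k (.dR p h i) := dif_pos ⟨h, i.isLt⟩

theorem degT_eq (q : ℕ) (h : q + 1 < N) (i : Fin (q + 1)) :
    degT K k N (q + 1) i = cfgA K k (.tR q h i) := dif_pos ⟨h, i.isLt⟩

theorem degA_eq (r : ℕ) (h : r + 1 ≤ N) (i : Fin r) :
    degA K k N r i = cfgA K k (.aR r h i) := dif_pos ⟨h, i.isLt⟩

/-- The normalizing idempotent at a vertex of the configuration. -/
def nrm : CVert N → ConfigAlg K k N
  | .D p _ => SimplicialSystem.idem (vertD K k N) (faceD K k N) (degD K k N) p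
  | .T q _ => SimplicialSystem.idem (vertT K k N) (faceT K k N) (degT K k N) (q + 1)
  | .A r _ => SimplicialSystem.idem (vertA K k N) (faceA K k N) (degA K k N) r

theorem cfgV_mul_nrm (v : CVert N) : cfgV K k v * nrm K k v = nrm K k v := by
  cases v with
  | D p h => rw [← vertD_eq]; exact (dSystem K k).ν_idem p
  | T q h => rw [← vertT_eq]; exact (tSystem K k).ν_idem (q + 1)
  | A r h => rw [← vertA_eq]; exact (aSystem K k).ν_idem r

theorem nrm_mul_cfgV (v : CVert N) : nrm K k v * cfgV K k v = nrm K k v := by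
  cases v with
  | D p h => rw [← vertD_eq]; exact (dSystem K k).idem_ν p
  | T q h => rw [← vertT_eq]; exact (tSystem K k).idem_ν (q + 1)
  | A r h => rw [← vertA_eq]; exact (aSystem K k).idem_ν r

theorem nrm_mul_self (v : CVert N) : nrm K k v * nrm K k v = nrm K k v := by
  cases v with
  | D p h => exact (dSystem K k).idem_idem h
  | T q h => exact (tSystem K k).idem_idem h
  | A r h => exact (aSystem K k).idem_idem h

theorem nrm_mul_of_ne {v v' : CVert N} (h : v ≠ v') : nrm K k v * nrm K k v' = 0 := by
  rw [← nrm_mul_cfgV, ← cfgV_mul_nrm K k v', mul_assoc, ← mul_assoc (cfgV K k v),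
    cfgV_mul_of_ne K k h, zero_mul, mul_zero]

theorem cfg_dS_nrm (p : ℕ) (h : p + 1 ≤ N) (i : Fin p) :
    cfgA K k (.dS p h i.castSucc) * nrm K k (.D (p + 1) h) = 0 := by
  rw [← faceD_eq]; exact (dSystem K k).d_idem h i.isLt

theorem cfg_tS_nrm (q : ℕ) (h : q + 1 < N) (i : Fin (q + 1)) :
    cfgA K k (.tS q h i.castSucc) * nrm K k (.T (q + 1) h) = 0 := by
  rw [← faceT_eq]; exact (tSystem K k).d_idem h i.isLt

theorem cfg_aS_nrm (r : ℕ) (h : r + 1 ≤ N) (i : Fin r) :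
    cfgA K k (.aS r h i.castSucc) * nrm K k (.A (r + 1) h) = 0 := by
  rw [← faceA_eq]; exact (aSystem K k).d_idem h i.isLt

theorem nrm_dR (p : ℕ) (h : p + 1 ≤ N) (i : Fin p) :
    nrm K k (.D (p + 1) h) * cfgA K k (.dR p h i) = 0 := by
  rw [← degD_eq]; exact (dSystem K k).idem_s h i.isLt

theorem nrm_tR (q : ℕ) (h : q + 1 < N) (i : Fin (q + 1)) :
    nrm K k (.T (q + 1) h) * cfgA K k (.tR q h i) = 0 := by
  rw [← degT_eq]; exact (tSystem K k).idem_s h i.isLt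

theorem nrm_aR (r : ℕ) (h : r + 1 ≤ N) (i : Fin r) :
    nrm K k (.A (r + 1) h) * cfgA K k (.aR r h i) = 0 := by
  rw [← degA_eq]; exact (aSystem K k).idem_s h i.isLt

variable {K k} {x : ConfigAlg K k N}

/-- The test for normalized elements: every contraction except the last must kill them. The index
`i.castSucc` expresses this exclusion. -/
theorem nrm_D_mul {p : ℕ} {h : p ≤ N} (hx : cfgV K k (.D p h) * x = x)
    (H : ∀ q (hq : q + 1 ≤ N) (i : Fin q), p = q + 1 → cfgA K k (.dS q hq i.castSucc) * x = 0) :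
    nrm K k (.D p h) * x = x := by
  have hx' : vertD K k N p * x = x := by rwa [vertD_eq]
  refine SimplicialSystem.idem_mul hx' fun i q hq hi => ?_
  exact (congrArg (· * x) (faceD_eq K k q (by omega) (Fin.castSucc ⟨i, hi⟩))).trans
    (H q (by omega) ⟨i, hi⟩ hq)

theorem nrm_T_mul {p : ℕ} {h : p < N} (hx : cfgV K k (.T p h) * x = x)
    (H : ∀ q (hq : q + 1 < N) (i : Fin (q + 1)), p = q + 1 →
      cfgA K k (.tS q hq i.castSucc) * x = 0) :
    nrm K k (.T p h) * x = x := by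
  have hx' : vertT K k N (p + 1) * x = x := by rwa [vertT_eq]
  refine SimplicialSystem.idem_mul (p := p + 1) (ν := vertT K k N) hx' fun i q hq hi => ?_
  obtain ⟨q, rfl⟩ : ∃ l, q = l + 1 := ⟨q - 1, by omega⟩
  exact (congrArg (· * x) (faceT_eq K k q (by omega) (Fin.castSucc ⟨i, hi⟩))).trans
    (H q (by omega) ⟨i, hi⟩ (by omega))

theorem nrm_A_mul {p : ℕ} {h : p ≤ N} (hx : cfgV K k (.A p h) * x = x)
    (H : ∀ q (hq : q + 1 ≤ N) (i : Fin q), p = q + 1 → cfgA K k (.aS q hq i.castSucc) * x = 0) :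
    nrm K k (.A p h) * x = x := by
  have hx' : vertA K k N p * x = x := by rwa [vertA_eq]
  refine SimplicialSystem.idem_mul hx' fun i q hq hi => ?_
  exact (congrArg (· * x) (faceA_eq K k q (by omega) (Fin.castSucc ⟨i, hi⟩))).trans
    (H q (by omega) ⟨i, hi⟩ hq)

/-! ### The homomorphism from the algebra of complexes -/

/-- The arrow of the configuration that represents an arrow of the second quiver. -/
def BArrow.toCArrow : ∀ {u v : CVert N}, BArrow N u v → CArrow N u v
  | _, _, .d p h => .dS p h (Fin.last p)
  | _, _, .t p h => .dT p h
  | _, _, .c q h => .dI q h false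
  | _, _, .cZero h => .dIZero h false
  | _, _, .a' q h => .tS q h (Fin.last (q + 1))
  | _, _, .f h => .tSZero h
  | _, _, .s h => .tT h
  | _, _, .b q h => .tE (q + 1) h
  | _, _, .a r h => .aS r h (Fin.last r)

variable (K k)

/-- The normalized arrow. -/
def nrmA {u v : CVert N} (e : BArrow N u v) : ConfigAlg K k N :=
  cfgA K k e.toCArrow * nrm K k u

theorem nrmA_mul_nrm {u v : CVert N} (e : BArrow N u v) :
    nrmA K k e * nrm K k u = nrmA K k e := by
  rw [nrmA, mul_assoc, nrm_mul_self]

theorem cfg_dT_nrm (p : ℕ) (h : p ≤ N) :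
    nrm K k (.D p h) * (cfgA K k (.dT p h) * nrm K k (.D p h)) =
      cfgA K k (.dT p h) * nrm K k (.D p h) := by
  refine nrm_D_mul (by rw [← mul_assoc, cfgV_mul_cfgA]) fun q hq i hp => ?_
  subst hp
  rw [← mul_assoc, ← cfg_dT_dS, mul_assoc, cfg_dS_nrm, mul_zero]

/-- Last contractions preserve normalized parts by the simplicial identities. The other arrows
intertwine contractions of the same index, so what the contractions other than the last kill is
still killed afterwards. -/
theorem nrm_mul_nrmA {u v : CVert N} (e : BArrow N u v) :
    nrm K k v * nrmA K k e = nrmA K k e := by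
  have hx : cfgV K k v * nrmA K k e = nrmA K k e := by rw [nrmA, ← mul_assoc, cfgV_mul_cfgA]
  rw [nrmA] at hx ⊢
  cases e with
  | d p h =>
    rw [BArrow.toCArrow, ← faceD_eq]
    exact (dSystem K k).idem_d_last h
  | t p h => exact cfg_dT_nrm K k p h
  | c q h =>
    refine nrm_T_mul hx fun l hl i hq => ?_
    subst hq
    rw [BArrow.toCArrow, ← mul_assoc, ← cfg_dI_dS, mul_assoc, cfg_dS_nrm, mul_zero]
  | cZero h =>
    -- The target is `A 1`, whose only contraction is the last one, so the condition is empty.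
    refine nrm_A_mul hx fun l hl i hq => ?_
    obtain rfl : l = 0 := by omega
    exact i.elim0
  | a' q h =>
    rw [BArrow.toCArrow, ← faceT_eq]
    exact (tSystem K k).idem_d_last h
  | f h =>
    refine nrm_A_mul hx fun l hl i hq => ?_
    obtain rfl : l = 0 := by omega
    exact i.elim0
  | s h => exact nrm_T_mul hx fun l hl i hq => by omega
  | b q h =>
    refine nrm_A_mul hx fun l hl i hq => ?_
    obtain rfl : l = q + 1 := by omega
    rw [BArrow.toCArrow, ← mul_assoc, cfg_aS_tE, mul_assoc, cfg_tS_nrm, mul_zero]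
  | a r h =>
    rw [BArrow.toCArrow, ← faceA_eq]
    exact (aSystem K k).idem_d_last h

/-- The inner idempotent can be dropped because the right factor already lands in the normalized
part. -/
theorem nrmA_mul_nrmA {u v x : CVert N} (e : BArrow N u v) (f : BArrow N v x) :
    nrmA K k f * nrmA K k e = cfgA K k f.toCArrow * cfgA K k e.toCArrow * nrm K k u := by
  conv_lhs => rw [nrmA, mul_assoc, nrm_mul_nrmA, nrmA, ← mul_assoc]

theorem nrmA_mul_nrmA_mul_nrmA {u v x y : CVert N} (e : BArrow N u v) (f : BArrow N v x)
    (g : BArrow N x y) : nrmA K k g * nrmA K k f * nrmA K k e =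
      cfgA K k g.toCArrow * cfgA K k f.toCArrow * cfgA K k e.toCArrow * nrm K k u := by
  rw [nrmA_mul_nrmA, mul_assoc, nrm_mul_nrmA, nrmA, ← mul_assoc]

/-- The sum of the normalizing idempotents. -/
def totalNrm (N : ℕ) : ConfigAlg K k N := ∑ v : CVert N, nrm K k v

theorem totalNrm_mul_of {v : CVert N} {y : ConfigAlg K k N} (h : nrm K k v * y = y) :
    totalNrm K k N * y = y := by
  rw [totalNrm, Finset.sum_mul, Finset.sum_eq_single_of_mem v (Finset.mem_univ v), h]
  intro v' _ hv
  rw [← h, ← mul_assoc, nrm_mul_of_ne K k hv, zero_mul]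

theorem mul_totalNrm_of {v : CVert N} {y : ConfigAlg K k N} (h : y * nrm K k v = y) :
    y * totalNrm K k N = y := by
  rw [totalNrm, Finset.mul_sum, Finset.sum_eq_single_of_mem v (Finset.mem_univ v), h]
  intro v' _ hv
  rw [← h, mul_assoc, nrm_mul_of_ne K k hv.symm, mul_zero]

theorem isIdempotentElem_totalNrm : IsRingIdem (totalNrm K k N) := by
  change totalNrm K k N * totalNrm K k N = totalNrm K k N
  conv_lhs => rw [totalNrm, Finset.sum_mul]
  exact Finset.sum_congr rfl fun v _ => mul_totalNrm_of K k (nrm_mul_self K k v)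

/-- The corner of the algebra of the configuration. -/
def NrmAlg (N : ℕ) : Type u := (isIdempotentElem_totalNrm K k (N := N)).Corner

instance : Ring (NrmAlg K k N) := cornerRing (isIdempotentElem_totalNrm K k)

instance : Algebra k (NrmAlg K k N) :=
  IsIdempotentElem.cornerAlgebra (isIdempotentElem_totalNrm K k)

/-- The inclusion of the corner. -/
def nrmIncl (N : ℕ) : NrmAlg K k N →ₗ[k] ConfigAlg K k N :=
  IsIdempotentElem.cornerIncl (isIdempotentElem_totalNrm K k)

theorem nrmIncl_injective : Function.Injective (nrmIncl K k N) := Subtype.val_injective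

theorem nrmIncl_mul (x y : NrmAlg K k N) :
    nrmIncl K k N (x * y) = nrmIncl K k N x * nrmIncl K k N y := rfl

/-- The normalizing idempotent in the corner. -/
def cornerV (v : CVert N) : NrmAlg K k N :=
  ⟨nrm K k v, (Subsemigroup.mem_corner_iff (isIdempotentElem_totalNrm K k)).2
    ⟨totalNrm_mul_of K k (nrm_mul_self K k v), mul_totalNrm_of K k (nrm_mul_self K k v)⟩⟩

/-- The normalized arrow in the corner. -/
def cornerA {u v : CVert N} (e : BArrow N u v) : NrmAlg K k N :=
  ⟨nrmA K k e, (Subsemigroup.mem_corner_iff (isIdempotentElem_totalNrm K k)).2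
    ⟨totalNrm_mul_of K k (nrm_mul_nrmA K k e), mul_totalNrm_of K k (nrmA_mul_nrm K k e)⟩⟩

/-- The homomorphism from the path algebra of the second quiver to the corner. -/
def nrmPathHom (N : ℕ) : PathAlg k (BVert N) →ₐ[k] NrmAlg K k N :=
  pathAlgLift k (V := BVert N) (fun v => cornerV K k v) (fun e => cornerA K k e)
    (fun v => Subtype.ext (nrm_mul_self K k v))
    (fun _ _ h => Subtype.ext (nrm_mul_of_ne K k h))
    (nrmIncl_injective K k (map_sum (nrmIncl K k N) _ _))
    (fun e => Subtype.ext (nrm_mul_nrmA K k e))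
    (fun e => Subtype.ext (nrmA_mul_nrm K k e))

theorem nrmPathHom_bElt {u v : CVert N} (e : BArrow N u v) :
    nrmIncl K k N (nrmPathHom K k N (bElt k e)) = nrmA K k e :=
  congrArg (nrmIncl K k N) (pathAlgLift_arrowElt k (V := BVert N) _ _ _ _ _ _ _ e)

theorem nrmPathHom_bOne (v : CVert N) :
    nrmIncl K k N (nrmPathHom K k N (bOne k v)) = nrm K k v :=
  congrArg (nrmIncl K k N) (pathAlgLift_vertexElt k (V := BVert N) _ _ _ _ _ _ _ v)

/-- Inner idempotents drop out, so each relation becomes an identity of configuration arrows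
multiplied by `nrm` at the source. Most identities hold before normalization; only the vanishing of
composites of two last contractions depends on it. -/
theorem nrmPathHom_rel {x y : PathAlg k (BVert N)} (h : BRel k x y) :
    nrmPathHom K k N x = nrmPathHom K k N y := by
  apply nrmIncl_injective
  have h2 : ∀ {u v x : CVert N} (e : BArrow N u v) (f : BArrow N v x),
      nrmIncl K k N (nrmPathHom K k N (bElt k f * bElt k e)) =
        cfgA K k f.toCArrow * cfgA K k e.toCArrow * nrm K k u := fun e f => by
    rw [map_mul, nrmIncl_mul, nrmPathHom_bElt, nrmPathHom_bElt, nrmA_mul_nrmA]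
  have h3 : ∀ {u v x y : CVert N} (e : BArrow N u v) (f : BArrow N v x) (g : BArrow N x y),
      nrmIncl K k N (nrmPathHom K k N (bElt k g * bElt k f * bElt k e)) =
        cfgA K k g.toCArrow * cfgA K k f.toCArrow * cfgA K k e.toCArrow * nrm K k u :=
    fun e f g => by
      rw [map_mul (nrmPathHom K k N), map_mul (nrmPathHom K k N), nrmIncl_mul, nrmIncl_mul,
        nrmPathHom_bElt, nrmPathHom_bElt,
        nrmPathHom_bElt, nrmA_mul_nrmA_mul_nrmA]
  cases h with
  | t_t p h => rw [h2, nrmPathHom_bOne]; simp only [BArrow.toCArrow, cfg_dT_dT, cfgV_mul_nrm]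
  | s_s h => rw [h2, nrmPathHom_bOne]; simp only [BArrow.toCArrow, cfg_tT_tT, cfgV_mul_nrm]
  | t_d_t p h =>
    rw [h3, nrmPathHom_bElt, nrmA]
    simp only [BArrow.toCArrow]
    rw [cfg_dT_dS, mul_assoc (cfgA K k _), cfg_dT_dT, cfgA_mul_cfgV]
  | c_d q h => rw [h2, h2]; exact congrArg (· * _) (cfg_dI_dS K k q h false _)
  | c_d_zero h => rw [h2, h2]; exact congrArg (· * _) (cfg_dIZero_dS K k h false)
  | c_t_d q h =>
    rw [h3, h3]
    simp only [BArrow.toCArrow]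
    rw [mul_assoc (cfgA K k _), cfg_dT_dS, ← mul_assoc, cfg_dI_dS]
  | c_t_d_zero h =>
    rw [h3, h3]
    simp only [BArrow.toCArrow]
    rw [mul_assoc (cfgA K k _), cfg_dT_dS, ← mul_assoc]
    exact congrArg (· * _ * _) (cfg_dIZero_dS K k h false)
  | a_b q h => rw [h2, h2]; exact congrArg (· * _) (cfg_aS_tE K k (q + 1) h _)
  | a_b_one h =>
    rw [h2, h3]
    simp only [BArrow.toCArrow]
    rw [cfg_tSZero_tT]
    exact congrArg (· * _) (cfg_aS_tE K k 0 h _)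
  | a_b_zero h =>
    rw [← mul_assoc, h3, h2]
    simp only [BArrow.toCArrow]
    rw [mul_assoc (cfgA K k _), cfg_tSZero_tT]
    exact congrArg (· * _) (cfg_aS_tSZero K k h).symm
  | b_c q h =>
    rw [mul_sub, ← mul_assoc, map_sub, map_sub, h2, h3]
    simp only [BArrow.toCArrow]
    rw [mul_assoc (cfgA K k _) (cfgA K k _) (cfgA K k _), cfg_dI_dT, cfg_tE_dI, map_zero, map_zero]
    exact sub_self _
  | b_c_one h =>
    -- Here `f s` plays the role of `b`: it forgets `extra`, after which the projections through the
    -- two injective representations agree.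
    have h4 : cfgA K k (.tSZero h) * cfgA K k (.tT h) * cfgA K k (.dI 0 h false) =
        cfgA K k (.tSZero h) * cfgA K k (.tT h) * (cfgA K k (.dI 0 h false) *
          cfgA K k (.dT 1 h)) := by
      rw [cfg_tSZero_tT, cfg_dI_dT, cfg_tE_dI]
    rw [mul_sub, map_sub, map_sub, h3, ← mul_assoc, map_mul (nrmPathHom K k N), nrmIncl_mul, h3,
      nrmPathHom_bElt, mul_assoc _ (nrm K k _), nrm_mul_nrmA, nrmA, map_zero, map_zero, sub_eq_zero]
    simp only [BArrow.toCArrow]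
    simpa only [mul_assoc] using congrArg (· * nrm K k (.D 1 h)) h4
  | b_c_zero h =>
    rw [mul_sub, ← mul_assoc, map_sub, map_sub, h2, h3]
    simp only [BArrow.toCArrow]
    rw [mul_assoc (cfgA K k _) (cfgA K k _) (cfgA K k _), cfg_dIZero_dT, map_zero, map_zero,
      sub_eq_zero]
    exact congrArg (· * _) (cfg_aS_dIZero K k h false)
  | d_d p h =>
    rw [h2]
    simp only [BArrow.toCArrow]
    rw [map_zero, map_zero, mul_assoc, ← faceD_eq, ← faceD_eq]
    exact (dSystem K k).d_last_d_last h
  | a'_a' q h =>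
    rw [h2]
    simp only [BArrow.toCArrow]
    rw [map_zero, map_zero, mul_assoc, ← faceT_eq, ← faceT_eq]
    exact (tSystem K k).d_last_d_last h
  | f_a' h =>
    rw [h2]
    simp only [BArrow.toCArrow]
    rw [map_zero, map_zero, mul_assoc, ← faceT_zero, ← faceT_eq]
    exact (tSystem K k).d_last_d_last h
  | a_a r h =>
    rw [h2]
    simp only [BArrow.toCArrow]
    rw [map_zero, map_zero, mul_assoc, ← faceA_eq, ← faceA_eq]
    exact (aSystem K k).d_last_d_last h

/-- The homomorphism from the algebra of complexes to the corner. -/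
def nrmHom (N : ℕ) : ComplexAlg k N →ₐ[k] NrmAlg K k N :=
  RingQuot.liftAlgHom k ⟨nrmPathHom K k N, fun _ _ h => nrmPathHom_rel K k h⟩

end Config

end

section

section Config

variable (K : Type w) [Field K] (k : Type u) [CommRing k] {N : ℕ}

/-! ### The normalizing idempotent is full -/

/-- What the normalizing idempotent removes from a vertex factors through lower degree, so by
induction on the degree all vertices lie in the ideal. -/
theorem one_mem_span_totalNrm :
    (1 : ConfigAlg K k N) ∈ TwoSidedIdeal.span {totalNrm K k N} := by
  set J := TwoSidedIdeal.span {totalNrm K k N} with hJ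
  have he : totalNrm K k N ∈ J := TwoSidedIdeal.subset_span rfl
  have hnrm : ∀ v : CVert N, nrm K k v ∈ J := fun v => by
    rw [← mul_totalNrm_of K k (nrm_mul_self K k v)]
    exact J.mul_mem_left _ _ he
  have hD := (dSystem (N := N) K k).ν_mem J fun p hp => hnrm (.D p hp)
  have hA := (aSystem (N := N) K k).ν_mem J fun r hr => hnrm (.A r hr)
  have hT := (tSystem (N := N) K k).ν_mem J fun q hq => by
    rcases q with _ | q
    -- Degree `0` of this system is the vertex `A 1`, already treated by the system of the `A`, or
    -- zero if `N = 0`.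
    · rcases Nat.eq_zero_or_pos N with h0 | h0
      · rw [SimplicialSystem.idem, vertT, dif_neg (by omega)]
        exact J.zero_mem
      · rw [SimplicialSystem.idem, vertT, dif_pos (Nat.succ_le_of_lt h0), ← vertA_eq]
        exact hA 1 h0
    · exact hnrm (.T q hq)
  rw [← sum_cfgV]
  refine Finset.sum_induction _ (· ∈ J) (fun _ _ => J.add_mem) J.zero_mem fun v _ => ?_
  cases v with
  | D p h => rw [← vertD_eq]; exact hD p h
  | T q h => rw [← vertT_eq]; exact hT (q + 1) h
  | A r h => rw [← vertA_eq]; exact hA r h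

theorem isMoritaEquivalent_nrmAlg (N : ℕ) :
    IsMoritaEquivalent k (ConfigAlg K k N) (NrmAlg K k N) :=
  isMoritaEquivalent_corner (isIdempotentElem_totalNrm K k) (one_mem_span_totalNrm K k)

/-! ### The homomorphism is surjective -/

theorem cfgA_mul_cfgA_of_ne {u v u' v' : CVert N} (e : CArrow N u v) (f : CArrow N u' v')
    (h : u ≠ v') : cfgA K k e * cfgA K k f = 0 := by
  rw [← cfgA_mul_cfgV, ← cfgV_mul_cfgA K k f, mul_assoc, ← mul_assoc (cfgV K k u),
    cfgV_mul_of_ne K k h, zero_mul, mul_zero]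

theorem cfgV_mul_cfgA_of_ne {u' v' u : CVert N} (f : CArrow N u' v') (h : u ≠ v') :
    cfgV K k u * cfgA K k f = 0 := by
  rw [← cfgV_mul_cfgA K k f, ← mul_assoc, cfgV_mul_of_ne K k h, zero_mul]

/-- The image of the algebra of complexes. -/
def nrmRange (N : ℕ) : Submodule k (ConfigAlg K k N) :=
  LinearMap.range (nrmIncl K k N ∘ₗ (nrmHom K k N).toLinearMap)

theorem nrmHom_mk (x : PathAlg k (BVert N)) :
    nrmHom K k N (RingQuot.mkAlgHom k _ x) = nrmPathHom K k N x :=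
  RingQuot.liftAlgHom_mkAlgHom_apply k _ _ _

theorem mul_mem_nrmRange {x y : ConfigAlg K k N} (hx : x ∈ nrmRange K k N)
    (hy : y ∈ nrmRange K k N) : x * y ∈ nrmRange K k N := by
  obtain ⟨x, rfl⟩ := hx
  obtain ⟨y, rfl⟩ := hy
  refine ⟨x * y, ?_⟩
  exact congrArg (nrmIncl K k N) (map_mul (nrmHom K k N) x y)

theorem nrm_mem_nrmRange (v : CVert N) : nrm K k v ∈ nrmRange K k N :=
  ⟨RingQuot.mkAlgHom k _ (bOne k v),
    (congrArg (nrmIncl K k N) (nrmHom_mk K k _)).trans (nrmPathHom_bOne K k v)⟩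

theorem nrmA_mem_nrmRange {u v : CVert N} (e : BArrow N u v) : nrmA K k e ∈ nrmRange K k N :=
  ⟨RingQuot.mkAlgHom k _ (bElt k e),
    (congrArg (nrmIncl K k N) (nrmHom_mk K k _)).trans (nrmPathHom_bElt K k e)⟩

theorem totalNrm_mul_nrmIncl (x : NrmAlg K k N) :
    totalNrm K k N * nrmIncl K k N x = nrmIncl K k N x :=
  congrArg (nrmIncl K k N) (one_mul x)

/-- The elements obtained from the image of the algebra of complexes by sections. -/
inductive Degenerated : ConfigAlg K k N → Prop
  | base (x) (hx : x ∈ nrmRange K k N) : Degenerated x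
  | dR (p : ℕ) (h : p + 1 ≤ N) (i : Fin p) (x) (hx : Degenerated x) :
      Degenerated (cfgA K k (.dR p h i) * x)
  | tR (q : ℕ) (h : q + 1 < N) (i : Fin (q + 1)) (x) (hx : Degenerated x) :
      Degenerated (cfgA K k (.tR q h i) * x)
  | aR (r : ℕ) (h : r + 1 ≤ N) (i : Fin r) (x) (hx : Degenerated x) :
      Degenerated (cfgA K k (.aR r h i) * x)

/-- The span of the elements obtained from the image of the algebra of complexes by sections. -/
def degSpan (N : ℕ) : Submodule k (ConfigAlg K k N) :=
  Submodule.span k {x | Degenerated K k x}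

variable {K k}

theorem mul_mem_degSpan {y : ConfigAlg K k N}
    (hy : ∀ x, Degenerated K k x → y * x ∈ degSpan K k N) {x : ConfigAlg K k N}
    (hx : x ∈ degSpan K k N) : y * x ∈ degSpan K k N := by
  have : degSpan K k N ≤ (degSpan K k N).comap (LinearMap.mulLeft k y) :=
    Submodule.span_le.2 hy
  exact this hx

theorem dR_mul_mem (p : ℕ) (h : p + 1 ≤ N) (i : Fin p) {x : ConfigAlg K k N}
    (hx : x ∈ degSpan K k N) : cfgA K k (.dR p h i) * x ∈ degSpan K k N :=
  mul_mem_degSpan (fun x hx => Submodule.subset_span (.dR p h i x hx)) hx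

theorem tR_mul_mem (q : ℕ) (h : q + 1 < N) (i : Fin (q + 1)) {x : ConfigAlg K k N}
    (hx : x ∈ degSpan K k N) : cfgA K k (.tR q h i) * x ∈ degSpan K k N :=
  mul_mem_degSpan (fun x hx => Submodule.subset_span (.tR q h i x hx)) hx

theorem aR_mul_mem (r : ℕ) (h : r + 1 ≤ N) (i : Fin r) {x : ConfigAlg K k N}
    (hx : x ∈ degSpan K k N) : cfgA K k (.aR r h i) * x ∈ degSpan K k N :=
  mul_mem_degSpan (fun x hx => Submodule.subset_span (.aR r h i x hx)) hx

variable (K k)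

theorem cfgV_mul_nrm_mem (u v : CVert N) : cfgV K k u * nrm K k v ∈ nrmRange K k N := by
  rcases eq_or_ne u v with rfl | h
  · rw [cfgV_mul_nrm]; exact nrm_mem_nrmRange K k u
  · rw [← cfgV_mul_nrm K k v, ← mul_assoc, cfgV_mul_of_ne K k h, zero_mul]
    exact Submodule.zero_mem _

/-- An arrow after a normalizing idempotent is a section or lies in the image. -/
theorem cfgA_mul_nrm_mem {u v : CVert N} (e : CArrow N u v) :
    Degenerated K k (cfgA K k e * nrm K k u) := by
  have hz : (0 : ConfigAlg K k N) ∈ nrmRange K k N := Submodule.zero_mem _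
  have hA := fun {u v : CVert N} (e : BArrow N u v) => nrmA_mem_nrmRange K k e
  cases e with
  | dS p h i =>
    refine .base _ ?_
    induction i using Fin.lastCases with
    | last => exact hA (.d p h)
    | cast i => rwa [cfg_dS_nrm]
  | dR p h i => exact .dR p h i _ (.base _ (nrm_mem_nrmRange K k _))
  | dT p h => exact .base _ (hA (.t p h))
  | dI q h b =>
    refine .base _ ?_
    cases b
    · exact hA (.c q h)
    -- The projection through the other injective representation is `c t`.
    · have := mul_mem_nrmRange K k (hA (.c q h)) (hA (.t (q + 1) h))
      rw [nrmA_mul_nrmA] at this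
      simp only [BArrow.toCArrow] at this
      rwa [cfg_dI_dT] at this
  | dIZero h b =>
    refine .base _ ?_
    cases b
    · exact hA (.cZero h)
    · have := mul_mem_nrmRange K k (hA (.cZero h)) (hA (.t 0 (Nat.zero_le N)))
      rw [nrmA_mul_nrmA] at this
      simp only [BArrow.toCArrow] at this
      rwa [cfg_dIZero_dT] at this
  | tS q h i =>
    refine .base _ ?_
    induction i using Fin.lastCases with
    | last => exact hA (.a' q h)
    | cast i => rwa [cfg_tS_nrm]
  | tSZero h => exact .base _ (hA (.f h))
  | tR q h i => exact .tR q h i _ (.base _ (nrm_mem_nrmRange K k _))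
  | tT h => exact .base _ (hA (.s h))
  | tE q h =>
    refine .base _ ?_
    cases q with
    | zero =>
      -- Forgetting `extra` on `A¹_3` is `f s`.
      have := mul_mem_nrmRange K k (hA (.f h)) (hA (.s h))
      rw [nrmA_mul_nrmA] at this
      simp only [BArrow.toCArrow] at this
      rwa [cfg_tSZero_tT] at this
    | succ q => exact hA (.b q h)
  | aS r h i =>
    refine .base _ ?_
    induction i using Fin.lastCases with
    | last => exact hA (.a r h)
    | cast i => rwa [cfg_aS_nrm]
  | aR r h i => exact .aR r h i _ (.base _ (nrm_mem_nrmRange K k _))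

theorem Degenerated.mul_right {x y : ConfigAlg K k N} (hx : Degenerated K k x)
    (hy : y ∈ nrmRange K k N) : Degenerated K k (x * y) := by
  induction hx with
  | base x hx => exact .base _ (mul_mem_nrmRange K k hx hy)
  | dR p h i x _ ih => rw [mul_assoc]; exact .dR p h i _ ih
  | tR q h i x _ ih => rw [mul_assoc]; exact .tR q h i _ ih
  | aR r h i x _ ih => rw [mul_assoc]; exact .aR r h i _ ih

/-- The total idempotent acts as the identity on the image, so it can be inserted, and only its
summand at `u` contributes. -/
theorem cfgA_mul_mem_degSpan_of_mem {u v : CVert N} (e : CArrow N u v) {x : ConfigAlg K k N}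
    (hx : x ∈ nrmRange K k N) : cfgA K k e * x ∈ degSpan K k N := by
  obtain ⟨b, rfl⟩ := hx
  change cfgA K k e * nrmIncl K k N (nrmHom K k N b) ∈ _
  rw [← totalNrm_mul_nrmIncl, ← mul_assoc, totalNrm, Finset.mul_sum, Finset.sum_mul]
  refine Submodule.sum_mem _ fun u' _ => ?_
  rcases eq_or_ne u u' with rfl | h
  · exact Submodule.subset_span ((cfgA_mul_nrm_mem K k e).mul_right K k ⟨b, rfl⟩)
  · have h0 : cfgA K k e * nrm K k u' = 0 := by
      rw [← cfgA_mul_cfgV, ← cfgV_mul_nrm K k u', mul_assoc, ← mul_assoc (cfgV K k u),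
        cfgV_mul_of_ne K k h, zero_mul, mul_zero]
    rw [h0, zero_mul]
    exact Submodule.zero_mem _

theorem cfgV_mul_mem_degSpan {x : ConfigAlg K k N} (hx : Degenerated K k x) (v : CVert N) :
    cfgV K k v * x ∈ degSpan K k N := by
  have aux : ∀ {u' v' : CVert N} (f : CArrow N u' v') (x : ConfigAlg K k N),
      Degenerated K k (cfgA K k f * x) → cfgV K k v * (cfgA K k f * x) ∈ degSpan K k N := by
    intro u' v' f x hx
    rw [← mul_assoc]
    rcases eq_or_ne v v' with rfl | h
    · rw [cfgV_mul_cfgA]; exact Submodule.subset_span hx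
    · rw [cfgV_mul_cfgA_of_ne K k f h, zero_mul]; exact Submodule.zero_mem _
  cases hx with
  | base x hx =>
    obtain ⟨b, rfl⟩ := hx
    change cfgV K k v * nrmIncl K k N (nrmHom K k N b) ∈ _
    rw [← totalNrm_mul_nrmIncl, ← mul_assoc, totalNrm, Finset.mul_sum, Finset.sum_mul]
    exact Submodule.sum_mem _ fun u' _ => Submodule.subset_span
      (.base _ (mul_mem_nrmRange K k (cfgV_mul_nrm_mem K k v u') ⟨b, rfl⟩))
  | dR p h i x hx => exact aux _ x (.dR p h i x hx)
  | tR p h i x hx => exact aux _ x (.tR p h i x hx)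
  | aR p h i x hx => exact aux _ x (.aR p h i x hx)

/-- Induction on the sections at the left: an arrow after a section cancels against it, or moves to
its right and meets an element with fewer sections, or is itself a further section. -/
theorem cfgA_mul_mem_degSpan {x : ConfigAlg K k N} (hx : Degenerated K k x) :
    ∀ {u v : CVert N} (e : CArrow N u v), cfgA K k e * x ∈ degSpan K k N := by
  have hz : (0 : ConfigAlg K k N) ∈ degSpan K k N := Submodule.zero_mem _
  induction hx with
  | base x hx => exact fun e => cfgA_mul_mem_degSpan_of_mem K k e hx
  | dR p h i x hx ih =>
    intro u v e
    rw [← mul_assoc]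
    by_cases hu : u = .D (p + 1) h
    swap
    · rwa [cfgA_mul_cfgA_of_ne K k _ _ hu, zero_mul]
    subst hu
    cases e with
    | dS _ _ j =>
      have h1 := (dSystem (N := N) K k).d_mul_s h j.isLt i.isLt
      rw [faceD_eq K k p h j, degD_eq K k p h i] at h1
      rcases h1 with h1 | ⟨q, i', j', h1⟩
      · rw [h1, vertD_eq K k p (by omega)]; exact cfgV_mul_mem_degSpan K k hx _
      · rw [h1, degD, faceD]
        split_ifs
        · rw [mul_assoc]; exact dR_mul_mem _ _ _ (ih _)
        all_goals simp
    | dR _ h' j => rw [mul_assoc]; exact Submodule.subset_span (.dR _ _ _ _ (.dR _ _ _ _ hx))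
    | dT => rw [cfg_dT_dR, mul_assoc]; exact dR_mul_mem _ _ _ (ih _)
    | dI _ _ b =>
      -- The section has an index below `p`, so `p` is positive and the commutation rule with
      -- sections applies.
      obtain ⟨p, rfl⟩ : ∃ q, p = q + 1 := ⟨p - 1, by have := i.isLt; omega⟩
      rw [cfg_dI_dR, mul_assoc]; exact tR_mul_mem _ _ _ (ih _)
  | tR q h i x hx ih =>
    intro u v e
    rw [← mul_assoc]
    by_cases hu : u = .T (q + 1) h
    swap
    · rwa [cfgA_mul_cfgA_of_ne K k _ _ hu, zero_mul]
    subst hu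
    cases e with
    | tS _ _ j =>
      have h1 := (tSystem (N := N) K k).d_mul_s (p := q + 1) h j.isLt i.isLt
      rw [faceT_eq K k q h j, degT_eq K k q h i] at h1
      rcases h1 with h1 | ⟨q', i', j', h1⟩
      · rw [h1, vertT_eq K k q (by omega)]; exact cfgV_mul_mem_degSpan K k hx _
      · rw [h1]
        rcases q' with _ | q'
        · rw [degT, zero_mul, zero_mul]; exact hz
        · rw [degT, faceT]
          split_ifs
          · rw [mul_assoc]; exact tR_mul_mem _ _ _ (ih _)
          all_goals simp
    | tR _ h' j => rw [mul_assoc]; exact Submodule.subset_span (.tR _ _ _ _ (.tR _ _ _ _ hx))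
    | tE => rw [cfg_tE_tR, mul_assoc]; exact aR_mul_mem _ _ _ (ih _)
  | aR p h i x hx ih =>
    intro u v e
    rw [← mul_assoc]
    by_cases hu : u = .A (p + 1) h
    swap
    · rwa [cfgA_mul_cfgA_of_ne K k _ _ hu, zero_mul]
    subst hu
    cases e with
    | aS _ _ j =>
      have h1 := (aSystem (N := N) K k).d_mul_s h j.isLt i.isLt
      rw [faceA_eq K k p h j, degA_eq K k p h i] at h1
      rcases h1 with h1 | ⟨q, i', j', h1⟩
      · rw [h1, vertA_eq K k p (by omega)]; exact cfgV_mul_mem_degSpan K k hx _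
      · rw [h1, degA, faceA]
        split_ifs
        · rw [mul_assoc]; exact aR_mul_mem _ _ _ (ih _)
        all_goals simp
    | aR _ h' j => rw [mul_assoc]; exact Submodule.subset_span (.aR _ _ _ _ (.aR _ _ _ _ hx))

theorem mul_totalNrm_mem_degSpan (x : ConfigAlg K k N) :
    x * totalNrm K k N ∈ degSpan K k N := by
  obtain ⟨x, rfl⟩ := RingQuot.mkAlgHom_surjective k _ x
  refine pathAlg_mul_mem k (V := CVert N) (RingQuot.mkAlgHom k (ConfigRel K k N))
    (· ∈ degSpan K k N) (fun _ _ => Submodule.add_mem _) (fun r _ => Submodule.smul_mem _ r) ?_ ?_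
    x _ ?_
  · exact fun v s hs => mul_mem_degSpan (fun x hx => cfgV_mul_mem_degSpan K k hx v) hs
  · exact fun e s hs => mul_mem_degSpan (fun x hx => cfgA_mul_mem_degSpan K k hx e) hs
  exact Submodule.subset_span (.base _ ⟨1, congrArg (nrmIncl K k N) (map_one (nrmHom K k N))⟩)

/-- The products `nrm * section` are zero, so only the terms without sections survive. -/
theorem totalNrm_mul_mem {x : ConfigAlg K k N} (hx : x ∈ degSpan K k N) :
    totalNrm K k N * x ∈ nrmRange K k N := by
  have key : ∀ {u v : CVert N} (f : CArrow N u v) (x : ConfigAlg K k N),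
      nrm K k v * cfgA K k f = 0 → totalNrm K k N * (cfgA K k f * x) ∈ nrmRange K k N := by
    intro u v f x h
    rw [← mul_assoc, totalNrm, Finset.sum_mul, Finset.sum_eq_zero, zero_mul]
    · exact Submodule.zero_mem _
    · intro v' _
      rcases eq_or_ne v' v with rfl | h'
      · exact h
      · rw [← nrm_mul_cfgV, mul_assoc, cfgV_mul_cfgA_of_ne K k f h', mul_zero]
  have : degSpan K k N ≤ (nrmRange K k N).comap (LinearMap.mulLeft k (totalNrm K k N)) := by
    refine Submodule.span_le.2 fun x hx => ?_
    cases hx with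
    | base x hx =>
      obtain ⟨b, rfl⟩ := hx
      exact ⟨b, (totalNrm_mul_nrmIncl K k _).symm⟩
    | dR p h i x hx => exact key _ x (nrm_dR K k p h i)
    | tR p h i x hx => exact key _ x (nrm_tR K k p h i)
    | aR p h i x hx => exact key _ x (nrm_aR K k p h i)
  exact this hx

/-- With `e = totalNrm`, an element `y` of the corner is `e (y e)`. Here `y e` lies in the span of
the degenerate elements, and `e` removes all terms that begin with a section. -/
theorem nrmHom_surjective (N : ℕ) : Function.Surjective (nrmHom K k N) := by
  intro y
  have h1 : totalNrm K k N * (nrmIncl K k N y * totalNrm K k N) = nrmIncl K k N y := by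
    have : nrmIncl K k N (1 * (y * 1)) = nrmIncl K k N y := by rw [one_mul, mul_one]
    exact this
  obtain ⟨b, hb⟩ := totalNrm_mul_mem K k (mul_totalNrm_mem_degSpan K k (nrmIncl K k N y))
  exact ⟨b, nrmIncl_injective K k (hb.trans h1)⟩

end Config

end

section

/-! ### The action on dimension vectors -/

/-- The effect on dimension vectors of the projection through an injective representation, if the
space at `src` is zero. -/
def iDim {p : ℕ} (b : Bool) (d : DVert p → ℕ) : TVert p → ℕ
  | .chain i => d (.mid i)
  | .extra => d (.snk (!b))
  | .sink => d (.snk false) + d (.snk true)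

section

variable {N : ℕ}

/-- The effect of the functor of an arrow on dimension vectors. -/
def CArrow.dimMap : ∀ {u v : CVert N}, CArrow N u v → (u.Verts → ℕ) → v.Verts → ℕ
  | _, _, .dS _ _ i => fun d => d ∘ DVert.mapV (Fin.succAboveOrderEmb i).toOrderHom id
  | _, _, .dR _ _ i => fun d => d ∘ DVert.mapV (Fin.predAboveOrderHom i) id
  | _, _, .dT _ _ => fun d => d ∘ DVert.mapV OrderHom.id not
  | _, _, .dI _ _ b => iDim b
  | _, _, .dIZero _ b => fun d => iDim b d ∘ AVert.foldV
  | _, _, .tS _ _ i => fun d => d ∘ TVert.mapV (Fin.succAboveOrderEmb i).toOrderHom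
  | _, _, .tSZero _ => fun d =>
      (d ∘ TVert.mapV (Fin.succAboveOrderEmb (0 : Fin 1)).toOrderHom) ∘ AVert.foldV
  | _, _, .tR _ _ i => fun d => d ∘ TVert.mapV (Fin.predAboveOrderHom i)
  | _, _, .tT _ => fun d => d ∘ TVert.swapV
  | _, _, .tE _ _ => fun d => d ∘ AVert.toTVert
  | _, _, .aS _ _ i => fun d => d ∘ AVert.mapV (Fin.succAboveOrderEmb i).toOrderHom
  | _, _, .aR _ _ i => fun d => d ∘ AVert.mapV (Fin.predAboveOrderHom i)

/-- Dimension vectors that vanish at `src`. -/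
def CVert.SrcZero : ∀ {v : CVert N}, (v.Verts → ℕ) → Prop
  | .D _ _, d => d .src = 0
  | .T _ _, _ => True
  | .A _ _, _ => True

theorem CArrow.srcZero_dimMap {u v : CVert N} (e : CArrow N u v) {d : u.Verts → ℕ}
    (hd : CVert.SrcZero d) : CVert.SrcZero (e.dimMap d) := by
  cases e with
  | dS => exact hd
  | dR => exact hd
  | dT => exact hd
  | _ => trivial

/-- If the space at `src` is zero, nothing is divided out and the result no longer depends on ranks
of maps. This is why only such dimension vectors are used. -/
theorem dimVec_iProj {K : Type w} [Field K] {p : ℕ} (b : Bool) (M : QRep K (DVert p))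
    (hM : M.dimVec .src = 0) : ((iProj K b).obj M).dimVec = iDim b M.dimVec := by
  have : Subsingleton (M.X .src) := Module.finrank_zero_iff.1 hM
  funext v
  cases v with
  | chain i =>
    have h0 : midImage M i = ⊥ := by
      rw [midImage_eq M (DVert.reach_src_mid i).some, LinearMap.range_eq_bot]
      exact Subsingleton.elim _ _
    exact ((midImage M i).quotEquivOfEqBot h0).finrank_eq
  | extra => rfl
  | sink =>
    have h0 : snkImage M = ⊥ := by
      rw [snkImage_eq M (DVert.reach_src_snk false).some (DVert.reach_src_snk true).some,
        LinearMap.range_eq_bot]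
      exact Subsingleton.elim _ _
    exact ((snkImage M).quotEquivOfEqBot h0).finrank_eq.trans (Module.finrank_prod)

theorem CArrow.dimVec_functor {K : Type w} [Field K] {u v : CVert N} (e : CArrow N u v)
    (M : QRep K u.Verts) (hM : CVert.SrcZero M.dimVec) :
    ((e.functor K).obj M).dimVec = e.dimMap M.dimVec := by
  cases e with
  | dI q h b => exact dimVec_iProj b M hM
  | dIZero h b => exact congrArg (· ∘ AVert.foldV) (dimVec_iProj b M hM)
  | _ => rfl

/-- The dimension vectors at a vertex of the configuration that vanish at `src`. -/
def DimState (v : CVert N) : Type := {d : v.Verts → ℕ // CVert.SrcZero d}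

/-- The effect of the functor of an arrow on dimension vectors that vanish at `src`. -/
def CArrow.dimState {u v : CVert N} (e : CArrow N u v) (d : DimState u) : DimState v :=
  ⟨e.dimMap d.1, e.srcZero_dimMap d.2⟩

/-- The effect of a path on dimension vectors that vanish at `src`. -/
def pathDim {u : CVert N} : ∀ {v : CVert N}, Quiver.Path u v → DimState u → DimState v
  | _, .nil => id
  | _, .cons x e => fun d => CArrow.dimState e (pathDim x d)

theorem dimVec_evalPath {K : Type w} [Field K] {u v : CVert N} (x : Quiver.Path u v)
    (M : QRep K u.Verts) (hM : CVert.SrcZero M.dimVec) :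
    ((evalPath K x).obj M).dimVec = (pathDim x ⟨M.dimVec, hM⟩).1 := by
  induction x with
  | nil => rfl
  | cons x e ih =>
    have h := CArrow.dimVec_functor (K := K) e ((evalPath K x).obj M) (by
      rw [ih]; exact (pathDim x _).2)
    exact h.trans (congrArg (CArrow.dimMap e) ih)

/-- Every dimension vector is realized by a representation with zero maps, and isomorphic functors
have isomorphic values on it. Of the isomorphisms that define the configuration algebra, nothing
else is used to show that elements are different. -/
theorem pathDim_eq_of_iso {K : Type w} [Field K] {u v : CVert N} {x y : Quiver.Path u v}
    (h : Nonempty (evalPath K x ≅ evalPath K y)) : pathDim x = pathDim y := by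
  obtain ⟨α⟩ := h
  funext d
  let M : QRep K u.Verts := { X := fun a => Fin (d.1 a) → K, map := fun _ => 0 }
  have hM : M.dimVec = d.1 := funext fun a => Module.finrank_fin_fun K
  have hM' : CVert.SrcZero M.dimVec := by rw [hM]; exact d.2
  have hd : d = ⟨M.dimVec, hM'⟩ := Subtype.ext hM.symm
  rw [hd]
  refine Subtype.ext ?_
  rw [← dimVec_evalPath x M hM', ← dimVec_evalPath y M hM']
  exact QRep.dimVec_eq_of_iso (α.app M)

variable (K : Type w) [Field K] (k : Type u) [CommRing k]

/-- The free module on all dimension vectors that vanish at `src`. -/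
abbrev DimModule (N : ℕ) : Type u := ∀ v : CVert N, DimState v →₀ k

open scoped Classical in
/-- The endomorphism of the free module given by a map of dimension vectors. -/
def dimEnd {u v : CVert N} (f : DimState u → DimState v) : Module.End k (DimModule k N) :=
  LinearMap.single k (fun v : CVert N => DimState v →₀ k) v ∘ₗ Finsupp.lmapDomain k k f ∘ₗ
    LinearMap.proj u

theorem dimEnd_mul {u v x : CVert N} (g : DimState v → DimState x) (f : DimState u → DimState v) :
    dimEnd k g * dimEnd k f = dimEnd k (g ∘ f) := by
  classical
  refine LinearMap.ext fun m => ?_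
  simp [dimEnd, Finsupp.mapDomain_comp]

theorem dimEnd_mul_of_ne {u v v' x : CVert N} (g : DimState v → DimState x)
    (f : DimState u → DimState v') (h : v ≠ v') : dimEnd k g * dimEnd k f = 0 := by
  classical
  refine LinearMap.ext fun m => ?_
  simp [dimEnd, Pi.single_eq_of_ne h]

theorem sum_dimEnd : ∑ v : CVert N, dimEnd k (id : DimState v → DimState v) = 1 := by
  classical
  refine LinearMap.ext fun m => ?_
  simp only [dimEnd, LinearMap.sum_apply, LinearMap.comp_apply, LinearMap.proj_apply,
    Finsupp.lmapDomain_apply, Finsupp.mapDomain_id, LinearMap.single_apply, Module.End.one_apply]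
  exact Finset.univ_sum_single m

/-- The action of the path algebra of the configuration on dimension vectors. -/
def pathDimHom (N : ℕ) : PathAlg k (CVert N) →ₐ[k] Module.End k (DimModule k N) :=
  pathAlgLift k (V := CVert N) (fun v => dimEnd k (id : DimState v → DimState v))
    (fun e => dimEnd k (CArrow.dimState e))
    (fun _ => dimEnd_mul k _ _) (fun _ _ h => dimEnd_mul_of_ne k _ _ h) (sum_dimEnd k)
    (fun _ => dimEnd_mul k _ _) (fun _ => dimEnd_mul k _ _)

theorem pathDimHom_pathElt {u v : CVert N} (x : Quiver.Path u v) :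
    pathDimHom k N (pathElt k x) = dimEnd k (pathDim x) := by
  induction x with
  | nil => exact pathAlgLift_vertexElt k (V := CVert N) _ _ _ _ _ _ _ u
  | cons x e ih =>
    rw [pathElt, map_mul, ih]
    refine Eq.trans ?_ (dimEnd_mul k (CArrow.dimState e) (pathDim x))
    exact congrArg (· * _) (pathAlgLift_arrowElt k (V := CVert N) _ _ _ _ _ _ _ e)

/-- The action of the algebra of the configuration on dimension vectors. -/
def dimHom (N : ℕ) : ConfigAlg K k N →ₐ[k] Module.End k (DimModule k N) :=
  RingQuot.liftAlgHom k ⟨pathDimHom k N, fun _ _ h => by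
    cases h with
    | mk x y h => rw [pathDimHom_pathElt, pathDimHom_pathElt, pathDim_eq_of_iso h]⟩

theorem dimHom_cfg {u v : CVert N} (x : Quiver.Path u v) :
    dimHom K k N (cfg K k x) = dimEnd k (pathDim x) :=
  (RingQuot.liftAlgHom_mkAlgHom_apply k _ _ _).trans (pathDimHom_pathElt k x)

theorem dimHom_cfgV (v : CVert N) :
    dimHom K k N (cfgV K k v) = dimEnd k (id : DimState v → DimState v) :=
  dimHom_cfg K k (Quiver.Path.nil : Quiver.Path v v)

theorem dimHom_cfgA {u v : CVert N} (e : CArrow N u v) :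
    dimHom K k N (cfgA K k e) = dimEnd k e.dimState := by
  rw [← cfg_one]
  exact dimHom_cfg K k (Quiver.Path.cons .nil e : Quiver.Path u v)

end

end

section

/-! ### Normal forms of paths of the second quiver -/

section Words

variable {N : ℕ}

/-- Paths of the second quiver. -/
abbrev BPath (u v : CVert N) : Type := Quiver.Path (V := BVert N) u v

/-- Normal forms of paths. Those that start at a vertex `D` contain a power of `t`. -/
inductive Word (N : ℕ) : CVert N → CVert N → Type
  | t (p : ℕ) (h : p ≤ N) (ε : Bool) : Word N (.D p h) (.D p h)
  | dt (p : ℕ) (h : p + 1 ≤ N) (ε : Bool) : Word N (.D (p + 1) h) (.D p (Nat.le_of_succ_le h))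
  | ct (q : ℕ) (h : q + 1 ≤ N) (ε : Bool) : Word N (.D (q + 1) h) (.T q h)
  | cdt (q : ℕ) (h : q + 2 ≤ N) (ε : Bool) :
      Word N (.D (q + 2) h) (.T q (Nat.le_of_succ_le h))
  | sct (h : 1 ≤ N) (ε : Bool) : Word N (.D 1 h) (.T 0 h)
  | scdt (h : 2 ≤ N) (ε : Bool) : Word N (.D 2 h) (.T 0 (Nat.le_of_succ_le h))
  | cZerot (h : 1 ≤ N) (ε : Bool) : Word N (.D 0 (Nat.zero_le N)) (.A 1 h)
  | acZero (h : 1 ≤ N) : Word N (.D 0 (Nat.zero_le N)) (.A 0 (Nat.zero_le N))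
  | cZerodt (h : 1 ≤ N) (ε : Bool) : Word N (.D 1 h) (.A 1 h)
  | fsc (h : 1 ≤ N) : Word N (.D 1 h) (.A 1 h)
  | acZerod (h : 1 ≤ N) : Word N (.D 1 h) (.A 0 (Nat.zero_le N))
  | bc (q : ℕ) (h : q + 2 ≤ N) : Word N (.D (q + 2) h) (.A (q + 2) h)
  | abc (q : ℕ) (h : q + 2 ≤ N) : Word N (.D (q + 2) h) (.A (q + 1) (Nat.le_of_succ_le h))
  | oneT (q : ℕ) (h : q < N) : Word N (.T q h) (.T q h)
  | s (h : 0 < N) : Word N (.T 0 h) (.T 0 h)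
  | a' (q : ℕ) (h : q + 1 < N) : Word N (.T (q + 1) h) (.T q (Nat.lt_of_succ_lt h))
  | sa' (h : 1 < N) : Word N (.T 1 h) (.T 0 (Nat.lt_of_succ_lt h))
  | f (h : 0 < N) : Word N (.T 0 h) (.A 1 h)
  | fs (h : 0 < N) : Word N (.T 0 h) (.A 1 h)
  | af (h : 0 < N) : Word N (.T 0 h) (.A 0 (Nat.zero_le N))
  | b (q : ℕ) (h : q + 1 < N) : Word N (.T (q + 1) h) (.A (q + 2) h)
  | ab (q : ℕ) (h : q + 1 < N) : Word N (.T (q + 1) h) (.A (q + 1) (Nat.le_of_succ_le h))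
  | oneA (r : ℕ) (h : r ≤ N) : Word N (.A r h) (.A r h)
  | a (r : ℕ) (h : r + 1 ≤ N) : Word N (.A (r + 1) h) (.A r (Nat.le_of_succ_le h))

/-- Appends an arrow. -/
def BPath.snoc {u v x : CVert N} (y : BPath u v) (e : BArrow N v x) : BPath u x :=
  Quiver.Path.cons (V := BVert N) y e

/-- The powers of `t`. -/
def tPath (p : ℕ) (h : p ≤ N) : Bool → BPath (.D p h : CVert N) (.D p h)
  | false => .nil
  | true => BPath.snoc .nil (.t p h)

/-- The path of a normal form. -/
def Word.toPath : ∀ {u v : CVert N}, Word N u v → BPath u v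
  | _, _, .t p h ε => tPath p h ε
  | _, _, .dt p h ε => (tPath _ _ ε).snoc (.d p h)
  | _, _, .ct q h ε => (tPath _ _ ε).snoc (.c q h)
  | _, _, .cdt q h ε => ((tPath _ _ ε).snoc (.d (q + 1) h)).snoc (.c q _)
  | _, _, .sct h ε => ((tPath _ _ ε).snoc (.c 0 h)).snoc (.s h)
  | _, _, .scdt h ε => (((tPath _ _ ε).snoc (.d 1 h)).snoc (.c 0 _)).snoc (.s _)
  | _, _, .cZerot h ε => (tPath _ _ ε).snoc (.cZero h)
  | _, _, .acZero h => (BPath.snoc .nil (.cZero h)).snoc (.a 0 h)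
  | _, _, .cZerodt h ε => ((tPath _ _ ε).snoc (.d 0 h)).snoc (.cZero h)
  | _, _, .fsc h => ((BPath.snoc .nil (.c 0 h)).snoc (.s h)).snoc (.f h)
  | _, _, .acZerod h => ((BPath.snoc .nil (.d 0 h)).snoc (.cZero h)).snoc (.a 0 h)
  | _, _, .bc q h => (BPath.snoc .nil (.c (q + 1) h)).snoc (.b q h)
  | _, _, .abc q h => ((BPath.snoc .nil (.c (q + 1) h)).snoc (.b q h)).snoc (.a (q + 1) h)
  | _, _, .oneT _ _ => .nil
  | _, _, .s h => BPath.snoc .nil (.s h)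
  | _, _, .a' q h => BPath.snoc .nil (.a' q h)
  | _, _, .sa' h => (BPath.snoc .nil (.a' 0 h)).snoc (.s _)
  | _, _, .f h => BPath.snoc .nil (.f h)
  | _, _, .fs h => (BPath.snoc .nil (.s h)).snoc (.f h)
  | _, _, .af h => (BPath.snoc .nil (.f h)).snoc (.a 0 h)
  | _, _, .b q h => BPath.snoc .nil (.b q h)
  | _, _, .ab q h => (BPath.snoc .nil (.b q h)).snoc (.a (q + 1) h)
  | _, _, .oneA _ _ => .nil
  | _, _, .a r h => BPath.snoc .nil (.a r h)

/-- The product of an arrow and a normal form is zero or a normal form. -/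
def BArrow.act : ∀ {u v x : CVert N}, BArrow N v x → Word N u v → Option (Word N u x)
  | _, _, _, .d p h, .t _ _ ε => some (.dt p h ε)
  | _, _, _, .d _ _, .dt _ _ _ => none
  | _, _, _, .t p h, .t _ _ ε => some (.t p h !ε)
  | _, _, _, .t _ _, .dt p h ε => some (.dt p h !ε)
  | _, _, _, .c q h, .t _ _ ε => some (.ct q h ε)
  | _, _, _, .c q _, .dt _ h ε => some (.cdt q h ε)
  | _, _, _, .cZero h, .t _ _ ε => some (.cZerot h ε)
  | _, _, _, .cZero _, .dt _ h ε => some (.cZerodt h ε)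
  | _, _, _, .a' q _, .ct _ h ε => some (.cdt q h ε)
  | _, _, _, .a' _ _, .cdt _ _ _ => none
  | _, _, _, .a' q h, .oneT _ _ => some (.a' q h)
  | _, _, _, .a' _ _, .a' _ _ => none
  | _, _, _, .f _, .ct _ h ε => some (.cZerodt h ε)
  | _, _, _, .f _, .cdt _ _ _ => none
  | _, _, _, .f _, .sct h _ => some (.fsc h)
  | _, _, _, .f _, .scdt h _ => some (.abc 0 h)
  | _, _, _, .f h, .oneT _ _ => some (.f h)
  | _, _, _, .f h, .s _ => some (.fs h)
  | _, _, _, .f _, .a' _ _ => none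
  | _, _, _, .f _, .sa' h => some (.ab 0 h)
  | _, _, _, .s _, .ct _ h ε => some (.sct h ε)
  | _, _, _, .s _, .cdt _ h ε => some (.scdt h ε)
  | _, _, _, .s _, .sct h ε => some (.ct 0 h ε)
  | _, _, _, .s _, .scdt h ε => some (.cdt 0 h ε)
  | _, _, _, .s h, .oneT _ _ => some (.s h)
  | _, _, _, .s _, .s h => some (.oneT 0 h)
  | _, _, _, .s _, .a' _ h => some (.sa' h)
  | _, _, _, .s _, .sa' h => some (.a' 0 h)
  | _, _, _, .b q _, .ct _ h _ => some (.bc q h)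
  | _, _, _, .b q _, .cdt _ h _ => some (.abc (q + 1) h)
  | _, _, _, .b q h, .oneT _ _ => some (.b q h)
  | _, _, _, .b q _, .a' _ h => some (.ab (q + 1) h)
  | _, _, _, .a _ _, .cZerot h _ => some (.acZero h)
  | _, _, _, .a _ _, .cZerodt h _ => some (.acZerod h)
  | _, _, _, .a _ _, .fsc h => some (.acZerod h)
  | _, _, _, .a _ _, .bc q h => some (.abc q h)
  | _, _, _, .a _ _, .abc _ _ => none
  | _, _, _, .a _ _, .f h => some (.af h)
  | _, _, _, .a _ _, .fs h => some (.af h)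
  | _, _, _, .a _ _, .b q h => some (.ab q h)
  | _, _, _, .a _ _, .ab _ _ => none
  | _, _, _, .a r h, .oneA _ _ => some (.a r h)
  | _, _, _, .a _ _, .a _ _ => none

end Words

end

section

/-! ### The normal forms span the algebra of complexes -/

section ComplexRelations

variable (k : Type u) [CommRing k] {N : ℕ}

/-- A vertex of the second quiver as an element of the algebra. -/
def bV (v : CVert N) : ComplexAlg k N := RingQuot.mkAlgHom k _ (bOne k v)

/-- An arrow of the second quiver as an element of the algebra. -/
def bA {u v : CVert N} (e : BArrow N u v) : ComplexAlg k N := RingQuot.mkAlgHom k _ (bElt k e)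

/-- A path of the second quiver as an element of the algebra. -/
def bPath {u v : CVert N} (x : BPath u v) : ComplexAlg k N :=
  RingQuot.mkAlgHom k _ (pathElt k (V := BVert N) x)

theorem bPath_nil (v : CVert N) :
    bPath k (Quiver.Path.nil : BPath v v) = bV k v := rfl

theorem bPath_snoc {u v x : CVert N} (y : BPath u v) (e : BArrow N v x) :
    bPath k (y.snoc e) = bA k e * bPath k y := by
  exact map_mul (RingQuot.mkAlgHom k (BRel k (N := N))) _ _

theorem bV_mul_self (v : CVert N) : bV k v * bV k v = bV k v := by
  rw [bV, ← map_mul]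
  exact congrArg _ (vertexElt_mul_self k (V := BVert N) v)

theorem bV_mul_of_ne {v v' : CVert N} (h : v ≠ v') : bV k v * bV k v' = 0 := by
  rw [bV, bV, ← map_mul]
  exact (congrArg _ (vertexElt_mul_of_ne k (V := BVert N) h)).trans (map_zero _)

theorem sum_bV : ∑ v : CVert N, bV k v = 1 := by
  simp only [bV]
  rw [← map_sum]
  exact (congrArg _ (sum_vertexElt k (V := BVert N))).trans (map_one _)

theorem bV_mul_bA {u v : CVert N} (e : BArrow N u v) : bV k v * bA k e = bA k e := by
  rw [bV, bA, ← map_mul]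
  exact congrArg _ (vertexElt_mul_arrowElt k (V := BVert N) (a := u) (b := v) e)

theorem bA_mul_bV {u v : CVert N} (e : BArrow N u v) : bA k e * bV k u = bA k e := by
  rw [bV, bA, ← map_mul]
  exact congrArg _ (arrowElt_mul_vertexElt k (V := BVert N) (a := u) (b := v) e)

theorem bV_mul_bA_mul {u v : CVert N} (e : BArrow N u v) (X : ComplexAlg k N) :
    bV k v * (bA k e * X) = bA k e * X := by rw [← mul_assoc, bV_mul_bA]

theorem bRel {x y : PathAlg k (BVert N)} (h : BRel k x y) :
    RingQuot.mkAlgHom k (BRel k (N := N)) x = RingQuot.mkAlgHom k _ y :=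
  RingQuot.mkAlgHom_rel k h

variable (X : ComplexAlg k N)

/-- The relations carry a further factor `X`, so that they rewrite inside products bracketed to the
right. -/
theorem b_t_t (p : ℕ) (h : p ≤ N) : bA k (.t p h) * (bA k (.t p h) * X) = bV k (.D p h) * X := by
  have := bRel k (.t_t p h)
  rw [map_mul] at this
  exact (mul_assoc _ _ _).symm.trans (congrArg (· * X) this)

theorem b_s_s (h : 0 < N) : bA k (.s h) * (bA k (.s h) * X) = bV k (.T 0 h) * X := by
  have := bRel k (.s_s h)
  rw [map_mul] at this
  exact (mul_assoc _ _ _).symm.trans (congrArg (· * X) this)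

/-- Multiply `t d t = d` by `t` on the left and use `t t = e`. -/
theorem b_t_d (p : ℕ) (h : p + 1 ≤ N) :
    bA k (.t p (Nat.le_of_succ_le h)) * (bA k (.d p h) * X) =
      bA k (.d p h) * (bA k (.t (p + 1) h) * X) := by
  have h1 := bRel k (.t_d_t p h)
  rw [map_mul, map_mul] at h1
  have h2 : bA k (.t p (Nat.le_of_succ_le h)) * (bA k (.d p h) * bA k (.t (p + 1) h)) =
    bA k (.d p h) := (mul_assoc _ _ _).symm.trans h1
  have h3 := b_t_t k (bA k (.d p h) * bA k (.t (p + 1) h)) p (Nat.le_of_succ_le h)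
  rw [h2, bV_mul_bA_mul] at h3
  rw [← mul_assoc, h3, mul_assoc]

theorem b_a'_c (q : ℕ) (h : q + 2 ≤ N) :
    bA k (.a' q h) * (bA k (.c (q + 1) h) * X) =
      bA k (.c q (Nat.le_of_succ_le h)) * (bA k (.d (q + 1) h) * X) := by
  have := bRel k (.c_d q h)
  rw [map_mul, map_mul] at this
  exact (mul_assoc _ _ _).symm.trans ((congrArg (· * X) this.symm).trans (mul_assoc _ _ _))

theorem b_f_c (h : 1 ≤ N) :
    bA k (.f h) * (bA k (.c 0 h) * X) = bA k (.cZero h) * (bA k (.d 0 h) * X) := by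
  have := bRel k (.c_d_zero h)
  rw [map_mul, map_mul] at this
  exact (mul_assoc _ _ _).symm.trans ((congrArg (· * X) this.symm).trans (mul_assoc _ _ _))

theorem b_b_a' (q : ℕ) (h : q + 2 < N) :
    bA k (.b q (Nat.lt_of_succ_lt h)) * (bA k (.a' (q + 1) h) * X) =
      bA k (.a (q + 2) h) * (bA k (.b (q + 1) h) * X) := by
  have := bRel k (.a_b q h)
  rw [map_mul, map_mul] at this
  exact (mul_assoc _ _ _).symm.trans ((congrArg (· * X) this.symm).trans (mul_assoc _ _ _))

theorem b_f_s_a' (h : 1 < N) :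
    bA k (.f (Nat.lt_of_succ_lt h)) * (bA k (.s (Nat.lt_of_succ_lt h)) * (bA k (.a' 0 h) * X)) =
      bA k (.a 1 h) * (bA k (.b 0 h) * X) := by
  have := bRel k (.a_b_one h)
  rw [map_mul, map_mul, map_mul] at this
  exact ((mul_assoc _ _ _).trans (mul_assoc _ _ _)).symm.trans
    ((congrArg (· * X) this.symm).trans (mul_assoc _ _ _))

theorem b_a_f_s (h : 0 < N) :
    bA k (.a 0 h) * (bA k (.f h) * (bA k (.s h) * X)) = bA k (.a 0 h) * (bA k (.f h) * X) := by
  have h1 := bRel k (.a_b_zero h)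
  rw [map_mul, map_mul, map_mul] at h1
  have h2 : bA k (.a 0 h) * (bA k (.f h) * bA k (.s h)) = bA k (.a 0 h) * bA k (.f h) := h1
  rw [← mul_assoc (bA k (.f h)), ← mul_assoc, h2, mul_assoc]

theorem b_b_c_t (q : ℕ) (h : q + 1 < N) :
    bA k (.b q h) * (bA k (.c (q + 1) h) * (bA k (.t (q + 2) h) * X)) =
      bA k (.b q h) * (bA k (.c (q + 1) h) * X) := by
  have h1 := bRel k (.b_c q h)
  rw [mul_sub, map_sub, map_mul, map_mul, map_mul, map_zero, sub_eq_zero] at h1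
  have h2 : bA k (.b q h) * bA k (.c (q + 1) h) =
    bA k (.b q h) * (bA k (.c (q + 1) h) * bA k (.t (q + 2) h)) := h1
  rw [← mul_assoc (bA k (.c (q + 1) h)), ← mul_assoc, ← h2, mul_assoc]

theorem b_f_s_c_t (h : 0 < N) :
    bA k (.f h) * (bA k (.s h) * (bA k (.c 0 h) * (bA k (.t 1 h) * X))) =
      bA k (.f h) * (bA k (.s h) * (bA k (.c 0 h) * X)) := by
  have h1 := bRel k (.b_c_one h)
  rw [mul_sub, map_sub, map_mul, map_mul, map_mul, map_mul, map_mul, map_zero, sub_eq_zero] at h1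
  have h2 : bA k (.f h) * bA k (.s h) * bA k (.c 0 h) =
    bA k (.f h) * bA k (.s h) * (bA k (.c 0 h) * bA k (.t 1 h)) := h1
  have h3 := congrArg (· * X) h2
  simp only [mul_assoc] at h3
  exact h3.symm

theorem b_a_cZero_t (h : 1 ≤ N) :
    bA k (.a 0 h) * (bA k (.cZero h) * (bA k (.t 0 (Nat.zero_le N)) * X)) =
      bA k (.a 0 h) * (bA k (.cZero h) * X) := by
  have h1 := bRel k (.b_c_zero h)
  rw [mul_sub, map_sub, map_mul, map_mul, map_mul, map_zero, sub_eq_zero] at h1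
  have h2 : bA k (.a 0 h) * bA k (.cZero h) =
    bA k (.a 0 h) * (bA k (.cZero h) * bA k (.t 0 (Nat.zero_le N))) := h1
  rw [← mul_assoc (bA k (.cZero h)), ← mul_assoc, ← h2, mul_assoc]

theorem b_d_d (p : ℕ) (h : p + 2 ≤ N) :
    bA k (.d p (Nat.le_of_succ_le h)) * (bA k (.d (p + 1) h) * X) = 0 := by
  have := bRel k (.d_d p h)
  rw [map_mul, map_zero] at this
  exact (mul_assoc _ _ _).symm.trans ((congrArg (· * X) this).trans (zero_mul X))

theorem b_a'_a' (q : ℕ) (h : q + 2 < N) :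
    bA k (.a' q (Nat.lt_of_succ_lt h)) * (bA k (.a' (q + 1) h) * X) = 0 := by
  have := bRel k (.a'_a' q h)
  rw [map_mul, map_zero] at this
  exact (mul_assoc _ _ _).symm.trans ((congrArg (· * X) this).trans (zero_mul X))

theorem b_f_a' (h : 1 < N) :
    bA k (.f (Nat.lt_of_succ_lt h)) * (bA k (.a' 0 h) * X) = 0 := by
  have := bRel k (.f_a' h)
  rw [map_mul, map_zero] at this
  exact (mul_assoc _ _ _).symm.trans ((congrArg (· * X) this).trans (zero_mul X))

theorem b_a_a (r : ℕ) (h : r + 2 ≤ N) :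
    bA k (.a r (Nat.le_of_succ_le h)) * (bA k (.a (r + 1) h) * X) = 0 := by
  have := bRel k (.a_a r h)
  rw [map_mul, map_zero] at this
  exact (mul_assoc _ _ _).symm.trans ((congrArg (· * X) this).trans (zero_mul X))

/-- The relations `c d = a' c` and `a b = b a'` overlap in `b a' c`; the normal form chosen for it
is `a b c`. -/
theorem b_b_c_d (q : ℕ) (h : q + 2 < N) :
    bA k (.b q (Nat.lt_of_succ_lt h)) * (bA k (.c (q + 1) (Nat.lt_of_succ_lt h)) *
      (bA k (.d (q + 2) h) * X)) =
      bA k (.a (q + 2) h) * (bA k (.b (q + 1) h) * (bA k (.c (q + 2) h) * X)) := by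
  rw [← b_b_a', b_a'_c]

theorem b_f_s_c_d (h : 1 < N) :
    bA k (.f (Nat.lt_of_succ_lt h)) * (bA k (.s (Nat.lt_of_succ_lt h)) *
      (bA k (.c 0 (Nat.lt_of_succ_lt h)) * (bA k (.d 1 h) * X))) =
      bA k (.a 1 h) * (bA k (.b 0 h) * (bA k (.c 1 h) * X)) := by
  rw [← b_f_s_a', b_a'_c]

/-- The loop passes `d` and is then absorbed. -/
theorem b_a_cZero_d_t (h : 1 ≤ N) :
    bA k (.a 0 h) * (bA k (.cZero h) * (bA k (.d 0 h) * (bA k (.t 1 h) * X))) =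
      bA k (.a 0 h) * (bA k (.cZero h) * (bA k (.d 0 h) * X)) := by
  rw [← b_t_d, b_a_cZero_t]

/-- A normal form as an element of the algebra. -/
def Word.elt {u v : CVert N} (w : Word N u v) : ComplexAlg k N := bPath k w.toPath

theorem b_t_tPath (p : ℕ) (h : p ≤ N) (ε : Bool) :
    bA k (.t p h) * bPath k (tPath p h ε) = bPath k (tPath p h !ε) := by
  cases ε
  · exact (bPath_snoc k _ _).symm
  · rw [tPath, bPath_snoc, b_t_t]
    exact bV_mul_self k _

theorem b_b_c_tPath (q : ℕ) (h : q + 1 < N) (ε : Bool) :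
    bA k (.b q h) * (bA k (.c (q + 1) h) * bPath k (tPath (q + 2) h ε)) =
      bA k (.b q h) * (bA k (.c (q + 1) h) * bV k (.D (q + 2) h)) := by
  cases ε
  · rfl
  · rw [tPath, bPath_snoc, b_b_c_t, bPath_nil]

theorem b_f_s_c_tPath (h : 0 < N) (ε : Bool) :
    bA k (.f h) * (bA k (.s h) * (bA k (.c 0 h) * bPath k (tPath 1 h ε))) =
      bA k (.f h) * (bA k (.s h) * (bA k (.c 0 h) * bV k (.D 1 h))) := by
  cases ε
  · rfl
  · rw [tPath, bPath_snoc, b_f_s_c_t, bPath_nil]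

theorem b_a_cZero_tPath (h : 1 ≤ N) (ε : Bool) :
    bA k (.a 0 h) * (bA k (.cZero h) * bPath k (tPath 0 (Nat.zero_le N) ε)) =
      bA k (.a 0 h) * (bA k (.cZero h) * bV k (.D 0 (Nat.zero_le N))) := by
  cases ε
  · rfl
  · rw [tPath, bPath_snoc, b_a_cZero_t, bPath_nil]

theorem b_a_cZero_d_tPath (h : 1 ≤ N) (ε : Bool) :
    bA k (.a 0 h) * (bA k (.cZero h) * (bA k (.d 0 h) * bPath k (tPath 1 h ε))) =
      bA k (.a 0 h) * (bA k (.cZero h) * (bA k (.d 0 h) * bV k (.D 1 h))) := by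
  cases ε
  · rfl
  · rw [tPath, bPath_snoc, b_a_cZero_d_t, bPath_nil]

/-- The rules above rewrite each composable product to its entry in the table `BArrow.act`. -/
theorem bA_mul_elt {u v x : CVert N} (e : BArrow N v x) (w : Word N u v) :
    bA k e * w.elt k = (e.act w).elim 0 (Word.elt k) := by
  cases e <;> cases w <;>
    simp only [BArrow.act, Word.elt, Word.toPath, bPath_snoc, bPath_nil, Option.elim_some,
      Option.elim_none, b_t_tPath, b_s_s, b_t_d, b_a'_c, b_f_c, b_b_a', b_f_s_a', b_a_f_s,
      b_b_c_tPath, b_a_cZero_tPath, b_d_d, b_a'_a', b_f_a', b_a_a, b_b_c_d,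
      b_f_s_c_d, bV_mul_bA_mul, bV_mul_self, mul_zero]
  · exact b_f_s_c_tPath k _ _
  · exact b_a_cZero_d_tPath k _ _

/-- The linear map that takes the basis to the normal forms. -/
def wordSum (N : ℕ) : ((Σ u v : CVert N, Word N u v) →₀ k) →ₗ[k] ComplexAlg k N :=
  Finsupp.linearCombination k fun w => w.2.2.elt k

variable {k} in
theorem mul_mem_range_wordSum {y : ComplexAlg k N}
    (h : ∀ {u v : CVert N} (w : Word N u v), y * w.elt k ∈ LinearMap.range (wordSum k N))
    {x : ComplexAlg k N} (hx : x ∈ LinearMap.range (wordSum k N)) :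
    y * x ∈ LinearMap.range (wordSum k N) := by
  obtain ⟨c, rfl⟩ := hx
  rw [wordSum, Finsupp.linearCombination_apply, Finsupp.sum, Finset.mul_sum]
  refine Submodule.sum_mem _ fun w _ => ?_
  rw [mul_smul_comm]
  exact Submodule.smul_mem _ _ (h w.2.2)

theorem elt_mem_range_wordSum {u v : CVert N} (w : Word N u v) :
    w.elt k ∈ LinearMap.range (wordSum k N) :=
  ⟨Finsupp.single ⟨u, v, w⟩ 1, by rw [wordSum, Finsupp.linearCombination_single, one_smul]⟩

theorem bV_mul_elt {u v : CVert N} (w : Word N u v) : bV k v * w.elt k = w.elt k := by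
  have := vertexElt_mul_pathElt k (V := BVert N) w.toPath
  exact (map_mul _ _ _).symm.trans (congrArg (RingQuot.mkAlgHom k (BRel k (N := N))) this)

theorem bV_mul_mem_range_wordSum (v : CVert N) {x : ComplexAlg k N}
    (hx : x ∈ LinearMap.range (wordSum k N)) : bV k v * x ∈ LinearMap.range (wordSum k N) := by
  refine mul_mem_range_wordSum (fun {u v'} w => ?_) hx
  rw [← bV_mul_elt, ← mul_assoc]
  rcases eq_or_ne v v' with rfl | h
  · rw [bV_mul_self, bV_mul_elt]; exact elt_mem_range_wordSum k w
  · rw [bV_mul_of_ne k h, zero_mul]; exact Submodule.zero_mem _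

theorem bA_mul_mem_range_wordSum {a b : CVert N} (e : BArrow N a b) {x : ComplexAlg k N}
    (hx : x ∈ LinearMap.range (wordSum k N)) : bA k e * x ∈ LinearMap.range (wordSum k N) := by
  refine mul_mem_range_wordSum (fun {u v} w => ?_) hx
  by_cases h : a = v
  · subst h
    rw [bA_mul_elt]
    rcases BArrow.act e w with _ | w'
    · exact Submodule.zero_mem _
    · exact elt_mem_range_wordSum k w'
  · rw [← bA_mul_bV, ← bV_mul_elt, mul_assoc, ← mul_assoc (bV k a), bV_mul_of_ne k h, zero_mul,
      mul_zero]
    exact Submodule.zero_mem _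

/-- The span contains `1`, as the sum of the trivial normal forms, and is stable under left
multiplication by vertices and arrows. -/
theorem wordSum_surjective (N : ℕ) : Function.Surjective (wordSum k N) := by
  intro x
  obtain ⟨x, rfl⟩ := RingQuot.mkAlgHom_surjective k _ x
  have key := pathAlg_mul_mem k (V := BVert N) (RingQuot.mkAlgHom k (BRel k (N := N)))
    (· ∈ LinearMap.range (wordSum k N)) (fun _ _ => Submodule.add_mem _)
    (fun r _ => Submodule.smul_mem _ r) ?_ ?_ x 1 ?_
  · rwa [mul_one] at key
  · exact fun v s hs => bV_mul_mem_range_wordSum k v hs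
  · exact fun e s hs => bA_mul_mem_range_wordSum k e hs
  · rw [← sum_bV]
    refine Submodule.sum_mem _ fun v _ => ?_
    cases v with
    | D p h => exact elt_mem_range_wordSum k (.t p h false)
    | T q h => exact elt_mem_range_wordSum k (.oneT q h)
    | A r h => exact elt_mem_range_wordSum k (.oneA r h)

end ComplexRelations

end

section

/-! ### Generic dimension vectors -/

section Generic

variable {N : ℕ}

/-- The path of the configuration that represents a path of the second quiver. -/
def BPath.toCPath {u : CVert N} :
    ∀ {v : CVert N}, BPath u v → Quiver.Path (V := CVert N) u v
  | _, .nil => .nil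
  | _, .cons x e => .cons (BPath.toCPath x) (BArrow.toCArrow e)

/-- The effect of a normal form on dimension vectors. -/
def Word.dim {u v : CVert N} (w : Word N u v) : DimState u → DimState v := pathDim w.toPath.toCPath

/-- A dimension vector whose entries at the relevant vertices are different. -/
def genericDim : ∀ v : CVert N, DimState v
  | .D p _ => ⟨fun x => match x with
      | .src => 0
      | .mid i => i.val
      | .snk b => p + b.toNat, rfl⟩
  | .T q _ => ⟨fun x => match x with
      | .chain i => i.val
      | .extra => q + 1
      | .sink => 0, trivial⟩
  | .A _ _ => ⟨fun x => match x with
      | .chain i => i.val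
      | .sink => 0, trivial⟩

/-- The vertices at which the functors only rearrange the spaces. -/
def CVert.Proper : ∀ {v : CVert N}, v.Verts → Prop
  | .D _ _, .src => False
  | .D _ _, .mid _ => True
  | .D _ _, .snk _ => True
  | .T _ _, .chain _ => True
  | .T _ _, .extra => True
  | .T _ _, .sink => False
  | .A _ _, .chain _ => True
  | .A _ _, .sink => False

/-- The number of vertices on the chain. -/
def CVert.len : CVert N → ℕ
  | .D p _ => p
  | .T q _ => q + 1
  | .A r _ => r

/-- The numbers `i` with `i + 1 < l` are entries at proper vertices. -/
def Covers (l : ℕ) {v : CVert N} (d : DimState v) : Prop :=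
  ∀ i, i + 1 < l → ∃ x : v.Verts, CVert.Proper x ∧ d.1 x = i

/-- Sums of spaces arise only at the sinks of the `T` and `A`. At proper vertices the functors
merely copy a space, and they copy it from a proper vertex. -/
theorem CArrow.exists_proper {u v : CVert N} (e : CArrow N u v) (x : v.Verts)
    (hx : CVert.Proper x) :
    ∃ y : u.Verts, CVert.Proper y ∧ ∀ d : DimState u, (e.dimState d).1 x = d.1 y := by
  cases e with
  | dS p h i =>
    rcases x with _ | j | b
    · exact hx.elim
    · exact ⟨.mid (i.succAbove j), trivial, fun d => rfl⟩
    · exact ⟨.snk b, trivial, fun d => rfl⟩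
  | dR p h i =>
    rcases x with _ | j | b
    · exact hx.elim
    · exact ⟨.mid (Fin.predAbove i j), trivial, fun d => rfl⟩
    · exact ⟨.snk b, trivial, fun d => rfl⟩
  | dT p h =>
    rcases x with _ | j | b
    · exact hx.elim
    · exact ⟨.mid j, trivial, fun d => rfl⟩
    · exact ⟨.snk (!b), trivial, fun d => rfl⟩
  | dI q h b =>
    rcases x with j | _ | _
    · exact ⟨.mid j, trivial, fun d => rfl⟩
    · exact ⟨.snk (!b), trivial, fun d => rfl⟩
    · exact hx.elim
  | dIZero h b =>
    rcases x with j | _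
    · exact ⟨.snk (!b), trivial, fun d => rfl⟩
    · exact hx.elim
  | tS q h i =>
    rcases x with j | _ | _
    · exact ⟨.chain (i.succAbove j), trivial, fun d => rfl⟩
    · exact ⟨.extra, trivial, fun d => rfl⟩
    · exact hx.elim
  | tSZero h =>
    rcases x with j | _
    · exact ⟨.extra, trivial, fun d => rfl⟩
    · exact hx.elim
  | tR q h i =>
    rcases x with j | _ | _
    · exact ⟨.chain (Fin.predAbove i j), trivial, fun d => rfl⟩
    · exact ⟨.extra, trivial, fun d => rfl⟩
    · exact hx.elim
  | tT h =>
    rcases x with j | _ | _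
    · exact ⟨.extra, trivial, fun d => rfl⟩
    · exact ⟨.chain 0, trivial, fun d => rfl⟩
    · exact hx.elim
  | tE q h =>
    rcases x with j | _
    · exact ⟨.chain j, trivial, fun d => rfl⟩
    · exact hx.elim
  | aS r h i =>
    rcases x with j | _
    · exact ⟨.chain (i.succAbove j), trivial, fun d => rfl⟩
    · exact hx.elim
  | aR r h i =>
    rcases x with j | _
    · exact ⟨.chain (Fin.predAbove i j), trivial, fun d => rfl⟩
    · exact hx.elim

/-- Functors can lose entries at proper vertices but cannot create new ones. -/
theorem Covers.of_dimState {l : ℕ} {u v : CVert N} {e : CArrow N u v} {d : DimState u}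
    (h : Covers l (e.dimState d)) : Covers l d := by
  intro i hi
  obtain ⟨x, hx, rfl⟩ := h i hi
  obtain ⟨y, hy, hd⟩ := e.exists_proper x hx
  exact ⟨y, hy, (hd d).symm⟩

/-- Of the entries on the chain a normal form drops at most the last one, and `Covers l` asks only
for indices up to `l - 2`. -/
theorem Word.covers {u v : CVert N} (w : Word N u v) : Covers u.len (w.dim (genericDim u)) := by
  intro i hi
  cases w with
  | t p h ε => cases ε <;> exact ⟨.mid ⟨i, Nat.lt_of_succ_lt hi⟩, trivial, rfl⟩
  | dt p h ε =>
    cases ε <;> exact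
      ⟨.mid ⟨i, Nat.lt_of_succ_lt_succ hi⟩, trivial, congrArg Fin.val (Fin.succAbove_last_apply _)⟩
  | ct q h ε => cases ε <;> exact ⟨.chain ⟨i, Nat.lt_of_succ_lt hi⟩, trivial, rfl⟩
  | cdt q h ε =>
    cases ε <;> exact
      ⟨.chain ⟨i, Nat.lt_of_succ_lt_succ hi⟩, trivial, congrArg Fin.val (Fin.succAbove_last_apply _)⟩
  | scdt h ε =>
    obtain rfl : i = 0 := Nat.lt_one_iff.1 (Nat.lt_of_succ_lt_succ hi)
    cases ε <;> exact ⟨.extra, trivial, rfl⟩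
  | bc q h => exact ⟨.chain ⟨i, Nat.lt_of_succ_lt hi⟩, trivial, rfl⟩
  | abc q h => exact
      ⟨.chain ⟨i, Nat.lt_of_succ_lt_succ hi⟩, trivial, congrArg Fin.val (Fin.succAbove_last_apply _)⟩
  | oneT q h => exact ⟨.chain ⟨i, Nat.lt_of_succ_lt hi⟩, trivial, rfl⟩
  | a' q h => exact
      ⟨.chain ⟨i, Nat.lt_of_succ_lt_succ hi⟩, trivial, congrArg Fin.val (Fin.succAbove_last_apply _)⟩
  | sa' h =>
    obtain rfl : i = 0 := Nat.lt_one_iff.1 (Nat.lt_of_succ_lt_succ hi)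
    exact ⟨.extra, trivial, rfl⟩
  | b q h => exact ⟨.chain ⟨i, Nat.lt_of_succ_lt hi⟩, trivial, rfl⟩
  | ab q h => exact
      ⟨.chain ⟨i, Nat.lt_of_succ_lt_succ hi⟩, trivial, congrArg Fin.val (Fin.succAbove_last_apply _)⟩
  | oneA r h => exact ⟨.chain ⟨i, Nat.lt_of_succ_lt hi⟩, trivial, rfl⟩
  | a r h => exact
      ⟨.chain ⟨i, Nat.lt_of_succ_lt_succ hi⟩, trivial, congrArg Fin.val (Fin.succAbove_last_apply _)⟩
  | _ => simp [CVert.len] at hi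

/-- The generic vector has different entries at different proper vertices, so the entry at `snk
false`, `extra` or `chain 0` of the target tells normal forms with the same ends apart. -/
theorem Word.dim_generic_injective {u v : CVert N} {w w' : Word N u v}
    (h : w.dim (genericDim u) = w'.dim (genericDim u)) : w = w' := by
  have h' : ∀ x, (w.dim (genericDim u)).1 x = (w'.dim (genericDim u)).1 x := fun x =>
    congrFun (congrArg Subtype.val h) x
  clear h
  cases w <;> cases w' <;> try rfl
  all_goals
    try rename Bool => ε
    (try cases ε) <;> (try rename Bool => ε) <;> (try cases ε) <;>
    first
      | rfl
      | exact absurd (h' (.snk false)) (Nat.succ_ne_self _)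
      | exact absurd (h' (.snk false)) (Nat.succ_ne_self _).symm
      | exact absurd (h' .extra) (Nat.succ_ne_self _)
      | exact absurd (h' .extra) (Nat.succ_ne_self _).symm
      | exact absurd (h' (.chain 0)) (Nat.succ_ne_self _)
      | exact absurd (h' (.chain 0)) (Nat.succ_ne_self _).symm
      | exact absurd (h' (.chain 0)) (Nat.succ_ne_zero _)
      | exact absurd (h' (.chain 0)) (Nat.succ_ne_zero _).symm

/-- The contraction removes the only proper entry equal to `i`, and this index is required because
the last contraction is excluded. -/
theorem not_covers_dS (p : ℕ) (h : p + 1 ≤ N) (i : Fin p) :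
    ¬ Covers (p + 1) ((CArrow.dS p h i.castSucc).dimState (genericDim (.D (p + 1) h))) := by
  intro H
  obtain ⟨x, hx, hi⟩ := H i.val (by omega)
  rcases x with _ | j | b
  · exact hx
  · have h1 : (Fin.succAbove i.castSucc j).val = i.val := hi
    exact Fin.succAbove_ne i.castSucc j (Fin.ext h1)
  · have h1 : p + 1 + b.toNat = i.val := hi
    omega

theorem not_covers_tS (q : ℕ) (h : q + 1 < N) (i : Fin (q + 1)) :
    ¬ Covers (q + 2) ((CArrow.tS q h i.castSucc).dimState (genericDim (.T (q + 1) h))) := by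
  intro H
  obtain ⟨x, hx, hi⟩ := H i.val (by omega)
  rcases x with j | _ | _
  · have h1 : (Fin.succAbove i.castSucc j).val = i.val := hi
    exact Fin.succAbove_ne i.castSucc j (Fin.ext h1)
  · have h1 : q + 1 + 1 = i.val := hi
    omega
  · exact hx

theorem not_covers_aS (r : ℕ) (h : r + 1 ≤ N) (i : Fin r) :
    ¬ Covers (r + 1) ((CArrow.aS r h i.castSucc).dimState (genericDim (.A (r + 1) h))) := by
  intro H
  obtain ⟨x, hx, hi⟩ := H i.val (by omega)
  rcases x with j | _
  · have h1 : (Fin.succAbove i.castSucc j).val = i.val := hi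
    exact Fin.succAbove_ne i.castSucc j (Fin.ext h1)
  · exact hx

end Generic

end

section

/-! ### The normal forms are linearly independent -/

/-- Expanding the product, each term other than the leading one ends on the right with a face that
is not the last, and `I` is a left ideal. -/
theorem SimplicialSystem.idem_sub_mem {A : Type*} [Ring A] {L : ℕ} {ν : ℕ → A} {d s : ℕ → ℕ → A}
    (S : SimplicialSystem L ν d s) (I : Ideal A) {p : ℕ}
    (h : ∀ i q, p = q + 1 → i < q → d q i ∈ I) : idem ν d s p - ν p ∈ I := by
  cases p with
  | zero => rw [idem, sub_self]; exact I.zero_mem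
  | succ p =>
    have key : ∀ j ≤ p, partialIdem ν d s p j - ν (p + 1) ∈ I := by
      intro j hj
      induction j with
      | zero => rw [partialIdem, sub_self]; exact I.zero_mem
      | succ j ih =>
        have h1 : partialIdem ν d s p (j + 1) - ν (p + 1) =
            (ν (p + 1) - s p j * d p j) * (partialIdem ν d s p j - ν (p + 1)) -
              s p j * d p j := by
          rw [partialIdem, mul_sub, sub_mul _ _ (ν (p + 1)), S.ν_ν, mul_assoc (s p j) _ (ν (p + 1)),
            S.d_ν]
          abel
        rw [h1]
        exact I.sub_mem (I.mul_mem_left _ (ih (Nat.le_of_succ_le hj)))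
          (I.mul_mem_left _ (h j p rfl hj))
    exact key p le_rfl

section Independence

variable (K : Type w) [Field K] (k : Type u) [CommRing k] {N : ℕ}

theorem cfg_mul_cfgV {u v : CVert N} (x : Quiver.Path u v) :
    cfg K k x * cfgV K k u = cfg K k x := by
  rw [cfg, cfgV, ← map_mul, pathElt_mul_vertexElt]

theorem nrmIncl_nrmHom_bV (v : CVert N) :
    nrmIncl K k N (nrmHom K k N (bV k v)) = nrm K k v :=
  (congrArg (nrmIncl K k N) (nrmHom_mk K k _)).trans (nrmPathHom_bOne K k v)

theorem nrmIncl_nrmHom_bA {u v : CVert N} (e : BArrow N u v) :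
    nrmIncl K k N (nrmHom K k N (bA k e)) = nrmA K k e :=
  (congrArg (nrmIncl K k N) (nrmHom_mk K k _)).trans (nrmPathHom_bElt K k e)

theorem nrm_mul_cfg_mul_nrm {u v : CVert N} (x : BPath u v) :
    nrm K k v * (cfg K k x.toCPath * nrm K k u) = cfg K k x.toCPath * nrm K k u := by
  induction x with
  | nil =>
    exact (congrArg (nrm K k u * ·) (cfgV_mul_nrm K k u)).trans
      ((nrm_mul_self K k u).trans (cfgV_mul_nrm K k u).symm)
  | @cons v z x e ih =>
    have h : cfgA K k (BArrow.toCArrow e) * cfg K k (BPath.toCPath x) * nrm K k u =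
        nrmA K k e * (cfg K k (BPath.toCPath x) * nrm K k u) := by
      rw [nrmA, mul_assoc, mul_assoc, ih]
    have h' : nrm K k z * (cfgA K k (BArrow.toCArrow e) * cfg K k (BPath.toCPath x) * nrm K k u) =
        cfgA K k (BArrow.toCArrow e) * cfg K k (BPath.toCPath x) * nrm K k u := by
      rw [h, ← mul_assoc, nrm_mul_nrmA]
    rw [← cfg_cons] at h'
    exact h'

/-- The idempotents along the path drop out; only the one at its start remains. -/
theorem nrmIncl_nrmHom_bPath {u v : CVert N} (x : BPath u v) :
    nrmIncl K k N (nrmHom K k N (bPath k x)) = cfg K k x.toCPath * nrm K k u := by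
  induction x with
  | nil => exact (nrmIncl_nrmHom_bV K k u).trans (cfgV_mul_nrm K k u).symm
  | @cons v z x e ih =>
    have h : nrmIncl K k N (nrmHom K k N (bA k e * bPath k x)) =
        cfgA K k (BArrow.toCArrow e) * cfg K k (BPath.toCPath x) * nrm K k u := by
      have h1 := nrm_mul_cfg_mul_nrm K k x
      rw [map_mul, nrmIncl_mul, nrmIncl_nrmHom_bA, ih, nrmA, mul_assoc, h1, mul_assoc]
    rw [← cfg_cons] at h
    exact (congrArg (fun y => nrmIncl K k N (nrmHom K k N y)) (bPath_snoc k x e)).trans h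

/-- The elements whose coefficients vanish at the dimension vectors that cover `l`. -/
def uncovered (N l : ℕ) : Submodule k (DimModule k N) where
  carrier := {m | ∀ (v : CVert N) (d : DimState v), Covers l d → m v d = 0}
  add_mem' hm hm' v d hd := by
    rw [Pi.add_apply, Finsupp.add_apply, hm v d hd, hm' v d hd, add_zero]
  zero_mem' _ _ _ := rfl
  smul_mem' r m hm v d hd := by
    rw [Pi.smul_apply, Finsupp.smul_apply, hm v d hd, smul_zero]

variable {k} in
theorem dimEnd_mem_uncovered {l : ℕ} {u v : CVert N} {f : DimState u → DimState v}
    (hf : ∀ d, Covers l (f d) → Covers l d) {m : DimModule k N} (hm : m ∈ uncovered k N l) :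
    dimEnd k f m ∈ uncovered k N l := by
  classical
  intro x d hd
  simp only [dimEnd, LinearMap.comp_apply, LinearMap.proj_apply, LinearMap.single_apply,
    Finsupp.lmapDomain_apply]
  rcases eq_or_ne x v with rfl | hx
  · rw [Pi.single_eq_same]
    by_contra h
    obtain ⟨d', h1, rfl⟩ := Finset.mem_image.1
      (Finsupp.mapDomain_support (Finsupp.mem_support_iff.2 h))
    exact Finsupp.mem_support_iff.1 h1 (hm u d' (hf d' hd))
  · rw [Pi.single_eq_of_ne hx, Finsupp.zero_apply]

/-- No arrow creates required entries, so the action of the whole algebra preserves the uncovered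
part. For this reason `uncoveredIdeal` is a left ideal. -/
theorem dimHom_mem_uncovered {l : ℕ} (a : ConfigAlg K k N) {m : DimModule k N}
    (hm : m ∈ uncovered k N l) : dimHom K k N a m ∈ uncovered k N l := by
  obtain ⟨x, rfl⟩ := RingQuot.mkAlgHom_surjective k _ a
  have := pathAlg_mul_mem k (V := CVert N)
    ((dimHom K k N).comp (RingQuot.mkAlgHom k (ConfigRel K k N)))
    (fun s : Module.End k (DimModule k N) => s m ∈ uncovered k N l) (fun _ _ => Submodule.add_mem _)
    (fun r _ => Submodule.smul_mem _ r) ?_ ?_ x 1 hm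
  · rwa [mul_one] at this
  · intro v s hs
    have h := dimEnd_mem_uncovered (fun _ => id) hs (f := (id : DimState v → DimState v))
    rwa [← dimHom_cfgV K k v] at h
  · intro a b e s hs
    have h := dimEnd_mem_uncovered (fun _ => Covers.of_dimState) hs (f := CArrow.dimState e)
    rwa [← dimHom_cfgA K k e] at h

open scoped Classical in
/-- The basis element of a dimension vector. -/
def dimSingle {u : CVert N} (d : DimState u) : DimModule k N :=
  Pi.single u (Finsupp.single d 1)

theorem dimEnd_dimSingle {u v : CVert N} (f : DimState u → DimState v) (d : DimState u) :
    dimEnd k f (dimSingle k d) = dimSingle k (f d) := by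
  classical
  simp [dimEnd, dimSingle, Finsupp.mapDomain_single]

theorem dimEnd_dimSingle_of_ne {u u' v : CVert N} (f : DimState u' → DimState v) (d : DimState u)
    (h : u' ≠ u) : dimEnd k f (dimSingle k d) = 0 := by
  classical
  simp [dimEnd, dimSingle, Pi.single_eq_of_ne h]

theorem dimSingle_mem_uncovered {l : ℕ} {u : CVert N} {d : DimState u} (hd : ¬ Covers l d) :
    dimSingle k d ∈ uncovered k N l := by
  classical
  intro v d' hd'
  rcases eq_or_ne v u with rfl | h
  · rw [dimSingle, Pi.single_eq_same, Finsupp.single_eq_of_ne]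
    rintro rfl
    exact hd hd'
  · rw [dimSingle, Pi.single_eq_of_ne h, Finsupp.zero_apply]

/-- The left ideal of the elements that map the generic dimension vector to dimension vectors with
too few different entries. -/
def uncoveredIdeal (u : CVert N) : Ideal (ConfigAlg K k N) where
  carrier := {a | dimHom K k N a (dimSingle k (genericDim u)) ∈ uncovered k N u.len}
  add_mem' {a b} ha hb := by
    change dimHom K k N (a + b) _ ∈ uncovered k N u.len
    rw [map_add]
    exact Submodule.add_mem _ ha hb
  zero_mem' := by
    change dimHom K k N 0 _ ∈ uncovered k N u.len
    rw [map_zero]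
    exact Submodule.zero_mem _
  smul_mem' a b hb := by
    change dimHom K k N (a * b) _ ∈ uncovered k N u.len
    rw [map_mul]
    exact dimHom_mem_uncovered K k a hb

theorem cfgA_mem_uncoveredIdeal {u v : CVert N} {e : CArrow N u v}
    (h : ¬ Covers u.len (e.dimState (genericDim u))) : cfgA K k e ∈ uncoveredIdeal K k u := by
  change dimHom K k N (cfgA K k e) _ ∈ uncovered k N u.len
  rw [dimHom_cfgA, dimEnd_dimSingle]
  exact dimSingle_mem_uncovered k h

/-- All correction terms of the idempotent first apply a contraction that loses a required entry of
the generic vector. -/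
theorem nrm_sub_mem_uncoveredIdeal (u : CVert N) :
    nrm K k u - cfgV K k u ∈ uncoveredIdeal K k u := by
  cases u with
  | D p h =>
    rw [← vertD_eq]
    refine (dSystem K k).idem_sub_mem _ fun i q hq hi => ?_
    subst hq
    refine (congrArg (· ∈ _) (faceD_eq K k q h (Fin.castSucc ⟨i, hi⟩))).mpr ?_
    exact cfgA_mem_uncoveredIdeal K k (not_covers_dS q h ⟨i, hi⟩)
  | T q h =>
    rw [← vertT_eq]
    refine (tSystem (N := N) K k).idem_sub_mem (p := q + 1) _ fun i l hq hi => ?_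
    obtain ⟨l, rfl⟩ : ∃ j, l = j + 1 := ⟨l - 1, by omega⟩
    obtain rfl : q = l + 1 := by omega
    refine (congrArg (· ∈ _) (faceT_eq K k l h (Fin.castSucc ⟨i, hi⟩))).mpr ?_
    exact cfgA_mem_uncoveredIdeal K k (not_covers_tS l h ⟨i, hi⟩)
  | A r h =>
    rw [← vertA_eq]
    refine (aSystem K k).idem_sub_mem _ fun i q hq hi => ?_
    subst hq
    refine (congrArg (· ∈ _) (faceA_eq K k q h (Fin.castSucc ⟨i, hi⟩))).mpr ?_
    exact cfgA_mem_uncoveredIdeal K k (not_covers_aS q h ⟨i, hi⟩)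

/-- The coefficient of a normal form. -/
def wordCoeff {u v : CVert N} (w : Word N u v) : ConfigAlg K k N →ₗ[k] k :=
  Finsupp.lapply (w.dim (genericDim u)) ∘ₗ
    LinearMap.proj (R := k) (φ := fun v : CVert N => DimState v →₀ k) v ∘ₗ
      LinearMap.applyₗ (dimSingle k (genericDim u)) ∘ₗ (dimHom K k N).toLinearMap

theorem wordCoeff_apply {u v : CVert N} (w : Word N u v) (a : ConfigAlg K k N) :
    wordCoeff K k w a =
      dimHom K k N a (dimSingle k (genericDim u)) v (w.dim (genericDim u)) := rfl

theorem wordCoeff_eq_zero {u v : CVert N} (w : Word N u v) {a : ConfigAlg K k N}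
    (ha : a ∈ uncoveredIdeal K k u) : wordCoeff K k w a = 0 :=
  ha v _ w.covers

-- The functionals are dual to the normal forms. The idempotent may be replaced by the vertex, since
-- the coefficients are taken at covered dimension vectors only, and different normal forms send the
-- generic vector to different places.
open scoped Classical in
theorem wordCoeff_elt (w w' : Σ u v : CVert N, Word N u v) :
    wordCoeff K k w.2.2 (nrmIncl K k N (nrmHom K k N (w'.2.2.elt k))) =
      Finsupp.single w' 1 w := by
  obtain ⟨u, v, w⟩ := w
  obtain ⟨u', v', w'⟩ := w'
  rw [Word.elt, nrmIncl_nrmHom_bPath]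
  rcases eq_or_ne u' u with rfl | hu
  · have h1 : wordCoeff K k w (cfg K k w'.toPath.toCPath * (nrm K k u' - cfgV K k u')) = 0 :=
      wordCoeff_eq_zero K k w (Ideal.mul_mem_left _ _ (nrm_sub_mem_uncoveredIdeal K k u'))
    have h2 := congrArg (wordCoeff K k w) (mul_sub (cfg K k w'.toPath.toCPath) (nrm K k u')
      (cfgV K k u'))
    rw [cfg_mul_cfgV, map_sub] at h2
    replace h1 := sub_eq_zero.1 (h2.symm.trans h1)
    rw [h1, wordCoeff_apply, dimHom_cfg, dimEnd_dimSingle]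
    rcases eq_or_ne v v' with rfl | hv
    · rw [dimSingle, Pi.single_eq_same]
      rcases eq_or_ne w w' with rfl | hw
      · rw [Finsupp.single_eq_same]; exact Finsupp.single_eq_same
      · rw [Finsupp.single_eq_of_ne, Finsupp.single_eq_of_ne]
        · exact fun h => hw (by simpa using h)
        · exact fun h => hw (Word.dim_generic_injective h)
    · rw [dimSingle, Pi.single_eq_of_ne hv, Finsupp.zero_apply, Finsupp.single_eq_of_ne]
      rintro ⟨⟩
      exact hv rfl
  · rw [Finsupp.single_eq_of_ne (by rintro ⟨⟩; exact hu rfl), wordCoeff_apply, ← nrm_mul_cfgV,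
      map_mul, map_mul, dimHom_cfgV, Module.End.mul_apply, Module.End.mul_apply,
      dimEnd_dimSingle_of_ne k _ _ hu, map_zero, map_zero, Pi.zero_apply, Finsupp.zero_apply]

/-- An element is a combination of normal forms, and its coefficients can be recovered from its
image. -/
theorem nrmHom_injective (N : ℕ) : Function.Injective (nrmHom K k N) := by
  classical
  rw [injective_iff_map_eq_zero]
  intro z hz
  obtain ⟨l, rfl⟩ := wordSum_surjective k N z
  have key : ∀ (w : Σ u v : CVert N, Word N u v) (l : (Σ u v : CVert N, Word N u v) →₀ k),
      wordCoeff K k w.2.2 (nrmIncl K k N (nrmHom K k N (wordSum k N l))) = l w := by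
    intro w l
    induction l using Finsupp.induction_linear with
    | zero => simp only [map_zero, Finsupp.zero_apply]
    | add l l' h h' => simp only [map_add, h, h', Finsupp.add_apply]
    | single w' r =>
      rw [wordSum, Finsupp.linearCombination_single, map_smul, map_smul, map_smul, wordCoeff_elt,
        ← Finsupp.smul_apply, Finsupp.smul_single, smul_eq_mul, mul_one]
  have hl : l = 0 := Finsupp.ext fun w => by
    rw [← key w l, hz, map_zero, map_zero, Finsupp.zero_apply]
  rw [hl, map_zero]

/-- The corner is isomorphic to the algebra of complexes. -/
def nrmEquiv (N : ℕ) : ComplexAlg k N ≃ₐ[k] NrmAlg K k N :=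
  AlgEquiv.ofBijective (nrmHom K k N) ⟨nrmHom_injective K k N, nrmHom_surjective K k N⟩

end Independence

end

end

/-! ### The main theorem -/

theorem mainTheorem8 (n : ℕ) (hn : 3 ≤ n) (K : Type w) [Field K]
    (k : Type u) [CommRing k] [IsDomain k] [IsPrincipalIdealRing k] :
    IsQECwd K (n - 2) ∧
      IsMoritaEquivalent k (ConfigAlg K k (n - 2)) (ComplexAlg k (n - 2)) :=
  ⟨isQECwd K (n - 2), (isMoritaEquivalent_nrmAlg K k (n - 2)).trans k
    (.of_algEquiv k (nrmEquiv K k (n - 2)).symm)⟩
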